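/- **Conventions.** A *hyperbolic 3-manifold* is a (Hausdorff, second countable) 3-manifold $X$, possibly with boundary and not necessarily complete, equipped with a metric such that every point has a neighbourhood isometric to a subset of $\mathbb H^3$ (that is, with charts onto codimension-zero subsets of $\mathbb H^3$ whose transition maps are locally restrictions of isometries of $\mathbb H^3$); its distance $d$ is the path metric. For $A\subset X$ and $r\ge 0$ put $\mathcal N_r(A;X)=\{x\in X: d(x,A)\le r\}$, with $\mathcal N_r(\emptyset;X)=\emptyset$. A connected hyperbolic 3-manifold is *convex* if any two points of its universal cover are joined by a geodesic of the universal cover. If $A\subset N$ are hyperbolic 3-manifolds (with $A$ carrying the topology and local metric induced from $N$), then $N$ is a *thickening* of $A$ if the inclusion $A\hookrightarrow N$ is a homotopy equivalence, and a *convex thickening* if moreover $N$ is convex. For a connected hyperbolic 3-manifold $A$ that has a convex thickening, the developing map identifies the universal cover $\widetilde A$ with a subset of $\mathbb H^3$; let $\Gamma\le \operatorname{Isom}(\mathbb H^3)$ be the holonomy group of $A$, and put $$\operatorname{CH}(A)=\operatorname{CH}(\widetilde A)/\Gamma\subset \mathbb H^3/\Gamma,\qquad \operatorname{Th}_r(A)=\mathcal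 N_r(\widetilde A;\mathbb H^3)/\Gamma\subset\mathbb H^3/\Gamma\quad(A\text{ convex}),$$ where $\operatorname{CH}(\widetilde A)$ is the intersection of all convex subsets of $\mathbb H^3$ that contain $\widetilde A$. For a hyperbolic 3-manifold $Z\supset A$ and a set $S$ with $A\subset S\subset\mathbb H^3/\Gamma$, the assertion $S\subset Z$ means that the inclusion $A\hookrightarrow Z$ extends to a locally isometric topological embedding $S\hookrightarrow Z$, by which $S$ is identified with a subset of $Z$. **Theorem.** For every $\epsilon>0$ there is $R=R(\epsilon)>8$ such that the following holds. Let $m\ge 0$ and suppose that 1. $Y=Y_0\cup\dots\cup Y_m$ and $M=M_0\cup\dots\cup M_m\subset Y$ are connected hyperbolic 3-manifolds; 2. $M_i$ and $Y_i$ are convex hyperbolic 3-manifolds, and $Y_i\supset M_i$ is a thickening of $M_i$, for each $i$; 3. $Y_i\supset\operatorname{Th}_8(M_i)$ for each $i$; 4. if $Y_i\cap Y_j\ne\emptyset$, then $i=j$ or one of $i,j$ is $0$; 5. every component of $Y_i\cap Y_j$ contains a point of $M_i\cap M_j$, for all $i,j$. Then $M$ has a convex thickening (so that $\operatorname{CH}(M)$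 is defined), $\operatorname{CH}(M)\subset Y$, and $$\operatorname{CH}(M)\ \subset\ \mathcal N_\epsilon(M_0;Y)\ \cup\ \mathcal N_R(M_1\cup\dots\cup M_m;Y).$$ -/

import Mathlib

open Set Filter Topology
open scoped ENNReal ContinuousMap

universe u

/-! ## Hyperbolic 3-space -/

/-- Hyperbolic 3-space `ℍ³`, in the hyperboloid model. The vector `v ∈ ℝ³` stands for the point
`(√(1 + ‖v‖²), v)` of the upper sheet `{(t, v) | t² = 1 + ‖v‖², t > 0}` in Minkowski space. -/
@[ext] structure H3 where
  vec : EuclideanSpace ℝ (Fin 3)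

namespace H3

/-- The time coordinate on the hyperboloid. -/
noncomputable def time (p : H3) : ℝ := Real.sqrt (1 + ‖p.vec‖ ^ 2)

/-- The Lorentzian pairing `t s - ⟨v, w⟩` of two points of the hyperboloid; it is the hyperbolic
cosine of their distance. -/
noncomputable def pairing (p q : H3) : ℝ := p.time * q.time - inner ℝ p.vec q.vec

lemma time_sq (p : H3) : p.time ^ 2 = 1 + ‖p.vec‖ ^ 2 :=
  Real.sq_sqrt (by positivity)

lemma time_pos (p : H3) : 0 < p.time := Real.sqrt_pos.2 (by positivity)

lemma pairing_comm (p q : H3) : p.pairing q = q.pairing p := by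
  unfold pairing; rw [mul_comm, real_inner_comm]

lemma pairing_self (p : H3) : p.pairing p = 1 := by
  unfold pairing
  have := time_sq p
  rw [real_inner_self_eq_norm_sq]; nlinarith

/-- Positivity of the Minkowski form on the orthogonal complement of a point of the hyperboloid. -/
lemma inner_sq_le (p : H3) (z : EuclideanSpace ℝ (Fin 3)) :
    (inner ℝ z p.vec) ^ 2 ≤ ‖z‖ ^ 2 * p.time ^ 2 := by
  have h := abs_real_inner_le_norm z p.vec
  have h2 : (inner ℝ z p.vec) ^ 2 ≤ (‖z‖ * ‖p.vec‖) ^ 2 := by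
    rw [← sq_abs]; gcongr
  rw [time_sq]
  nlinarith [sq_nonneg ‖z‖]

lemma one_le_pairing (p q : H3) : 1 ≤ p.pairing q := by
  have hp := time_sq p
  have hq := time_sq q
  have h := real_inner_le_norm p.vec q.vec
  have hpos := mul_pos p.time_pos q.time_pos
  have key : 1 + ‖p.vec‖ * ‖q.vec‖ ≤ p.time * q.time := by
    apply le_of_sq_le_sq _ hpos.le
    rw [mul_pow, hp, hq]
    nlinarith [sq_nonneg (‖p.vec‖ - ‖q.vec‖)]
  unfold pairing; linarith

lemma pairing_aux (u v w : H3) :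
    (u.pairing w - u.pairing v * v.pairing w) ^ 2
      ≤ ((u.pairing v) ^ 2 - 1) * ((v.pairing w) ^ 2 - 1) := by
  have hu := time_sq u
  have hv := time_sq v
  have hw := time_sq w
  have hvpos : 0 < v.time ^ 2 := by have := v.time_pos; positivity
  obtain ⟨a, ha⟩ : ∃ a, a = u.time := ⟨_, rfl⟩
  obtain ⟨b, hb⟩ : ∃ b, b = v.time := ⟨_, rfl⟩
  obtain ⟨c, hc⟩ : ∃ c, c = w.time := ⟨_, rfl⟩
  obtain ⟨x, hx⟩ : ∃ x, x = u.vec - u.pairing v • v.vec := ⟨_, rfl⟩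
  obtain ⟨y, hy⟩ : ∃ y, y = w.vec - v.pairing w • v.vec := ⟨_, rfl⟩
  have hq : ∀ t : ℝ, 0 ≤ (‖y‖ ^ 2 * v.time ^ 2 - (inner ℝ y v.vec) ^ 2) * (t * t)
      + (2 * (inner ℝ x y * v.time ^ 2 - inner ℝ x v.vec * inner ℝ y v.vec)) * t
      + (‖x‖ ^ 2 * v.time ^ 2 - (inner ℝ x v.vec) ^ 2) := by
    intro t
    have h := inner_sq_le v (x + t • y)
    rw [norm_add_sq_real, inner_add_left, real_inner_smul_left, real_inner_smul_right,
      norm_smul, mul_pow, Real.norm_eq_abs, sq_abs] at h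
    nlinarith [h]
  have hd := discrim_le_zero hq
  unfold discrim at hd
  have exv : inner ℝ x v.vec = (a - u.pairing v * b) * b := by
    rw [hx, inner_sub_left, real_inner_smul_left, real_inner_self_eq_norm_sq]
    simp only [pairing, ← ha, ← hb] at hv ⊢
    have : ‖v.vec‖ ^ 2 = b ^ 2 - 1 := by linarith
    rw [this]; ring
  have eyv : inner ℝ y v.vec = (c - v.pairing w * b) * b := by
    rw [hy, inner_sub_left, real_inner_smul_left, real_inner_self_eq_norm_sq,
      real_inner_comm v.vec w.vec]
    simp only [pairing, ← hc, ← hb] at hv ⊢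
    have : ‖v.vec‖ ^ 2 = b ^ 2 - 1 := by linarith
    rw [this]; ring
  have exx : ‖x‖ ^ 2 = (u.pairing v) ^ 2 - 1 + (a - u.pairing v * b) ^ 2 := by
    rw [hx, norm_sub_sq_real, real_inner_smul_right, norm_smul, mul_pow, Real.norm_eq_abs, sq_abs]
    simp only [pairing, ← ha, ← hb] at hv hu ⊢
    have h1 : ‖v.vec‖ ^ 2 = b ^ 2 - 1 := by linarith
    have h2 : ‖u.vec‖ ^ 2 = a ^ 2 - 1 := by linarith
    rw [h1, h2]; ring
  have eyy : ‖y‖ ^ 2 = (v.pairing w) ^ 2 - 1 + (c - v.pairing w * b) ^ 2 := by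
    rw [hy, norm_sub_sq_real, real_inner_smul_right, norm_smul, mul_pow, Real.norm_eq_abs, sq_abs,
      real_inner_comm v.vec w.vec]
    simp only [pairing, ← hc, ← hb] at hv hw ⊢
    have h1 : ‖v.vec‖ ^ 2 = b ^ 2 - 1 := by linarith
    have h2 : ‖w.vec‖ ^ 2 = c ^ 2 - 1 := by linarith
    rw [h1, h2]; ring
  have exy : inner ℝ x y = u.pairing v * v.pairing w - u.pairing w
      + (a - u.pairing v * b) * (c - v.pairing w * b) := by
    rw [hx, hy]
    simp only [inner_sub_left, inner_sub_right, real_inner_smul_left, real_inner_smul_right,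
      real_inner_self_eq_norm_sq]
    simp only [pairing, ← ha, ← hc, ← hb] at hv ⊢
    have h1 : ‖v.vec‖ ^ 2 = b ^ 2 - 1 := by linarith
    rw [h1]; ring
  rw [exv, eyv, exx, eyy, exy, ← hb] at hd
  rw [← hb] at hvpos
  have hd' : (b ^ 2) ^ 2 * (u.pairing w - u.pairing v * v.pairing w) ^ 2
      ≤ (b ^ 2) ^ 2 * (((u.pairing v) ^ 2 - 1) * ((v.pairing w) ^ 2 - 1)) := by
    nlinarith [hd]
  exact le_of_mul_le_mul_left hd' (by positivity)

lemma arcosh_pairing_triangle (u v w : H3) :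
    Real.arcosh (u.pairing w) ≤ Real.arcosh (u.pairing v) + Real.arcosh (v.pairing w) := by
  have h1 := one_le_pairing u v
  have h2 := one_le_pairing v w
  have h3 := one_le_pairing u w
  have hs := add_nonneg (Real.arcosh_nonneg h1) (Real.arcosh_nonneg h2)
  rw [← Real.arcosh_cosh hs, Real.arcosh_le_arcosh (by linarith) (Real.cosh_pos _), Real.cosh_add,
    Real.cosh_arcosh h1, Real.cosh_arcosh h2, Real.sinh_arcosh h1, Real.sinh_arcosh h2,
    ← Real.sqrt_mul (by nlinarith)]
  have := Real.le_sqrt_of_sq_le (pairing_aux u v w)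
  linarith

lemma eq_of_pairing_eq_one {p q : H3} (h : p.pairing q = 1) : p = q := by
  have hp := time_sq p
  have hq := time_sq q
  have h1 := time_pos p
  have h2 := time_pos q
  have hi := real_inner_le_norm p.vec q.vec
  have hn : ‖p.vec - q.vec‖ ^ 2 = (p.time - q.time) ^ 2 := by
    rw [norm_sub_sq_real]; unfold pairing at h; nlinarith
  have ht : p.time = q.time := by
    have e : p.time * q.time ≤ 1 + ‖p.vec‖ * ‖q.vec‖ := by unfold pairing at h; linarith
    have e2 : (p.time * q.time) ^ 2 ≤ (1 + ‖p.vec‖ * ‖q.vec‖) ^ 2 := by gcongr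
    rw [mul_pow, hp, hq] at e2
    have e3 : (‖p.vec‖ - ‖q.vec‖) ^ 2 ≤ 0 := by nlinarith
    have e4 : ‖p.vec‖ = ‖q.vec‖ := by
      have := pow_eq_zero_iff (two_ne_zero) |>.1 (le_antisymm e3 (sq_nonneg _)); linarith
    unfold time; rw [e4]
  rw [ht, sub_self] at hn
  have : p.vec - q.vec = 0 := by
    rw [← norm_eq_zero]; exact pow_eq_zero_iff (two_ne_zero) |>.1 (by simpa using hn)
  exact H3.ext (sub_eq_zero.1 this)

/-- The hyperbolic metric (of curvature `-1`): `cosh d(p, q)` is the Lorentzian pairing. -/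
noncomputable instance : MetricSpace H3 where
  dist p q := Real.arcosh (p.pairing q)
  dist_self p := by rw [pairing_self]; exact (Real.arcosh_eq_zero_iff le_rfl).2 rfl
  dist_comm p q := by rw [pairing_comm]
  dist_triangle := arcosh_pairing_triangle
  eq_of_dist_eq_zero {p q} h :=
    eq_of_pairing_eq_one ((Real.arcosh_eq_zero_iff (one_le_pairing p q)).1 h)

/-- A subset of `ℍ³` is convex if it contains the geodesic segment
`[p, q] = {z | d(p, z) + d(z, q) = d(p, q)}` between any two of its points. -/
def GeodConvex (S : Set H3) : Prop :=
  ∀ p ∈ S, ∀ q ∈ S, ∀ z : H3, dist p z + dist z q = dist p q → z ∈ S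

/-- The convex hull of a subset of `ℍ³`. -/
def hull (A : Set H3) : Set H3 := ⋂₀ {S | GeodConvex S ∧ A ⊆ S}

end H3

/-! ## Hyperbolic 3-manifolds, possibly incomplete and with boundary -/

/-- A chart of `X` with values in `ℍ³`: a homeomorphism from an open subset of `X` onto a (not
necessarily open) subset of `ℍ³`. The values outside `source` are irrelevant. -/
structure HypChart (X : Type u) [TopologicalSpace X] where
  source : Set X
  toFun : X → H3
  isOpen_source : IsOpen source
  isEmbedding : IsEmbedding (source.domRestrict toFun)

/-- An atlas of charts onto subsets of `ℍ³` whose transition maps are locally restrictions of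
isometries of `ℍ³`. -/
class HypStructure (X : Type u) [TopologicalSpace X] where
  atlas : Set (HypChart X)
  cover : ∀ x : X, ∃ c ∈ atlas, x ∈ c.source
  compat : ∀ c ∈ atlas, ∀ c' ∈ atlas, ∀ x ∈ c.source ∩ c'.source,
    ∃ g : H3 ≃ᵢ H3, ∀ᶠ y in 𝓝 x, c'.toFun y = g (c.toFun y)

/-- Restriction of a chart to a subset. -/
def HypChart.restrict {X : Type u} [TopologicalSpace X] (c : HypChart X) (A : Set X) :
    HypChart A where
  source := Subtype.val ⁻¹' c.source
  toFun a := c.toFun a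
  isOpen_source := c.isOpen_source.preimage continuous_subtype_val
  isEmbedding := by
    have h : IsEmbedding (fun a : (Subtype.val ⁻¹' c.source : Set A) =>
        (⟨a.1.1, a.2⟩ : c.source)) := by
      have h' : IsEmbedding (fun a : (Subtype.val ⁻¹' c.source : Set A) => (a.1.1 : X)) :=
        IsEmbedding.subtypeVal.comp IsEmbedding.subtypeVal
      exact IsEmbedding.of_comp (by fun_prop) continuous_subtype_val h'
    exact c.isEmbedding.comp h

/-- A subset of a space with a hyperbolic structure carries the restricted charts. -/
instance HypStructure.subset {X : Type u} [TopologicalSpace X] [HypStructure X] (A : Set X) :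
    HypStructure A where
  atlas := (fun c => c.restrict A) '' HypStructure.atlas
  cover x := by
    obtain ⟨c, hc, hx⟩ := HypStructure.cover x.1
    exact ⟨_, ⟨c, hc, rfl⟩, hx⟩
  compat := by
    rintro _ ⟨c, hc, rfl⟩ _ ⟨c', hc', rfl⟩ x hx
    obtain ⟨g, hg⟩ := HypStructure.compat c hc c' hc' x.1 hx
    exact ⟨g, (continuous_subtype_val.tendsto x).eventually hg⟩

/-- `X` is a hyperbolic 3-manifold: a (Hausdorff, second countable) 3-manifold, possibly with
boundary, each of whose points has a neighbourhood isometric to a subset of `ℍ³`. These subsets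
have codimension zero: they lie in the closure of their interior (for 3-manifolds this is
automatic, by invariance of domain). Neither connected nor complete in general. -/
structure IsHyp3Manifold (X : Type u) [TopologicalSpace X] [HypStructure X] : Prop where
  t2 : T2Space X
  secondCountable : SecondCountableTopology X
  manifold : Nonempty (ChartedSpace (EuclideanHalfSpace 3) X)
  codimZero : ∀ c ∈ HypStructure.atlas (X := X),
    c.toFun '' c.source ⊆ closure (interior (c.toFun '' c.source))

section Geometry

variable {X : Type u} [TopologicalSpace X] [HypStructure X]

/-- `φ` is, near `x`, a chart of the maximal atlas: a chart of the atlas followed by an isometry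
of `ℍ³`. Only the germ of `φ` at `x` matters. -/
def IsChartAt (φ : X → H3) (x : X) : Prop :=
  ∃ c ∈ HypStructure.atlas (X := X), x ∈ c.source ∧
    ∃ g : H3 ≃ᵢ H3, ∀ᶠ y in 𝓝 x, φ y = g (c.toFun y)

/-- `Φ t` (`t ∈ [0, 1]`) is an analytic continuation of chart germs along the path `γ`. The path
`t ↦ Φ t (γ t)` in `ℍ³` is then the development of `γ`. -/
def IsContinuation {x y : X} (γ : Path x y) (Φ : unitInterval → X → H3) : Prop :=
  ∀ t : unitInterval, IsChartAt (Φ t) (γ t) ∧ ∀ᶠ s in 𝓝 t, Φ s =ᶠ[𝓝 (γ s)] Φ t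

/-- A path is a (constant speed) geodesic if in charts it is locally a constant speed geodesic
of `ℍ³`. -/
def IsGeodesicPath {x y : X} (γ : Path x y) : Prop :=
  ∃ v : ℝ, ∀ t : unitInterval, ∃ φ : X → H3, IsChartAt φ (γ t) ∧ ∃ U ∈ 𝓝 t, ∀ s ∈ U, ∀ s' ∈ U,
    dist (φ (γ s)) (φ (γ s')) = v * dist s s'

/-- The path metric of a hyperbolic 3-manifold: the infimum of the lengths of paths, the length
of a path being the length of its development in `ℍ³`. -/
noncomputable def hypEDist (x y : X) : ℝ≥0∞ :=
  ⨅ (γ : Path x y) (Φ : unitInterval → X → H3) (_ : IsContinuation γ Φ),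
    eVariationOn (fun t : unitInterval => Φ t (γ t)) univ

/-- The closed `r`-neighbourhood `𝒩_r(A; X)` of `A` in `X`. -/
def hypNhd (r : ℝ) (A : Set X) : Set X := {x | ⨅ a ∈ A, hypEDist x a ≤ ENNReal.ofReal r}

variable (X) in
/-- The points of the universal cover of `X` based at `x₀`: homotopy classes, relative to the
endpoints, of paths that start at `x₀`. -/
def UnivCover (x₀ : X) : Type u := Σ x : X, Path.Homotopic.Quotient x₀ x

/-- Two points of the universal cover are joined by a geodesic of the universal cover, that is,
by the lift of a geodesic of `X`. -/
def UnivCover.JoinedByGeodesic {x₀ : X} (a b : UnivCover X x₀) : Prop :=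
  ∃ σ : Path a.1 b.1, IsGeodesicPath σ ∧ a.2.trans (Path.Homotopic.Quotient.mk σ) = b.2

end Geometry

/-- A convex hyperbolic 3-manifold: connected, and any two points of the universal cover are
joined by a geodesic. -/
structure IsConvexHyp3Manifold (X : Type u) [TopologicalSpace X] [HypStructure X] : Prop where
  manifold : IsHyp3Manifold X
  connected : ConnectedSpace X
  convex : ∀ (x₀ : X) (a b : UnivCover X x₀), a.JoinedByGeodesic b

/-- An inclusion of hyperbolic 3-manifolds: a topological embedding that is a local isometry
(charts pull back to charts). -/
structure IsIsometricInclusion {A N : Type u} [TopologicalSpace A] [HypStructure A]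
    [TopologicalSpace N] [HypStructure N] (i : A → N) : Prop where
  isEmbedding : IsEmbedding i
  localIsometry : ∀ (x : A) (φ : N → H3), IsChartAt φ (i x) → IsChartAt (φ ∘ i) x

/-- `N`, with the inclusion `i : A → N`, is a thickening of `A`: the inclusion is a homotopy
equivalence. -/
def IsThickening {A N : Type u} [TopologicalSpace A] [HypStructure A]
    [TopologicalSpace N] [HypStructure N] (i : A → N) : Prop :=
  IsIsometricInclusion i ∧ ∃ e : A ≃ₕ N, (e : A → N) = i

/-- `A` has a convex thickening. -/
def HasConvexThickening (A : Type u) [TopologicalSpace A] [HypStructure A] : Prop :=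
  ∃ (N : Type u) (_ : TopologicalSpace N) (_ : HypStructure N) (i : A → N),
    IsConvexHyp3Manifold N ∧ IsThickening i

/-! ## Developing map, holonomy, universal thickening, convex hull -/

/-- A base point of `A` together with a chart germ there; this fixes the developing map and the
holonomy representation. -/
structure BaseGerm (A : Type u) [TopologicalSpace A] [HypStructure A] where
  pt : A
  chart : A → H3
  isChartAt : IsChartAt chart pt

namespace BaseGerm

variable {A : Type u} [TopologicalSpace A] [HypStructure A] (b : BaseGerm A)

/-- The analytic continuation of the base germ along `γ` ends with the germ of `ψ`. The developing
map sends the point `[γ]` of the universal cover to `ψ y`. -/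
def ContinuesTo {y : A} (γ : Path b.pt y) (ψ : A → H3) : Prop :=
  ∃ Φ : unitInterval → A → H3, IsContinuation γ Φ ∧ Φ 0 =ᶠ[𝓝 b.pt] b.chart ∧ Φ 1 =ᶠ[𝓝 y] ψ

/-- The image in `ℍ³` of the universal cover of `A` under the developing map. -/
def devImage : Set H3 :=
  {p | ∃ (y : A) (γ : Path b.pt y) (ψ : A → H3), b.ContinuesTo γ ψ ∧ p = ψ y}

/-- The holonomy group `Γ ≤ Isom ℍ³` of `A`: the isometries `g` such that continuation of the base
germ `φ` along some loop ends with the germ `g ∘ φ`. (These already form a subgroup.) -/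
noncomputable def holonomy : Subgroup (H3 ≃ᵢ H3) :=
  Subgroup.closure {g | ∃ γ : Path b.pt b.pt, b.ContinuesTo γ (g ∘ b.chart)}

/-- The orbit relation of the holonomy group on `ℍ³`. -/
noncomputable def orbitSetoid : Setoid H3 where
  r p q := ∃ g ∈ b.holonomy, g p = q
  iseqv := ⟨fun _ => ⟨1, one_mem _, rfl⟩,
    fun {p q} ⟨g, hg, h⟩ => ⟨g⁻¹, inv_mem hg, by rw [← h]; exact g.symm_apply_apply p⟩,
    fun {p q s} ⟨g, hg, h⟩ ⟨g', hg', h'⟩ => ⟨g' * g, mul_mem hg' hg, by rw [← h', ← h]; rfl⟩⟩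

/-- The universal thickening `Th_∞(A) = ℍ³ / Γ`, with the quotient topology. -/
def UnivThickening : Type := Quotient b.orbitSetoid

instance : TopologicalSpace b.UnivThickening :=
  inferInstanceAs (TopologicalSpace (Quotient b.orbitSetoid))

/-- The projection `ℍ³ → ℍ³ / Γ`. -/
noncomputable def proj (p : H3) : b.UnivThickening := Quotient.mk b.orbitSetoid p

/-- The `r`-thickening `Th_r(A) = 𝒩_r(Ã; ℍ³) / Γ` of a convex `A`, where `Ã ⊆ ℍ³` through the
developing map. -/
def thickening (r : ℝ) : Set b.UnivThickening := b.proj '' Metric.cthickening r b.devImage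

/-- The convex hull `CH(A) = CH(Ã) / Γ` of an `A` that has a convex thickening, where `Ã ⊆ ℍ³`
through the developing map. -/
def convexHull : Set b.UnivThickening := b.proj '' H3.hull b.devImage

/-- Let `A` be included in `Z` by `i`, and let `S` be a subset of `ℍ³ / Γ`. Then `j : S → Z`
realizes `S` as a subset of `Z`, if it is a topological embedding, a local isometry, and extends
the inclusion of `A`. Here a point `y` of `A` is the class in `ℍ³ / Γ` of its images under the
developing map. -/
structure IsRealization {Z : Type u} [TopologicalSpace Z] [HypStructure Z]
    (i : A → Z) (S : Set b.UnivThickening) (j : S → Z) : Prop where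
  isEmbedding : IsEmbedding j
  localIsometry : ∀ (p : H3) (hp : b.proj p ∈ S), ∃ ψ : Z → H3, IsChartAt ψ (j ⟨b.proj p, hp⟩) ∧
    ∀ᶠ q in 𝓝 p, ∀ hq : b.proj q ∈ S, ψ (j ⟨b.proj q, hq⟩) = q
  extends_inclusion : ∀ (y : A) (γ : Path b.pt y) (ψ : A → H3), b.ContinuesTo γ ψ →
    ∃ h : b.proj (ψ y) ∈ S, j ⟨b.proj (ψ y), h⟩ = i y

end BaseGerm

/-!
The argument takes place in `ℍ³`. The germs of all charts of `Y` form a covering `GermSpace Y` of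
`Y`, on whose fibres the discrete group `Isom(ℍ³)` acts simply transitively, with a tautological
locally injective developing map `dev`. It replaces universal covers: the component of a germ over
`M = ⋃ Mᵢ` (`Decomposition.hat`) covers `M`, and its stabilizer in `Isom(ℍ³)` is the holonomy
group.

A *piece* is a component of the germs over some `Yᵢ`. Its *model* is the developing image of the
part over `Mᵢ`. As `Yᵢ` is convex, `dev` is injective on pieces, since two germs are joined by a
geodesic that develops to a segment; as `Mᵢ` is convex and `Mᵢ ↪ Yᵢ` is surjective on fundamental
groups, models are convex; as `Yᵢ` contains the `8`-neighbourhood of `Mᵢ`, the `8`-neighbourhood of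
a model lifts back into its piece (`ThickPair.exists_section`). If two pieces meet, they meet over
`Mᵢ ∩ Mⱼ`, and their lifts agree where the two neighbourhoods overlap. Of two different pieces that
meet, exactly one has index zero. So for three consecutive pieces of a chain without backtracking
the `8`-neighbourhoods of the models have no common point: there the three pieces would meet
pairwise. This structure is a `ConvexPattern`.

The geometry is that of such patterns. Take a chain of convex sets that meet consecutively, such
that the `3`-neighbourhoods of any three consecutive ones have no common point. Then a segment from
the first set to the last has, for each two consecutive sets, a point within `3/2` of both, by thin
triangles and the exponential divergence of geodesics from convex sets (`H3.exists_near_of_chain`).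
Two consequences follow for the pieces that a chain connects to a given one. Pieces whose models
are within `5` of a common point are equal or meet (`ConvexPattern.eq_or_adj`). Joining points by
segments increases the distance from the models by at most `3/2`, and three joins produce the
convex hull in dimension three, so that the hull of the `1/4`-neighbourhoods stays within `1/4 + 3
* 3/2 = 19/4` of the models (`ConvexPattern.hull_nhd_subset`). This needs separated neighbourhoods
of radius up to `5 + 3 = 8`. The distance from a convex set along a segment decays like `exp (-D)`
at depth `D`, which yields the finer estimate with `ε` and `R` (`ConvexPattern.hull_subset_fine`).

The lifts of the `5`-neighbourhoods of the models therefore glue to a map from an open convex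
neighbourhood `dom` of the developing image of `M` to the space of germs (`Decomposition.lift`). It
is equivariant and injective modulo the holonomy, so it embeds the quotient in `Y`, which realizes
the convex hull (`Decomposition.isRealization`). The image `hullNhd` of `dom` is a convex open
submanifold of `Y`. To see that it is a thickening of `M`, the points of `dom` are pushed into the
models: near each point a constant map to a common point of the at most two models nearby will do,
and these maps are averaged with a partition of unity on `hullNhd` and equivariant weighted centres
in the hyperboloid model (`Decomposition.exists_equivariant`). Moving along segments descends to
the deformation (`Decomposition.exists_homotopyEquiv`).
-/

namespace H3

/-- The Minkowski form of signature `(1, 3)` on `ℝ × ℝ³`. -/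
noncomputable def mink (u v : ℝ × EuclideanSpace ℝ (Fin 3)) : ℝ := u.1 * v.1 - inner ℝ u.2 v.2

/-- A point of `ℍ³` as a vector of Minkowski space, on the hyperboloid. -/
noncomputable def lin (p : H3) : ℝ × EuclideanSpace ℝ (Fin 3) := (p.time, p.vec)

variable {u v w : ℝ × EuclideanSpace ℝ (Fin 3)} {p q z : H3} {c s t : ℝ}

lemma mink_comm (u v) : mink u v = mink v u := by
  unfold mink; rw [mul_comm, real_inner_comm]

@[simp] lemma mink_add_left (u v w) : mink (u + v) w = mink u w + mink v w := by
  simp only [mink, Prod.fst_add, Prod.snd_add, inner_add_left]; ring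

@[simp] lemma mink_smul_left (c : ℝ) (u v) : mink (c • u) v = c * mink u v := by
  simp only [mink, Prod.smul_fst, Prod.smul_snd, real_inner_smul_left, smul_eq_mul]; ring

@[simp] lemma mink_add_right (u v w) : mink u (v + w) = mink u v + mink u w := by
  rw [mink_comm, mink_add_left, mink_comm v, mink_comm w]

@[simp] lemma mink_smul_right (c : ℝ) (u v) : mink u (c • v) = c * mink u v := by
  rw [mink_comm, mink_smul_left, mink_comm]

@[simp] lemma mink_sub_left (u v w) : mink (u - v) w = mink u w - mink v w := by
  simp only [mink, Prod.fst_sub, Prod.snd_sub, inner_sub_left]; ring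

@[simp] lemma mink_sub_right (u v w) : mink u (v - w) = mink u v - mink u w := by
  rw [mink_comm, mink_sub_left, mink_comm v, mink_comm w]

@[simp] lemma mink_lin (p q : H3) : mink p.lin q.lin = p.pairing q := rfl

lemma lin_injective : Function.Injective lin := fun _ _ h => H3.ext (congrArg Prod.snd h)

lemma mink_sum_left {ι : Type*} (s : Finset ι) (f : ι → ℝ × EuclideanSpace ℝ (Fin 3)) (v) :
    mink (∑ i ∈ s, f i) v = ∑ i ∈ s, mink (f i) v := by
  classical
  induction s using Finset.induction_on with
  | empty => simp [mink]
  | insert a s ha ih => rw [Finset.sum_insert ha, Finset.sum_insert ha, mink_add_left, ih]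

/-- The Minkowski form is negative semidefinite on the orthogonal complement of a point. -/
lemma mink_self_nonpos (h : mink u p.lin = 0) : mink u u ≤ 0 := by
  have h1 := inner_sq_le p u.2
  have h2 : u.1 * p.time = inner ℝ u.2 p.vec := by
    have : u.1 * p.time - inner ℝ u.2 p.vec = 0 := h
    linarith
  rw [← h2, mul_pow] at h1
  have h3 : u.1 ^ 2 ≤ ‖u.2‖ ^ 2 :=
    le_of_mul_le_mul_right h1 (by have := p.time_pos; positivity)
  unfold mink
  rw [real_inner_self_eq_norm_sq]; nlinarith

lemma mink_sq_le (hu : mink u p.lin = 0) (hv : mink v p.lin = 0) :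
    mink u v ^ 2 ≤ mink u u * mink v v := by
  have hq : ∀ t : ℝ, 0 ≤ -mink v v * (t * t) + -(2 * mink u v) * t + -mink u u := by
    intro t
    have h : mink (u + t • v) (u + t • v) ≤ 0 := mink_self_nonpos (p := p) (by simp [hu, hv])
    simp only [mink_add_left, mink_add_right, mink_smul_left, mink_smul_right,
      mink_comm v u] at h
    nlinarith
  have hd := discrim_le_zero hq
  unfold discrim at hd
  nlinarith

lemma cosh_dist (p q : H3) : Real.cosh (dist p q) = p.pairing q :=
  Real.cosh_arcosh (one_le_pairing p q)

lemma pairing_sq_sub_one (p q : H3) : p.pairing q ^ 2 - 1 = Real.sinh (dist p q) ^ 2 := by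
  rw [← cosh_dist, Real.cosh_sq]; ring

lemma dist_eq_of_cosh {r : ℝ} (hr : 0 ≤ r) (h : p.pairing q = Real.cosh r) : dist p q = r := by
  rw [← cosh_dist] at h
  exact Real.cosh_injOn dist_nonneg hr h

lemma dist_le_iff {r : ℝ} (hr : 0 ≤ r) : dist p q ≤ r ↔ p.pairing q ≤ Real.cosh r := by
  rw [← cosh_dist, Real.cosh_le_cosh, abs_of_nonneg dist_nonneg, abs_of_nonneg hr]

lemma pairing_isometry (g : H3 ≃ᵢ H3) (p q : H3) : (g p).pairing (g q) = p.pairing q := by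
  rw [← cosh_dist, ← cosh_dist, g.dist_eq]

/-- The point of `ℍ³` on the ray through a future-pointing timelike vector. -/
noncomputable def normalize (u : ℝ × EuclideanSpace ℝ (Fin 3)) : H3 :=
  ⟨(Real.sqrt (mink u u))⁻¹ • u.2⟩

lemma lin_normalize (h : 0 < mink u u) (h1 : 0 < u.1) :
    (normalize u).lin = (Real.sqrt (mink u u))⁻¹ • u := by
  refine Prod.ext ?_ rfl
  have hs : Real.sqrt (mink u u) ^ 2 = mink u u := Real.sq_sqrt h.le
  have hs' : 0 < Real.sqrt (mink u u) := Real.sqrt_pos.2 h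
  change Real.sqrt (1 + ‖(Real.sqrt (mink u u))⁻¹ • u.2‖ ^ 2) = (Real.sqrt (mink u u))⁻¹ * u.1
  rw [Real.sqrt_eq_iff_mul_self_eq (by positivity) (by positivity), norm_smul, Real.norm_eq_abs,
    abs_of_nonneg (by positivity)]
  have e : mink u u = u.1 ^ 2 - ‖u.2‖ ^ 2 := by
    unfold mink; rw [real_inner_self_eq_norm_sq]; ring
  field_simp
  rw [hs, e]; ring

lemma exists_lin_eq (h : mink u u = 1) (h1 : 0 < u.1) : ∃ p : H3, p.lin = u :=
  ⟨normalize u, by rw [lin_normalize (by rw [h]; norm_num) h1, h]; simp⟩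

/-! ### Segments -/

/-- `z` lies on the geodesic segment `[p, q]`. -/
def Btw (p z q : H3) : Prop := dist p z + dist z q = dist p q

lemma Btw.symm (h : Btw p z q) : Btw q z p := by
  unfold Btw at *; rw [dist_comm q z, dist_comm z p, dist_comm q p]; linarith

lemma btw_left (p q : H3) : Btw p p q := by simp [Btw]

lemma btw_right (p q : H3) : Btw p q q := by simp [Btw]

lemma btw_self_iff : Btw p z p ↔ z = p := by
  constructor
  · intro h
    unfold Btw at h
    rw [dist_self, dist_comm z p] at h
    have : dist p z = 0 := by linarith
    exact (dist_eq_zero.1 this).symm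
  · rintro rfl; simp [Btw]

lemma Btw.map (h : Btw p z q) (g : H3 ≃ᵢ H3) : Btw (g p) (g z) (g q) := by
  unfold Btw at *; simpa only [g.dist_eq] using h

/-- The law of sines form of a point on a segment. -/
lemma Btw.lin_eq (h : Btw p z q) :
    Real.sinh (dist p q) • z.lin
      = Real.sinh (dist z q) • p.lin + Real.sinh (dist p z) • q.lin := by
  unfold Btw at h
  obtain ⟨a, ha⟩ : ∃ a, a = dist p z := ⟨_, rfl⟩
  obtain ⟨b, hb⟩ : ∃ b, b = dist z q := ⟨_, rfl⟩
  have ha0 : 0 ≤ a := ha ▸ dist_nonneg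
  have hb0 : 0 ≤ b := hb ▸ dist_nonneg
  rw [← h, ← ha, ← hb]
  rcases eq_or_lt_of_le (add_nonneg ha0 hb0) with h0 | h0
  · have h1 : a = 0 := by linarith
    have h2 : b = 0 := by linarith
    simp [h1, h2]
  have hS : 0 < Real.sinh (a + b) := Real.sinh_pos_iff.2 h0
  have hsa : 0 ≤ Real.sinh a := Real.sinh_nonneg_iff.2 ha0
  have hsb : 0 ≤ Real.sinh b := Real.sinh_nonneg_iff.2 hb0
  have hpq : p.pairing q = Real.cosh (a + b) := by rw [← cosh_dist, ← h, ha, hb]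
  have hzp : z.pairing p = Real.cosh a := by rw [← cosh_dist, dist_comm, ha]
  have hzq : z.pairing q = Real.cosh b := by rw [← cosh_dist, hb]
  have hca := Real.cosh_sq a
  have hcb := Real.cosh_sq b
  obtain ⟨z', hz'⟩ : ∃ z' : H3, z'.lin = (Real.sinh (a + b))⁻¹ • (Real.sinh b • p.lin
      + Real.sinh a • q.lin) := by
    apply exists_lin_eq
    · simp only [mink_smul_left, mink_smul_right, mink_add_left, mink_add_right, mink_lin,
        pairing_self, pairing_comm q p, hpq]
      field_simp
      rw [Real.sinh_add, Real.cosh_add]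
      nlinarith
    · change 0 < (Real.sinh (a + b))⁻¹ * (Real.sinh b * p.time + Real.sinh a * q.time)
      have h1 := p.time_pos
      have h2 := q.time_pos
      have : 0 < Real.sinh b * p.time + Real.sinh a * q.time := by
        rcases eq_or_lt_of_le hb0 with h | h
        · have : 0 < Real.sinh a := Real.sinh_pos_iff.2 (by linarith)
          positivity
        · have : 0 < Real.sinh b := Real.sinh_pos_iff.2 h
          positivity
      positivity
  have hzz' : z = z' := by
    apply eq_of_pairing_eq_one
    rw [← mink_lin, hz']
    simp only [mink_smul_right, mink_add_right, mink_lin, hzp, hzq]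
    field_simp
    rw [Real.sinh_add]; ring
  rw [hzz', hz', smul_smul, mul_inv_cancel₀ hS.ne', one_smul]

lemma btw_of_lin_eq (hs : 0 ≤ s) (ht : 0 ≤ t) (h : z.lin = s • p.lin + t • q.lin) :
    Btw p z q := by
  obtain ⟨C, hC⟩ : ∃ C, C = p.pairing q := ⟨_, rfl⟩
  have hC1 : 1 ≤ C := hC ▸ one_le_pairing p q
  have h1 : s ^ 2 + t ^ 2 + 2 * s * t * C = 1 := by
    have := pairing_self z
    rw [← mink_lin, h] at this
    simp only [mink_smul_left, mink_smul_right, mink_add_left, mink_add_right, mink_lin,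
        pairing_self, pairing_comm q p, ← hC] at this
    nlinarith
  have hpz : p.pairing z = s + t * C := by
    rw [← mink_lin, h]
    simp only [mink_smul_right, mink_add_right, mink_lin, pairing_self, ← hC]; ring
  have hzq : z.pairing q = s * C + t := by
    rw [← mink_lin, h]
    simp only [mink_smul_left, mink_add_left, mink_lin, pairing_self, ← hC]; ring
  have hS := pairing_sq_sub_one p q
  have hS0 : 0 ≤ Real.sinh (dist p q) := Real.sinh_nonneg_iff.2 dist_nonneg
  have s1 : Real.sinh (dist p z) = t * Real.sinh (dist p q) := by
    have := pairing_sq_sub_one p z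
    rw [hpz] at this
    apply (pow_left_inj₀ (Real.sinh_nonneg_iff.2 dist_nonneg) (by positivity) two_ne_zero).1
    rw [← this, mul_pow, ← hS, ← hC]; nlinarith
  have s2 : Real.sinh (dist z q) = s * Real.sinh (dist p q) := by
    have := pairing_sq_sub_one z q
    rw [hzq] at this
    apply (pow_left_inj₀ (Real.sinh_nonneg_iff.2 dist_nonneg) (by positivity) two_ne_zero).1
    rw [← this, mul_pow, ← hS, ← hC]; nlinarith
  unfold Btw
  refine (dist_eq_of_cosh (by positivity) ?_).symm
  rw [Real.cosh_add, s1, s2, cosh_dist, cosh_dist, hpz, hzq, ← hC]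
  rw [← hC] at hS
  linear_combination (-C) * h1 + s * t * hS

/-- The point at a given distance along a segment. -/
lemma exists_btw (p q : H3) {r : ℝ} (h0 : 0 ≤ r) (h1 : r ≤ dist p q) :
    ∃ z, Btw p z q ∧ dist p z = r := by
  rcases eq_or_lt_of_le (h0.trans h1) with hd | hd
  · refine ⟨p, btw_left p q, ?_⟩
    rw [dist_self]; linarith
  obtain ⟨L, hL⟩ : ∃ L, L = dist p q := ⟨_, rfl⟩
  rw [← hL] at h1 hd
  have hS : 0 < Real.sinh L := Real.sinh_pos_iff.2 hd
  have hsa : 0 ≤ Real.sinh r := Real.sinh_nonneg_iff.2 h0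
  have hsb : 0 ≤ Real.sinh (L - r) := Real.sinh_nonneg_iff.2 (by linarith)
  have hpq : p.pairing q = Real.cosh L := by rw [← cosh_dist, hL]
  have hcr := Real.cosh_sq r
  have hcL := Real.cosh_sq L
  obtain ⟨z, hz⟩ : ∃ z : H3, z.lin = (Real.sinh (L - r) / Real.sinh L) • p.lin
      + (Real.sinh r / Real.sinh L) • q.lin := by
    apply exists_lin_eq
    · simp only [mink_smul_left, mink_smul_right, mink_add_left, mink_add_right, mink_lin,
        pairing_self, pairing_comm q p, hpq]
      field_simp
      rw [Real.sinh_sub]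
      nlinarith
    · change 0 < Real.sinh (L - r) / Real.sinh L * p.time + Real.sinh r / Real.sinh L * q.time
      have h1 := p.time_pos
      have h2 := q.time_pos
      rcases eq_or_lt_of_le h0 with h | h
      · have : 0 < Real.sinh (L - r) := Real.sinh_pos_iff.2 (by linarith)
        positivity
      · have : 0 < Real.sinh r := Real.sinh_pos_iff.2 h
        positivity
  refine ⟨z, btw_of_lin_eq (by positivity) (by positivity) hz, dist_eq_of_cosh h0 ?_⟩
  rw [← mink_lin, hz]
  simp only [mink_smul_right, mink_add_right, mink_lin, pairing_self, hpq]
  field_simp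
  rw [Real.sinh_sub]
  ring

lemma Btw.eq_of_dist {z' : H3} (h : Btw p z q) (h' : Btw p z' q) (hd : dist p z = dist p z') :
    z = z' := by
  rcases eq_or_lt_of_le (dist_nonneg (x := p) (y := q)) with h0 | h0
  · have e1 : dist p z = 0 := by
      unfold Btw at h; linarith [dist_nonneg (x := p) (y := z), dist_nonneg (x := z) (y := q)]
    have e2 : dist p z' = 0 := by rw [← hd, e1]
    rw [← dist_eq_zero.1 e1, ← dist_eq_zero.1 e2]
  have e1 := h.lin_eq
  have e2 := h'.lin_eq
  have : dist z q = dist z' q := by unfold Btw at h h'; linarith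
  rw [this, hd, ← e2] at e1
  exact lin_injective (smul_right_injective _ (Real.sinh_pos_iff.2 h0).ne' e1)

/-- Two segments that overlap in a nondegenerate segment fit together. -/
lemma Btw.glue {a b c d : H3} (h : Btw a b c) (h' : Btw b c d) (hbc : b ≠ c) :
    dist a d = dist a b + dist b c + dist c d := by
  have e1 := h.lin_eq
  have e2 := h'.lin_eq
  have h1 : dist a c = dist a b + dist b c := Eq.symm h
  have h2 : dist b d = dist b c + dist c d := Eq.symm h'
  obtain ⟨x, hx⟩ : ∃ x, x = dist a b := ⟨_, rfl⟩
  obtain ⟨y, hy⟩ : ∃ y, y = dist b c := ⟨_, rfl⟩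
  obtain ⟨w, hw⟩ : ∃ w, w = dist c d := ⟨_, rfl⟩
  have hy0 : 0 < y := hy ▸ dist_pos.2 hbc
  have hx0 : 0 ≤ x := hx ▸ dist_nonneg
  have hw0 : 0 ≤ w := hw ▸ dist_nonneg
  rw [h1, ← hx, ← hy] at e1
  rw [h2, ← hy, ← hw] at e2
  rw [← hx, ← hy, ← hw]
  have hS : 0 < Real.sinh y := Real.sinh_pos_iff.2 hy0
  apply dist_eq_of_cosh (by positivity)
  have hbd : b.pairing d = Real.cosh (y + w) := by rw [← cosh_dist, h2, hy, hw]
  have hcd : c.pairing d = Real.cosh w := by rw [← cosh_dist, hw]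
  have := congrArg (fun u => mink u d.lin) e1
  simp only [mink_smul_left, mink_add_left, mink_lin, hbd, hcd] at this
  have h3 : Real.sinh y * a.pairing d = Real.sinh y * Real.cosh (x + y + w) := by
    have hcy := Real.cosh_sq y
    have : Real.sinh y * a.pairing d = Real.sinh (x + y) * Real.cosh (y + w)
      - Real.sinh x * Real.cosh w := by linarith
    rw [this, add_assoc, Real.cosh_add x, Real.sinh_add x y, Real.cosh_add y w, Real.sinh_add y w]
    linear_combination Real.sinh x * Real.cosh w * hcy
  exact mul_left_cancel₀ hS.ne' h3

end H3

namespace H3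

variable {p q z : H3}

/-! ### The topology of `ℍ³` and the Klein model -/

lemma time_origin : (⟨0⟩ : H3).time = 1 := by simp [time]

lemma cosh_dist_origin (p : H3) : Real.cosh (dist p ⟨0⟩) = p.time := by
  rw [cosh_dist]; simp [pairing, time_origin]

lemma continuous_time : Continuous (time : H3 → ℝ) := by
  have : (time : H3 → ℝ) = fun p => Real.cosh (dist p ⟨0⟩) := by
    ext p; rw [cosh_dist_origin]
  rw [this]; fun_prop

lemma norm_vec_sub_sq (p q : H3) :
    ‖p.vec - q.vec‖ ^ 2 = (p.time - q.time) ^ 2 + 2 * (p.pairing q - 1) := by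
  have hp := time_sq p
  have hq := time_sq q
  rw [norm_sub_sq_real]; unfold pairing; nlinarith

lemma continuous_vec : Continuous (vec : H3 → EuclideanSpace ℝ (Fin 3)) := by
  rw [continuous_iff_continuousAt]
  intro q
  rw [ContinuousAt, tendsto_iff_norm_sub_tendsto_zero]
  have h : Tendsto (fun p : H3 => Real.sqrt ((p.time - q.time) ^ 2 + 2 * (p.pairing q - 1)))
      (𝓝 q) (𝓝 0) := by
    have hc : Continuous fun p : H3 =>
        Real.sqrt ((p.time - q.time) ^ 2 + 2 * (p.pairing q - 1)) := by
      have h1 : Continuous fun p : H3 => p.time := continuous_time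
      have h2 : Continuous fun p : H3 => p.pairing q := by
        simp_rw [← cosh_dist]; fun_prop
      exact (((h1.sub continuous_const).pow 2).add
        (continuous_const.mul (h2.sub continuous_const))).sqrt
    have h0 := hc.tendsto q
    rw [pairing_self, sub_self, sub_self, mul_zero, zero_pow two_ne_zero, add_zero,
      Real.sqrt_zero] at h0
    exact h0
  refine h.congr fun p => ?_
  rw [← norm_vec_sub_sq, Real.sqrt_sq (norm_nonneg _)]

lemma continuous_mk : Continuous (H3.mk : EuclideanSpace ℝ (Fin 3) → H3) := by
  rw [continuous_iff_continuousAt]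
  intro v
  rw [ContinuousAt, tendsto_iff_dist_tendsto_zero]
  have hc : Continuous fun w : EuclideanSpace ℝ (Fin 3) => (⟨w⟩ : H3).pairing ⟨v⟩ := by
    unfold pairing time; fun_prop
  have h := (Real.continuousOn_arcosh.comp_continuous hc fun w => one_le_pairing _ _).tendsto v
  rw [Function.comp_apply, pairing_self, (Real.arcosh_eq_zero_iff le_rfl).2 rfl] at h
  exact h

/-- `ℍ³` is homeomorphic to `ℝ³` by the vertical projection of the hyperboloid. -/
noncomputable def vecHomeo : H3 ≃ₜ EuclideanSpace ℝ (Fin 3) where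
  toFun := vec
  invFun := H3.mk
  left_inv _ := rfl
  right_inv _ := rfl
  continuous_toFun := continuous_vec
  continuous_invFun := continuous_mk

/-- The projective (Klein) model: central projection of the hyperboloid to the unit ball. It
turns geodesic segments into affine segments. -/
noncomputable def klein (p : H3) : EuclideanSpace ℝ (Fin 3) := p.time⁻¹ • p.vec

lemma isOpenEmbedding_klein : IsOpenEmbedding klein := by
  have h : IsOpenEmbedding (OpenPartialHomeomorph.univUnitBall :
      OpenPartialHomeomorph (EuclideanSpace ℝ (Fin 3)) (EuclideanSpace ℝ (Fin 3))) :=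
    OpenPartialHomeomorph.isOpenEmbedding _ rfl
  have := h.comp vecHomeo.isOpenEmbedding
  exact this

lemma range_klein : range klein = Metric.ball 0 1 := by
  have h : (OpenPartialHomeomorph.univUnitBall :
      OpenPartialHomeomorph (EuclideanSpace ℝ (Fin 3)) (EuclideanSpace ℝ (Fin 3))) '' univ
      = Metric.ball 0 1 :=
    OpenPartialHomeomorph.univUnitBall.image_source_eq_target
  have e : klein = (OpenPartialHomeomorph.univUnitBall :
      OpenPartialHomeomorph (EuclideanSpace ℝ (Fin 3)) (EuclideanSpace ℝ (Fin 3)))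
      ∘ vecHomeo := rfl
  rw [e, range_comp, vecHomeo.surjective.range_eq, h]

lemma lin_eq_klein (p : H3) : p.lin = p.time • ((1 : ℝ), p.klein) := by
  refine Prod.ext (by simp [lin]) ?_
  change p.vec = p.time • p.time⁻¹ • p.vec
  rw [smul_smul, mul_inv_cancel₀ p.time_pos.ne', one_smul]

lemma btw_iff_klein : Btw p z q ↔ klein z ∈ segment ℝ (klein p) (klein q) := by
  have hp := p.time_pos
  have hq := q.time_pos
  have hz := z.time_pos
  constructor
  · intro h
    rcases eq_or_lt_of_le (dist_nonneg (x := p) (y := q)) with h0 | h0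
    · have e1 : dist p z = 0 := by
        unfold Btw at h; linarith [dist_nonneg (x := p) (y := z), dist_nonneg (x := z) (y := q)]
      rw [dist_eq_zero.1 e1]; exact left_mem_segment _ _ _
    have e := h.lin_eq
    have hS := Real.sinh_pos_iff.2 h0
    obtain ⟨s, hs⟩ : ∃ s, s = Real.sinh (dist z q) := ⟨_, rfl⟩
    obtain ⟨t, ht⟩ : ∃ t, t = Real.sinh (dist p z) := ⟨_, rfl⟩
    have hs0 : 0 ≤ s := hs ▸ Real.sinh_nonneg_iff.2 dist_nonneg
    have ht0 : 0 ≤ t := ht ▸ Real.sinh_nonneg_iff.2 dist_nonneg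
    rw [← hs, ← ht, lin_eq_klein p, lin_eq_klein q, lin_eq_klein z] at e
    have e1 := congrArg Prod.fst e
    have e2 := congrArg Prod.snd e
    simp only [Prod.smul_fst, Prod.smul_snd, Prod.fst_add, Prod.snd_add, smul_eq_mul,
      mul_one, smul_smul] at e1 e2
    have hpos : 0 < Real.sinh (dist p q) * z.time := by positivity
    refine ⟨s * p.time / (Real.sinh (dist p q) * z.time),
      t * q.time / (Real.sinh (dist p q) * z.time), by positivity, by positivity, ?_, ?_⟩
    · rw [← add_div, ← e1, div_self hpos.ne']
    · rw [div_eq_inv_mul, div_eq_inv_mul, ← smul_smul _ (s * p.time), ← smul_smul _ (t * q.time),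
        ← smul_add, ← e2, smul_smul, inv_mul_cancel₀ hpos.ne', one_smul]
  · rintro ⟨a, b, ha, hb, hab, e⟩
    refine btw_of_lin_eq (s := z.time * a / p.time) (t := z.time * b / q.time)
      (by positivity) (by positivity) ?_
    rw [lin_eq_klein p, lin_eq_klein q, lin_eq_klein z, ← e]
    refine Prod.ext ?_ ?_
    · simp only [Prod.smul_fst, Prod.fst_add, smul_eq_mul, mul_one]
      field_simp
      linarith
    · simp only [Prod.smul_snd, Prod.snd_add, smul_smul, smul_add]
      congr 2 <;> field_simp

lemma geodConvex_iff {S : Set H3} : GeodConvex S ↔ Convex ℝ (klein '' S) := by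
  rw [convex_iff_segment_subset]
  constructor
  · rintro h _ ⟨p, hp, rfl⟩ _ ⟨q, hq, rfl⟩ v hv
    have : v ∈ range klein := by
      rw [range_klein]
      refine (convex_ball (0 : EuclideanSpace ℝ (Fin 3)) 1).segment_subset ?_ ?_ hv <;>
      · rw [← range_klein]; exact mem_range_self _
    obtain ⟨z, rfl⟩ := this
    exact ⟨z, h p hp q hq z (btw_iff_klein.2 hv), rfl⟩
  · intro h p hp q hq z hz
    have := h ⟨p, hp, rfl⟩ ⟨q, hq, rfl⟩ (btw_iff_klein.1 hz)
    exact (isOpenEmbedding_klein.injective.mem_set_image).1 this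

lemma GeodConvex.mem {S : Set H3} (hS : GeodConvex S) (hp : p ∈ S) (hq : q ∈ S)
    (h : Btw p z q) : z ∈ S := hS p hp q hq z h

lemma GeodConvex.isPreconnected {S : Set H3} (h : GeodConvex S) : IsPreconnected S :=
  isOpenEmbedding_klein.toIsInducing.isPreconnected_image.1 (geodConvex_iff.1 h).isPreconnected

lemma GeodConvex.inter {S T : Set H3} (hS : GeodConvex S) (hT : GeodConvex T) :
    GeodConvex (S ∩ T) :=
  fun p hp q hq z hz => ⟨hS p hp.1 q hq.1 z hz, hT p hp.2 q hq.2 z hz⟩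

lemma subset_hull (A : Set H3) : A ⊆ hull A := fun _ hp _ hS => hS.2 hp

lemma geodConvex_hull (A : Set H3) : GeodConvex (hull A) :=
  fun p hp q hq z hz S hS => hS.1 p (hp S hS) q (hq S hS) z hz

lemma hull_subset {A S : Set H3} (h : GeodConvex S) (hA : A ⊆ S) : hull A ⊆ S :=
  fun _ hp => hp S ⟨h, hA⟩

lemma hull_mono {A B : Set H3} (h : A ⊆ B) : hull A ⊆ hull B :=
  hull_subset (geodConvex_hull B) (h.trans (subset_hull B))

lemma klein_image_hull (A : Set H3) : klein '' hull A = convexHull ℝ (klein '' A) := by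
  apply Subset.antisymm
  · rintro _ ⟨p, hp, rfl⟩
    have hc : GeodConvex (klein ⁻¹' convexHull ℝ (klein '' A)) := by
      intro p hp q hq z hz
      exact (convex_convexHull ℝ _).segment_subset hp hq (btw_iff_klein.1 hz)
    exact hp _ ⟨hc, fun a ha => subset_convexHull ℝ _ ⟨a, ha, rfl⟩⟩
  · exact convexHull_min (image_mono (subset_hull A)) (geodConvex_iff.1 (geodConvex_hull A))

lemma isOpen_hull {A : Set H3} (hA : IsOpen A) : IsOpen (hull A) := by
  rw [isOpenEmbedding_klein.isOpen_iff_image_isOpen, klein_image_hull]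
  exact (isOpenEmbedding_klein.isOpenMap A hA).convexHull

lemma hull_image (g : H3 ≃ᵢ H3) (A : Set H3) : hull (g '' A) = g '' hull A := by
  have key : ∀ (g : H3 ≃ᵢ H3) (A : Set H3), hull (g '' A) ⊆ g '' hull A := by
    intro g A
    refine hull_subset ?_ (image_mono (subset_hull A))
    rintro _ ⟨p, hp, rfl⟩ _ ⟨q, hq, rfl⟩ z hz
    refine ⟨g.symm z, ?_, g.apply_symm_apply z⟩
    have := Btw.map hz g.symm
    simp only [IsometryEquiv.symm_apply_apply] at this
    exact (geodConvex_hull A).mem hp hq this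
  refine Subset.antisymm (key g A) ?_
  have := image_mono (f := g) (key g.symm (g '' A))
  rw [← image_comp, ← image_comp] at this
  simpa using this

/-- The union of the segments between the points of a set. -/
def join (S : Set H3) : Set H3 := {z | ∃ p ∈ S, ∃ q ∈ S, Btw p z q}

lemma subset_join (S : Set H3) : S ⊆ join S := fun p hp => ⟨p, hp, p, hp, btw_left p p⟩

/-- Carathéodory's theorem: in dimension three a convex hull is reached after three joins. -/
lemma hull_subset_join (S : Set H3) : hull S ⊆ join (join (join S)) := by
  have key : ∀ (n : ℕ) (t : Finset (EuclideanSpace ℝ (Fin 3))), t.card ≤ n + 1 →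
      (t : Set (EuclideanSpace ℝ (Fin 3))) ⊆ klein '' S →
      convexHull ℝ (t : Set (EuclideanSpace ℝ (Fin 3))) ⊆ klein '' (join^[n] S) := by
    classical
    intro n
    induction n with
    | zero =>
      intro t ht hS
      rcases Finset.card_le_one_iff_subsingleton.1 ht |>.eq_empty_or_singleton with h | ⟨x, h⟩
      · rw [h]; simp
      · rw [h] at hS ⊢
        simpa using hS
    | succ n ih =>
      intro t ht hS
      rcases t.eq_empty_or_nonempty with rfl | ⟨x, hx⟩
      · simp
      rw [← Finset.insert_erase hx] at hS ⊢
      rw [Finset.coe_insert] at hS ⊢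
      have hc : (t.erase x).card ≤ n + 1 := by rw [Finset.card_erase_of_mem hx]; omega
      have hsub : ∀ k, klein '' S ⊆ klein '' (join^[k] S) := by
        intro k
        induction k with
        | zero => exact Subset.rfl
        | succ k ihk =>
          rw [Function.iterate_succ_apply']
          exact ihk.trans (image_mono (subset_join _))
      have h1 := ih _ hc ((subset_insert _ _).trans hS)
      have hxS : x ∈ klein '' (join^[n] S) := hsub n (hS (mem_insert _ _))
      rcases (t.erase x).eq_empty_or_nonempty with h0 | h0
      · rw [h0]
        simp only [Finset.coe_empty, insert_empty_eq, convexHull_singleton,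
          singleton_subset_iff]
        exact hsub (n + 1) (hS (mem_insert _ _))
      rw [convexHull_insert h0]
      intro v hv
      rw [mem_convexJoin] at hv
      obtain ⟨a, ha, b, hb, hv⟩ := hv
      rw [mem_singleton_iff] at ha
      subst ha
      obtain ⟨p, hp, rfl⟩ := hxS
      obtain ⟨q, hq, rfl⟩ := h1 hb
      have : v ∈ range klein := by
        rw [range_klein]
        refine (convex_ball (0 : EuclideanSpace ℝ (Fin 3)) 1).segment_subset ?_ ?_ hv <;>
        · rw [← range_klein]; exact mem_range_self _
      obtain ⟨z, rfl⟩ := this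
      rw [Function.iterate_succ_apply']
      exact ⟨z, ⟨p, hp, q, hq, btw_iff_klein.2 hv⟩, rfl⟩
  intro p hp
  have h : klein p ∈ convexHull ℝ (klein '' S) := klein_image_hull S ▸ mem_image_of_mem _ hp
  rw [convexHull_eq_union] at h
  simp only [mem_iUnion] at h
  obtain ⟨t, htS, hti, ht⟩ := h
  have hcard : t.card ≤ 3 + 1 := by
    have := hti.card_le_finrank_succ
    have h2 : Module.finrank ℝ (vectorSpan ℝ (range ((↑) : t → EuclideanSpace ℝ (Fin 3)))) ≤ 3 := by
      have := Submodule.finrank_le (vectorSpan ℝ (range ((↑) : t → EuclideanSpace ℝ (Fin 3))))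
      simpa using this
    simp only [Fintype.card_coe] at this
    omega
  have := key 3 t hcard htS ht
  exact (isOpenEmbedding_klein.injective.mem_set_image).1 this

/-! ### Weighted centres -/

/-- The weighted centre of finitely many points: the normalized linear combination. It is
determined by its pairings with the points of `ℍ³`, hence equivariant under isometries. -/
noncomputable def center {ι : Type*} (s : Finset ι) (w : ι → ℝ) (a : ι → H3) : H3 :=
  normalize (∑ i ∈ s, w i • (a i).lin)

section center

variable {ι : Type*} {s : Finset ι} {w : ι → ℝ} {a : ι → H3}

lemma mink_sum_pos (hw : ∀ i ∈ s, 0 ≤ w i) (h : ∃ i ∈ s, 0 < w i) :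
    0 < mink (∑ i ∈ s, w i • (a i).lin) (∑ i ∈ s, w i • (a i).lin) := by
  obtain ⟨i, hi, hwi⟩ := h
  have e : ∀ j ∈ s, w j * w i ≤ w j * ∑ k ∈ s, w k * (a j).pairing (a k) := by
    intro j hj
    apply mul_le_mul_of_nonneg_left _ (hw j hj)
    have h1 : w i * 1 ≤ w i * (a j).pairing (a i) :=
      mul_le_mul_of_nonneg_left (one_le_pairing _ _) hwi.le
    rw [mul_one] at h1
    refine h1.trans (Finset.single_le_sum (f := fun k => w k * (a j).pairing (a k)) ?_ hi)
    intro k hk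
    exact mul_nonneg (hw k hk) (zero_le_one.trans (one_le_pairing _ _))
  have e2 : mink (∑ i ∈ s, w i • (a i).lin) (∑ i ∈ s, w i • (a i).lin)
      = ∑ j ∈ s, w j * ∑ k ∈ s, w k * (a j).pairing (a k) := by
    rw [mink_sum_left]
    refine Finset.sum_congr rfl fun j _ => ?_
    rw [mink_smul_left, mink_comm, mink_sum_left]
    congr 1
    refine Finset.sum_congr rfl fun k _ => ?_
    rw [mink_smul_left, mink_lin, pairing_comm]
  rw [e2]
  refine lt_of_lt_of_le ?_ (Finset.sum_le_sum e)
  exact Finset.sum_pos' (fun j hj => mul_nonneg (hw j hj) hwi.le) ⟨i, hi, mul_pos hwi hwi⟩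

lemma fst_sum_pos (hw : ∀ i ∈ s, 0 ≤ w i) (h : ∃ i ∈ s, 0 < w i) :
    0 < (∑ i ∈ s, w i • (a i).lin).1 := by
  rw [Prod.fst_sum]
  obtain ⟨i, hi, hwi⟩ := h
  exact Finset.sum_pos' (fun j hj => mul_nonneg (hw j hj) (time_pos _).le)
    ⟨i, hi, mul_pos hwi (time_pos _)⟩

lemma lin_center (hw : ∀ i ∈ s, 0 ≤ w i) (h : ∃ i ∈ s, 0 < w i) :
    ∃ c : ℝ, 0 < c ∧ (center s w a).lin = c • ∑ i ∈ s, w i • (a i).lin :=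
  ⟨_, inv_pos.2 (Real.sqrt_pos.2 (mink_sum_pos hw h)),
    lin_normalize (mink_sum_pos hw h) (fst_sum_pos hw h)⟩

lemma eq_of_lin_eq_smul {c : ℝ} (h : p.lin = c • q.lin) (hc : 0 ≤ c) : p = q := by
  have h1 := pairing_self p
  rw [← mink_lin, h] at h1
  simp only [mink_smul_left, mink_smul_right, mink_lin, pairing_self] at h1
  have : c = 1 := by nlinarith
  rw [this, one_smul] at h
  exact lin_injective h

lemma center_mem {S : Set H3} (hS : GeodConvex S) (hw : ∀ i ∈ s, 0 ≤ w i)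
    (h : ∃ i ∈ s, 0 < w i) (ha : ∀ i ∈ s, a i ∈ S) : center s w a ∈ S := by
  obtain ⟨c, hc, e⟩ := lin_center (a := a) hw h
  have h1 := congrArg Prod.fst e
  have h2 := congrArg Prod.snd e
  simp only [Prod.smul_fst, Prod.smul_snd, Prod.fst_sum, Prod.snd_sum] at h1 h2
  have hpos : 0 < ∑ i ∈ s, w i * (a i).time := by
    have := fst_sum_pos (a := a) hw h
    rwa [Prod.fst_sum] at this
  have hk : klein (center s w a)
      = s.centerMass (fun i => w i * (a i).time) fun i => klein (a i) := by
    have h3 : ∀ i ∈ s, (w i * (a i).time) • klein (a i) = w i • (a i).vec := by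
      intro i _
      rw [klein, smul_smul, mul_assoc, mul_inv_cancel₀ (time_pos _).ne', mul_one]
    have h1' : (center s w a).time = c * ∑ i ∈ s, w i * (a i).time := h1
    have h2' : (center s w a).vec = c • ∑ i ∈ s, w i • (a i).vec := h2
    rw [Finset.centerMass, Finset.sum_congr rfl h3, klein, h1', h2', smul_smul]
    congr 1
    field_simp
  rw [← isOpenEmbedding_klein.injective.mem_set_image (s := S), hk]
  exact (geodConvex_iff.1 hS).centerMass_mem (fun i hi => mul_nonneg (hw i hi) (time_pos _).le)
    hpos fun i hi => ⟨_, ha i hi, rfl⟩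

lemma map_center (g : H3 ≃ᵢ H3) (hw : ∀ i ∈ s, 0 ≤ w i) (h : ∃ i ∈ s, 0 < w i) :
    g (center s w a) = center s w fun i => g (a i) := by
  obtain ⟨c, hc, e⟩ := lin_center (a := a) hw h
  obtain ⟨c', hc', e'⟩ := lin_center (a := fun i => g (a i)) hw h
  have hx : ∀ x, c * (center s w fun i => g (a i)).pairing x
      = c' * (g (center s w a)).pairing x := by
    intro x
    have h1 : (g (center s w a)).pairing x = (center s w a).pairing (g.symm x) := by
      rw [← pairing_isometry g (center s w a), g.apply_symm_apply]
    rw [h1, ← mink_lin, ← mink_lin, e, e']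
    simp only [mink_smul_left, mink_sum_left, mink_lin]
    have : ∀ i, (a i).pairing (g.symm x) = (g (a i)).pairing x := fun i => by
      rw [← pairing_isometry g, g.apply_symm_apply]
    simp only [this]; ring
  have h1 := hx (center s w fun i => g (a i))
  have h2 := hx (g (center s w a))
  rw [pairing_self] at h1 h2
  rw [pairing_comm (g _)] at h1
  have h3 := one_le_pairing (center s w fun i => g (a i)) (g (center s w a))
  symm
  apply eq_of_pairing_eq_one
  nlinarith

end center

/-! ### Rigidity of isometries -/

/-- A point is determined by its pairings with the points of a nonempty open set. -/
lemma eq_of_pairing_eq_on {U : Set H3} (hU : IsOpen U) (hne : U.Nonempty)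
    (h : ∀ a ∈ U, p.pairing a = q.pairing a) : p = q := by
  obtain ⟨a, ha⟩ := hne
  have key : ∀ v : EuclideanSpace ℝ (Fin 3), (⟨v⟩ : H3) ∈ U →
      (p.time - q.time) * (⟨v⟩ : H3).time = inner ℝ (p.vec - q.vec) v := by
    intro v hv
    have := h _ hv
    rw [inner_sub_left]
    unfold pairing at this
    linarith
  have hnear : ∀ e : EuclideanSpace ℝ (Fin 3), ∃ r : ℝ, 0 < r ∧ (⟨a.vec + r • e⟩ : H3) ∈ U ∧
      (⟨a.vec - r • e⟩ : H3) ∈ U := by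
    intro e
    have h1 : Tendsto (fun r : ℝ => (⟨a.vec + r • e⟩ : H3)) (𝓝 0) (𝓝 a) := by
      have : Continuous fun r : ℝ => (⟨a.vec + r • e⟩ : H3) :=
        continuous_mk.comp (by fun_prop)
      simpa using this.tendsto 0
    have h2 : Tendsto (fun r : ℝ => (⟨a.vec - r • e⟩ : H3)) (𝓝 0) (𝓝 a) := by
      have : Continuous fun r : ℝ => (⟨a.vec - r • e⟩ : H3) :=
        continuous_mk.comp (by fun_prop)
      simpa using this.tendsto 0
    have h3 := ((h1.eventually (hU.mem_nhds ha)).and (h2.eventually (hU.mem_nhds ha)))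
    have h4 : ∀ᶠ r : ℝ in 𝓝[>] 0, 0 < r := self_mem_nhdsWithin
    obtain ⟨r, hr, hr'⟩ := (h4.and (h3.filter_mono nhdsWithin_le_nhds)).exists
    exact ⟨r, hr, hr'⟩
  have ht : p.time - q.time = 0 := by
    by_contra hne
    obtain ⟨r, hr, h1, h2⟩ := hnear (EuclideanSpace.single 0 1)
    obtain ⟨e, he⟩ : ∃ e : EuclideanSpace ℝ (Fin 3), e = EuclideanSpace.single 0 1 := ⟨_, rfl⟩
    have he1 : ‖e‖ = 1 := by rw [he]; simp
    rw [← he] at h1 h2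
    have k0 := key a.vec ha
    have k1 := key _ h1
    have k2 := key _ h2
    rw [inner_add_right] at k1
    rw [inner_sub_right] at k2
    have hsum : (⟨a.vec + r • e⟩ : H3).time + (⟨a.vec - r • e⟩ : H3).time = 2 * a.time := by
      apply mul_left_cancel₀ hne
      have : (⟨a.vec⟩ : H3) = a := rfl
      rw [this] at k0
      linarith
    have s0 := time_sq a
    have s1 := time_sq (⟨a.vec + r • e⟩ : H3)
    have s2 := time_sq (⟨a.vec - r • e⟩ : H3)
    simp only [norm_add_sq_real, norm_sub_sq_real, real_inner_smul_right, norm_smul, he1,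
      Real.norm_eq_abs, mul_one, sq_abs] at s1 s2
    have hcs := abs_real_inner_le_norm a.vec e
    rw [he1, mul_one] at hcs
    have hcs2 : (inner ℝ a.vec e) ^ 2 ≤ ‖a.vec‖ ^ 2 := by rw [← sq_abs]; gcongr
    obtain ⟨x, hx⟩ : ∃ x, x = (⟨a.vec + r • e⟩ : H3).time := ⟨_, rfl⟩
    obtain ⟨y, hy⟩ : ∃ y, y = (⟨a.vec - r • e⟩ : H3).time := ⟨_, rfl⟩
    rw [← hx, ← hy] at hsum
    rw [← hx] at s1
    rw [← hy] at s2
    have hT := a.time_pos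
    have d1 : (x - y) * a.time = 2 * r * inner ℝ a.vec e := by nlinarith
    have d2 : (x - y) ^ 2 = 4 * r ^ 2 := by nlinarith
    have d3 : 4 * r ^ 2 * a.time ^ 2 = 4 * r ^ 2 * (inner ℝ a.vec e) ^ 2 := by
      rw [← d2, ← mul_pow, d1, mul_pow, mul_pow, d2]; ring
    have d4 := mul_left_cancel₀ (by positivity) d3
    nlinarith
  have hv : p.vec - q.vec = 0 := by
    obtain ⟨r, hr, h1, h2⟩ := hnear (p.vec - q.vec)
    have k1 := key _ h1
    have k2 := key _ h2
    rw [ht, zero_mul, inner_add_right, real_inner_smul_right] at k1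
    rw [ht, zero_mul, inner_sub_right, real_inner_smul_right] at k2
    have : r * inner ℝ (p.vec - q.vec) (p.vec - q.vec) = 0 := by linarith
    exact inner_self_eq_zero.1 ((mul_eq_zero.1 this).resolve_left hr.ne')
  exact H3.ext (sub_eq_zero.1 hv)

lemma isometry_eq_of_eqOn {U : Set H3} (hU : IsOpen U) (hne : U.Nonempty) {g g' : H3 ≃ᵢ H3}
    (h : ∀ a ∈ U, g a = g' a) : g = g' := by
  refine IsometryEquiv.ext fun x => ?_
  refine eq_of_pairing_eq_on (U := g '' U) (g.toHomeomorph.isOpenMap U hU) (hne.image g) ?_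
  rintro _ ⟨a, ha, rfl⟩
  rw [pairing_isometry, h a ha, pairing_isometry]

end H3

namespace H3

variable {p q z : H3}

/-! ### Distance to a convex set -/

lemma isCompact_segment (p q : H3) : IsCompact {z | Btw p z q} := by
  have e : {z | Btw p z q} = klein ⁻¹' segment ℝ (klein p) (klein q) := by
    ext z; exact btw_iff_klein
  rw [e, isOpenEmbedding_klein.toIsInducing.isCompact_preimage_iff]
  · rw [← convexHull_pair (𝕜 := ℝ)]
    exact Set.Finite.isCompact_convexHull ℝ ((finite_singleton _).insert _)
  · rw [range_klein]
    refine (convex_ball (0 : EuclideanSpace ℝ (Fin 3)) 1).segment_subset ?_ ?_ <;>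
    · rw [← range_klein]; exact mem_range_self _

lemma geodConvex_segment (p q : H3) : GeodConvex {z | Btw p z q} := by
  have e : {z | Btw p z q} = klein ⁻¹' segment ℝ (klein p) (klein q) := by
    ext z; exact btw_iff_klein
  rw [e]
  intro a ha b hb c hc
  exact (convex_segment _ _).segment_subset ha hb (btw_iff_klein.1 hc)

/-- The angle at the point of a convex set nearest to `w` is at least a right angle. -/
lemma pairing_mul_le_of_nearest {A : Set H3} (hA : GeodConvex A) {w w' c : H3} (hw' : w' ∈ A)
    (hmin : ∀ c ∈ A, w.pairing w' ≤ w.pairing c) (hc : c ∈ A) :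
    w.pairing w' * w'.pairing c ≤ w.pairing c := by
  rcases eq_or_lt_of_le (dist_nonneg (x := w') (y := c)) with h0 | h0
  · rw [dist_eq_zero.1 h0.symm, pairing_self, mul_one]
  obtain ⟨l, hl⟩ : ∃ l, l = dist w' c := ⟨_, rfl⟩
  have hwc : w'.pairing c = Real.cosh l := by rw [← cosh_dist, hl]
  rw [← hl] at h0
  have key : ∀ h : ℝ, 0 < h → 2 * h ≤ l →
      w.pairing w' * Real.cosh (l - h) ≤ w.pairing c * Real.cosh h := by
    intro h hh hle
    obtain ⟨x, hx, hxd⟩ := exists_btw w' c (r := 2 * h) (by linarith) (by rw [← hl]; exact hle)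
    have e := congrArg (fun u => mink w.lin u) hx.lin_eq
    have hxc : dist x c = l - 2 * h := by unfold Btw at hx; linarith
    rw [hxd, hxc, ← hl] at e
    simp only [mink_smul_right, mink_add_right, mink_lin] at e
    have h1 := hmin x (hA.mem hw' hc hx)
    have hS : 0 < Real.sinh l := Real.sinh_pos_iff.2 h0
    have h2 := mul_le_mul_of_nonneg_left h1 hS.le
    rw [e] at h2
    have hsh : 0 < Real.sinh h := Real.sinh_pos_iff.2 hh
    have e1 : Real.sinh l = Real.sinh (l - h) * Real.cosh h + Real.cosh (l - h) * Real.sinh h := by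
      rw [← Real.sinh_add]; congr 1; ring
    have e2 : Real.sinh (l - 2 * h)
        = Real.sinh (l - h) * Real.cosh h - Real.cosh (l - h) * Real.sinh h := by
      rw [← Real.sinh_sub]; congr 1; ring
    rw [e1, e2, Real.sinh_two_mul] at h2
    have h3 : Real.sinh h * (w.pairing w' * Real.cosh (l - h))
        ≤ Real.sinh h * (w.pairing c * Real.cosh h) := by nlinarith
    exact le_of_mul_le_mul_left h3 hsh
  have hlim : Tendsto (fun h : ℝ => w.pairing c * Real.cosh h - w.pairing w' * Real.cosh (l - h))
      (𝓝[>] 0) (𝓝 (w.pairing c * Real.cosh 0 - w.pairing w' * Real.cosh (l - 0))) := by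
    apply Tendsto.mono_left _ nhdsWithin_le_nhds
    apply Continuous.tendsto
    fun_prop
  have h3 : 0 ≤ w.pairing c * Real.cosh 0 - w.pairing w' * Real.cosh (l - 0) := by
    apply ge_of_tendsto hlim
    have h4 : ∀ᶠ h : ℝ in 𝓝[>] 0, h < l / 2 :=
      nhdsWithin_le_nhds (Iio_mem_nhds (by linarith))
    filter_upwards [self_mem_nhdsWithin, h4] with h h5 h6
    linarith [key h h5 (by linarith)]
  rw [hwc]
  simp at h3
  linarith

/-- The signed distance to the half-space that supports a convex set at the point `w'` nearest to
`w` does not exceed the distance to points of the half-space. -/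
lemma support_le {w w' a a' : H3}
    (ha' : 0 ≤ w.pairing a' - Real.cosh (dist w w') * w'.pairing a') :
    -(w.pairing a - Real.cosh (dist w w') * w'.pairing a)
      ≤ Real.sinh (dist w w') * Real.sinh (dist a a') := by
  obtain ⟨C, hC⟩ : ∃ C, C = a.pairing a' := ⟨_, rfl⟩
  obtain ⟨D, hD⟩ : ∃ D, D = Real.cosh (dist w w') := ⟨_, rfl⟩
  obtain ⟨E, hE⟩ : ∃ E, E = Real.sinh (dist w w') := ⟨_, rfl⟩
  obtain ⟨S, hS⟩ : ∃ S, S = Real.sinh (dist a a') := ⟨_, rfl⟩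
  have hDE : D ^ 2 = E ^ 2 + 1 := by rw [hD, hE, Real.cosh_sq]
  have hww : w.pairing w' = D := by rw [hD, cosh_dist]
  have hCS : C ^ 2 - 1 = S ^ 2 := by rw [hC, hS, pairing_sq_sub_one]
  have hE0 : 0 ≤ E := hE ▸ Real.sinh_nonneg_iff.2 dist_nonneg
  have hS0 : 0 ≤ S := hS ▸ Real.sinh_nonneg_iff.2 dist_nonneg
  have hC1 : 1 ≤ C := hC ▸ one_le_pairing _ _
  rw [← hD] at ha' ⊢
  rw [← hE, ← hS]
  obtain ⟨f, hf⟩ : ∃ f, f = w.pairing a - D * w'.pairing a := ⟨_, rfl⟩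
  obtain ⟨f', hf'⟩ : ∃ f', f' = w.pairing a' - D * w'.pairing a' := ⟨_, rfl⟩
  rw [← hf'] at ha'
  rw [← hf]
  have cs := mink_sq_le (p := a') (u := w.lin - D • w'.lin - f' • a'.lin)
    (v := a.lin - C • a'.lin)
    (by simp only [mink_sub_left, mink_smul_left, mink_lin, pairing_self]; rw [hf']; ring)
    (by simp only [mink_sub_left, mink_smul_left, mink_lin, pairing_self]; rw [hC]; ring)
  simp only [mink_sub_left, mink_smul_left, mink_sub_right, mink_smul_right, mink_lin,
    pairing_self, pairing_comm a' w, pairing_comm a' w', pairing_comm w' w, pairing_comm a' a,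
    hww, ← hC] at cs
  have cs' : (f - C * f') ^ 2 ≤ (E ^ 2 + f' ^ 2) * S ^ 2 := by
    have e1 : w.pairing a = f + D * w'.pairing a := by rw [hf]; ring
    have e2 : w.pairing a' = f' + D * w'.pairing a' := by rw [hf']; ring
    rw [e1, e2] at cs
    nlinarith
  by_contra hlt
  push Not at hlt
  have h1 : 0 ≤ C * f' := by positivity
  have h2 : 0 ≤ E * S := by positivity
  have h3 : (C * f' + E * S) ^ 2 < (f - C * f') ^ 2 := by nlinarith
  nlinarith [mul_nonneg h1 h2, sq_nonneg f']

/-- The hyperbolic sine of the distance to a convex set is a convex function, in the sense of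
the hyperboloid model, along segments. -/
lemma sinh_dist_segment {A : Set H3} (hA : GeodConvex A) {a w b a' b' : H3} (h : Btw a w b)
    (ha : a' ∈ A) (hb : b' ∈ A) :
    Real.sinh (Metric.infDist w A) * Real.sinh (dist a b)
      ≤ Real.sinh (dist w b) * Real.sinh (dist a a')
        + Real.sinh (dist a w) * Real.sinh (dist b b') := by
  obtain ⟨w', hw', hmin⟩ := (isCompact_segment a' b').exists_isMinOn ⟨a', btw_left _ _⟩
    (f := fun c => w.pairing c) (by
      have : Continuous fun c => w.pairing c := by simp_rw [← cosh_dist]; fun_prop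
      exact this.continuousOn)
  have hob : ∀ c, Btw a' c b' → 0 ≤ w.pairing c - Real.cosh (dist w w') * w'.pairing c := by
    intro c hc
    have := pairing_mul_le_of_nearest (geodConvex_segment a' b') hw' (fun c hc => hmin hc) hc
    rw [cosh_dist]; linarith
  have hA' := support_le (a := a) (hob a' (btw_left _ _))
  have hB' := support_le (a := b) (hob b' (btw_right _ _))
  have e1 := congrArg (fun u => mink u w.lin) h.lin_eq
  have e2 := congrArg (fun u => mink u w'.lin) h.lin_eq
  simp only [mink_smul_left, mink_add_left, mink_lin, pairing_self] at e1 e2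
  have hd := Metric.infDist_le_dist_of_mem (x := w) (hA.mem ha hb hw')
  have hd0 : 0 ≤ Metric.infDist w A := Metric.infDist_nonneg
  rcases eq_or_lt_of_le (dist_nonneg (x := w) (y := w')) with h0 | h0
  · have : Metric.infDist w A = 0 := by linarith
    rw [this, Real.sinh_zero, zero_mul]
    have := Real.sinh_nonneg_iff.2 (dist_nonneg (x := w) (y := b))
    have := Real.sinh_nonneg_iff.2 (dist_nonneg (x := a) (y := w))
    have := Real.sinh_nonneg_iff.2 (dist_nonneg (x := a) (y := a'))
    have := Real.sinh_nonneg_iff.2 (dist_nonneg (x := b) (y := b'))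
    positivity
  have hE := Real.sinh_pos_iff.2 h0
  have s1 := Real.sinh_nonneg_iff.2 (dist_nonneg (x := w) (y := b))
  have s2 := Real.sinh_nonneg_iff.2 (dist_nonneg (x := a) (y := w))
  have s3 := Real.sinh_nonneg_iff.2 (dist_nonneg (x := a) (y := b))
  have key : Real.sinh (dist w w') * (Real.sinh (dist w w') * Real.sinh (dist a b))
      ≤ Real.sinh (dist w w') * (Real.sinh (dist w b) * Real.sinh (dist a a')
        + Real.sinh (dist a w) * Real.sinh (dist b b')) := by
    have k1 := mul_le_mul_of_nonneg_left hA' s1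
    have k2 := mul_le_mul_of_nonneg_left hB' s2
    have hcc := Real.cosh_sq (dist w w')
    rw [pairing_comm w a, pairing_comm w' a] at k1
    rw [pairing_comm w b, pairing_comm w' b] at k2
    rw [← cosh_dist w w'] at e2
    have e3 : Real.sinh (dist w w') * (Real.sinh (dist w w') * Real.sinh (dist a b))
        = Real.sinh (dist w b) * -(a.pairing w - Real.cosh (dist w w') * a.pairing w')
          + Real.sinh (dist a w) * -(b.pairing w - Real.cosh (dist w w') * b.pairing w') := by
      linear_combination Real.cosh (dist w w') * e2 - e1 - Real.sinh (dist a b) * hcc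
    rw [e3]
    linarith
  refine le_trans ?_ (le_of_mul_le_mul_left key hE)
  exact mul_le_mul_of_nonneg_right (Real.sinh_le_sinh.2 hd) s3

/-- Along a segment, `sinh` of the distance to a convex set lies below the solution of `f'' = f`
with the same boundary values. -/
lemma sinh_infDist_segment {A : Set H3} (hA : GeodConvex A) (hne : A.Nonempty) {a w b : H3}
    (h : Btw a w b) :
    Real.sinh (Metric.infDist w A) * Real.sinh (dist a b)
      ≤ Real.sinh (dist w b) * Real.sinh (Metric.infDist a A)
        + Real.sinh (dist a w) * Real.sinh (Metric.infDist b A) := by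
  have s1 := Real.sinh_nonneg_iff.2 (dist_nonneg (x := w) (y := b))
  have s2 := Real.sinh_nonneg_iff.2 (dist_nonneg (x := a) (y := w))
  have hlim : Tendsto (fun r : ℝ => Real.sinh (dist w b) * Real.sinh (Metric.infDist a A + r)
        + Real.sinh (dist a w) * Real.sinh (Metric.infDist b A + r)) (𝓝[>] 0)
      (𝓝 (Real.sinh (dist w b) * Real.sinh (Metric.infDist a A + 0)
        + Real.sinh (dist a w) * Real.sinh (Metric.infDist b A + 0))) := by
    apply Tendsto.mono_left _ nhdsWithin_le_nhds
    apply Continuous.tendsto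
    fun_prop
  rw [add_zero, add_zero] at hlim
  apply ge_of_tendsto hlim
  filter_upwards [self_mem_nhdsWithin] with r hr
  obtain ⟨a', ha', h1⟩ :=
    (Metric.infDist_lt_iff hne).1 (lt_add_of_pos_right (Metric.infDist a A) hr)
  obtain ⟨b', hb', h2⟩ :=
    (Metric.infDist_lt_iff hne).1 (lt_add_of_pos_right (Metric.infDist b A) hr)
  refine (sinh_dist_segment hA h ha' hb').trans (add_le_add ?_ ?_)
  · exact mul_le_mul_of_nonneg_left (Real.sinh_le_sinh.2 h1.le) s1
  · exact mul_le_mul_of_nonneg_left (Real.sinh_le_sinh.2 h2.le) s2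

lemma sinh_add_le {x y : ℝ} (hx : 0 ≤ x) (hy : 0 ≤ y) :
    Real.sinh x + Real.sinh y ≤ Real.sinh (x + y) := by
  rw [Real.sinh_add]
  have h1 := Real.one_le_cosh x
  have h2 := Real.one_le_cosh y
  have h3 := Real.sinh_nonneg_iff.2 hx
  have h4 := Real.sinh_nonneg_iff.2 hy
  nlinarith

lemma mem_cthickening_iff {A : Set H3} (hne : A.Nonempty) {r : ℝ} (hr : 0 ≤ r) :
    p ∈ Metric.cthickening r A ↔ Metric.infDist p A ≤ r := by
  rw [Metric.mem_cthickening_iff, Metric.infDist,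
    ENNReal.le_ofReal_iff_toReal_le (Metric.infEDist_ne_top hne) hr]

lemma mem_cthickening_add {A : Set H3} {r s : ℝ} (hr : 0 ≤ r) (h : p ∈ Metric.cthickening r A)
    (hd : dist p q ≤ s) : q ∈ Metric.cthickening (r + s) A := by
  have hs : 0 ≤ s := dist_nonneg.trans hd
  rw [Metric.mem_cthickening_iff] at h ⊢
  rw [ENNReal.ofReal_add hr hs]
  refine (Metric.infEDist_le_infEDist_add_edist (x := q) (y := p)).trans (add_le_add h ?_)
  rw [edist_comm, edist_dist]
  exact ENNReal.ofReal_le_ofReal hd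

/-- Closed neighbourhoods of convex sets are convex. -/
lemma GeodConvex.cthickening {A : Set H3} (hA : GeodConvex A) {r : ℝ} (hr : 0 ≤ r) :
    GeodConvex (Metric.cthickening r A) := by
  rcases A.eq_empty_or_nonempty with rfl | hne
  · rw [Metric.cthickening_empty]; intro p hp; exact hp.elim
  intro a ha b hb w hw
  rw [mem_cthickening_iff hne hr] at *
  have h := sinh_infDist_segment hA hne hw
  rcases eq_or_lt_of_le (dist_nonneg (x := a) (y := b)) with h0 | h0
  · have e1 : dist a w = 0 := by
      linarith [dist_nonneg (x := a) (y := w), dist_nonneg (x := w) (y := b)]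
    rwa [← dist_eq_zero.1 e1]
  have s1 := Real.sinh_nonneg_iff.2 (dist_nonneg (x := w) (y := b))
  have s2 := Real.sinh_nonneg_iff.2 (dist_nonneg (x := a) (y := w))
  have hS := Real.sinh_pos_iff.2 h0
  have hr' := Real.sinh_nonneg_iff.2 hr
  have k1 := mul_le_mul_of_nonneg_left (Real.sinh_le_sinh.2 ha) s1
  have k2 := mul_le_mul_of_nonneg_left (Real.sinh_le_sinh.2 hb) s2
  have k3 := sinh_add_le (dist_nonneg (x := a) (y := w)) (dist_nonneg (x := w) (y := b))
  rw [hw] at k3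
  have k4 : Real.sinh (Metric.infDist w A) * Real.sinh (dist a b)
      ≤ Real.sinh r * Real.sinh (dist a b) := by nlinarith
  exact Real.sinh_le_sinh.1 (le_of_mul_le_mul_right k4 hS)

/-- Exponential decay of a ratio of hyperbolic sines. -/
lemma sinh_le_exp_mul {x y D : ℝ} (h : x + D ≤ y) (hD : 0 ≤ D) :
    Real.sinh x ≤ Real.exp (-D) * Real.sinh y := by
  have h1 : Real.sinh (x + D) ≤ Real.sinh y := Real.sinh_le_sinh.2 h
  refine le_trans ?_ (mul_le_mul_of_nonneg_left h1 (Real.exp_pos _).le)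
  rw [Real.sinh_eq, Real.sinh_eq, neg_add, Real.exp_add, Real.exp_add]
  have e : Real.exp (-D) * Real.exp D = 1 := by rw [← Real.exp_add]; simp
  have h2 : Real.exp (-D) ≤ 1 := Real.exp_le_one_iff.2 (by linarith)
  have h3 := Real.exp_pos (-x)
  have h4 := Real.exp_pos (-D)
  have h5 : Real.exp (-D) * Real.exp (-D) ≤ 1 := by nlinarith
  have e4 : Real.exp (-D) * ((Real.exp x * Real.exp D - Real.exp (-x) * Real.exp (-D)) / 2)
      = (Real.exp x - Real.exp (-x) * (Real.exp (-D) * Real.exp (-D))) / 2 := by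
    linear_combination Real.exp x / 2 * e
  rw [e4]
  nlinarith [mul_le_mul_of_nonneg_left h5 h3.le]

/-! ### Thin triangles -/

lemma three_halves_le_cosh_one : 3 / 2 ≤ Real.cosh 1 := by
  rw [Real.cosh_eq]
  have h1 := Real.exp_one_gt_d9
  have h2 := Real.exp_one_lt_d9
  have h3 : Real.exp 1 * Real.exp (-1) = 1 := by rw [← Real.exp_add]; simp
  have h4 := Real.exp_pos (-1)
  have h5 : 1 ≤ 2.72 * Real.exp (-1) := by nlinarith
  linarith

/-- Points on two sides of a triangle, at the same distance from the common vertex, are `1`-close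
as long as this distance is at most the Gromov product. -/
lemma dist_le_one_of_gromov {x y p q : H3} {t : ℝ} (hp : Btw z p x) (hq : Btw z q y)
    (hpt : dist z p = t) (hqt : dist z q = t) (ht : 2 * t ≤ dist z x + dist z y - dist x y) :
    dist p q ≤ 1 := by
  obtain ⟨a, ha⟩ : ∃ a, a = dist z x := ⟨_, rfl⟩
  obtain ⟨b, hb⟩ : ∃ b, b = dist z y := ⟨_, rfl⟩
  obtain ⟨c, hc⟩ : ∃ c, c = dist x y := ⟨_, rfl⟩
  have ht0 : 0 ≤ t := hpt ▸ dist_nonneg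
  rcases eq_or_lt_of_le ht0 with h0 | h0
  · rw [← h0] at hpt hqt
    rw [← dist_eq_zero.1 hpt, ← dist_eq_zero.1 hqt, dist_self]; exact zero_le_one
  have tri1 : b ≤ a + c := by rw [ha, hb, hc]; exact dist_triangle z x y
  have tri2 : a ≤ b + c := by rw [ha, hb, hc, dist_comm x y]; exact dist_triangle z y x
  rw [← ha, ← hb, ← hc] at ht
  have hta : t ≤ a := by linarith
  have htb : t ≤ b := by linarith
  have e1 := hp.lin_eq
  have e2 := hq.lin_eq
  have hpx : dist p x = a - t := by unfold Btw at hp; linarith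
  have hqy : dist q y = b - t := by unfold Btw at hq; linarith
  rw [hpt, hpx, ← ha] at e1
  rw [hqt, hqy, ← hb] at e2
  have hSa : 0 < Real.sinh a := Real.sinh_pos_iff.2 (by linarith)
  have hSb : 0 < Real.sinh b := Real.sinh_pos_iff.2 (by linarith)
  have hzx : z.pairing x = Real.cosh a := by rw [← cosh_dist, ha]
  have hzy : z.pairing y = Real.cosh b := by rw [← cosh_dist, hb]
  have hxy : x.pairing y = Real.cosh c := by rw [← cosh_dist, hc]
  have e3 : mink (Real.sinh a • p.lin) (Real.sinh b • q.lin)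
      = mink (Real.sinh (a - t) • z.lin + Real.sinh t • x.lin)
        (Real.sinh (b - t) • z.lin + Real.sinh t • y.lin) := by rw [e1, e2]
  simp only [mink_smul_left, mink_smul_right, mink_add_left, mink_add_right, mink_lin,
    pairing_self, pairing_comm x z, hzx, hzy, hxy] at e3
  -- half the perimeter, measured from `z`, from `x` and from `y`
  obtain ⟨g, hg⟩ : ∃ g, g = (a + b - c) / 2 := ⟨_, rfl⟩
  obtain ⟨α, hα⟩ : ∃ α, α = (a + c - b) / 2 := ⟨_, rfl⟩
  obtain ⟨β, hβ⟩ : ∃ β, β = (b + c - a) / 2 := ⟨_, rfl⟩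
  have hcc : Real.cosh c - Real.cosh (a - b) = 2 * Real.sinh α * Real.sinh β := by
    have h1 : c = α + β := by rw [hα, hβ]; ring
    have h2 : a - b = α - β := by rw [hα, hβ]; ring
    rw [h1, h2, Real.cosh_add, Real.cosh_sub]; ring
  have hpq : Real.sinh a * Real.sinh b * (p.pairing q - 1)
      = 2 * Real.sinh t ^ 2 * (Real.sinh α * Real.sinh β) := by
    have : Real.sinh a * Real.sinh b * (p.pairing q - 1)
        = Real.sinh t ^ 2 * (Real.cosh c - Real.cosh (a - b)) := by
      have hct := Real.cosh_sq t
      rw [Real.cosh_sub a b]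
      rw [Real.sinh_sub, Real.sinh_sub] at e3
      linear_combination e3 + Real.sinh a * Real.sinh b * hct
    rw [this, hcc]; ring
  have hα0 : 0 ≤ α := by rw [hα]; linarith
  have hβ0 : 0 ≤ β := by rw [hβ]; linarith
  have htg : t ≤ g := by rw [hg]; linarith
  have hg0 : 0 ≤ g := by linarith
  have sα := Real.sinh_nonneg_iff.2 hα0
  have sβ := Real.sinh_nonneg_iff.2 hβ0
  have sg := Real.sinh_nonneg_iff.2 hg0
  have stt := Real.sinh_nonneg_iff.2 ht0
  have stg : Real.sinh t ≤ Real.sinh g := Real.sinh_le_sinh.2 htg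
  have bound : ∀ r : ℝ, 0 ≤ r → 2 * Real.sinh g * Real.sinh r ≤ Real.sinh (g + r) := by
    intro r hr
    rw [Real.sinh_add]
    have h1 := (Real.sinh_lt_cosh g).le
    have h2 := (Real.sinh_lt_cosh r).le
    have h3 := Real.sinh_nonneg_iff.2 hr
    nlinarith
  have ba := bound α hα0
  have bb := bound β hβ0
  have ea : g + α = a := by rw [hg, hα]; ring
  have eb : g + β = b := by rw [hg, hβ]; ring
  rw [ea] at ba
  rw [eb] at bb
  have hfin : Real.sinh a * Real.sinh b * (p.pairing q - 1) ≤
      Real.sinh a * Real.sinh b * (1 / 2) := by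
    rw [hpq]
    have h1 : (2 * Real.sinh g * Real.sinh α) * (2 * Real.sinh g * Real.sinh β)
        ≤ Real.sinh a * Real.sinh b := mul_le_mul ba bb (by positivity) hSa.le
    have h2 : Real.sinh t ^ 2 ≤ Real.sinh g ^ 2 := by gcongr
    have h3 : 0 ≤ Real.sinh α * Real.sinh β := by positivity
    have h4 := mul_le_mul_of_nonneg_right h2 h3
    linarith
  have h1 := le_of_mul_le_mul_left hfin (by positivity)
  rw [dist_le_iff zero_le_one]
  linarith [three_halves_le_cosh_one]

/-! ### Local geodesics -/

/-- A path in `ℍ³` that locally is a geodesic of constant speed is one globally. -/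
lemma dist_eq_of_locally {f : unitInterval → H3} {v : ℝ}
    (hf : ∀ t, ∃ U ∈ 𝓝 t, ∀ s ∈ U, ∀ s' ∈ U, dist (f s) (f s') = v * dist s s') :
    ∀ s s', dist (f s) (f s') = v * dist s s' := by
  have hcov : (univ : Set unitInterval) ⊆ ⋃ t, interior (hf t).choose := fun t _ =>
    mem_iUnion.2 ⟨t, mem_interior_iff_mem_nhds.2 (hf t).choose_spec.1⟩
  obtain ⟨δ, hδ, hleb⟩ := lebesgue_number_lemma_of_metric isCompact_univ
    (fun t => isOpen_interior) hcov
  have hloc : ∀ s s', dist s s' < δ → dist (f s) (f s') = v * dist s s' := by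
    intro s s' h
    obtain ⟨t, ht⟩ := hleb s (mem_univ _)
    exact (hf t).choose_spec.2 s (interior_subset (ht (Metric.mem_ball_self hδ))) s'
      (interior_subset (ht (by rw [Metric.mem_ball, dist_comm]; exact h)))
  have hv : 0 ≤ v := by
    by_contra hv
    push Not at hv
    have hm : min (δ / 2) 1 ∈ unitInterval := ⟨by positivity, min_le_right _ _⟩
    have hd : dist (⟨min (δ / 2) 1, hm⟩ : unitInterval) 0 = min (δ / 2) 1 := by
      rw [Subtype.dist_eq, Real.dist_eq]
      simp only [Set.Icc.coe_zero, sub_zero]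
      exact abs_of_nonneg (by positivity)
    have h := hloc ⟨min (δ / 2) 1, hm⟩ 0 (by
      rw [hd]; exact (min_le_left _ _).trans_lt (by linarith))
    rw [hd] at h
    have h1 : 0 < min (δ / 2) 1 := by positivity
    have h2 := dist_nonneg (x := f ⟨min (δ / 2) 1, hm⟩) (y := f 0)
    nlinarith
  have hdist : ∀ s s' : unitInterval, s ≤ s' → dist s s' = s'.1 - s.1 := by
    intro s s' h
    rw [Subtype.dist_eq, Real.dist_eq, abs_sub_comm,
      abs_of_nonneg (sub_nonneg.2 (Subtype.coe_le_coe.2 h))]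
  have key : ∀ (n : ℕ) (s s' : unitInterval), s ≤ s' → s'.1 - s.1 ≤ δ / 2 + n * (δ / 4) →
      dist (f s) (f s') = v * dist s s' := by
    intro n
    induction n with
    | zero =>
      intro s s' h h'
      apply hloc
      rw [hdist s s' h]
      simp at h'; linarith
    | succ n ih =>
      intro s s' h h'
      rcases le_or_gt (s'.1 - s.1) (δ / 2) with hle | hlt
      · exact hloc _ _ (by rw [hdist s s' h]; linarith)
      push_cast at h'
      obtain ⟨m, hm⟩ : ∃ m : unitInterval, m.1 = s'.1 - δ / 2 :=
        ⟨⟨s'.1 - δ / 2, by have := s.2.1; linarith, by have := s'.2.2; linarith⟩, rfl⟩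
      obtain ⟨m', hm'⟩ : ∃ m : unitInterval, m.1 = s'.1 - δ / 4 :=
        ⟨⟨s'.1 - δ / 4, by have := s.2.1; linarith, by have := s'.2.2; linarith⟩, rfl⟩
      have h1 : s ≤ m := Subtype.coe_le_coe.1 (by linarith)
      have h2 : m ≤ m' := Subtype.coe_le_coe.1 (by linarith)
      have h3 : m' ≤ s' := Subtype.coe_le_coe.1 (by linarith)
      have e1 := ih s m h1 (by rw [hm]; have : 0 ≤ (n : ℝ) * (δ / 4) := by positivity
                               linarith)
      have e2 := ih s m' (h1.trans h2) (by rw [hm']; linarith)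
      have e3 := hloc m m' (by rw [hdist m m' h2]; linarith)
      have e4 := hloc m' s' (by rw [hdist m' s' h3]; linarith)
      have e5 := hloc m s' (by rw [hdist m s' (h2.trans h3)]; linarith)
      rw [hdist _ _ h1] at e1
      rw [hdist _ _ (h1.trans h2)] at e2
      rw [hdist _ _ h2] at e3
      rw [hdist _ _ h3] at e4
      rw [hdist _ _ (h2.trans h3)] at e5
      rw [hdist _ _ h]
      rcases eq_or_lt_of_le hv with h0 | h0
      · rw [← h0, zero_mul] at e2 e4 ⊢
        exact le_antisymm ((dist_triangle _ (f m') _).trans (by rw [e2, e4, add_zero]))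
          dist_nonneg
      have b1 : Btw (f s) (f m) (f m') := by unfold Btw; rw [e1, e2, e3]; ring
      have b2 : Btw (f m) (f m') (f s') := by unfold Btw; rw [e3, e4, e5]; ring
      rw [b1.glue b2 (by
        rw [← dist_pos, e3, hm, hm']
        have : s'.1 - δ / 4 - (s'.1 - δ / 2) = δ / 4 := by ring
        rw [this]; positivity), e1, e3, e4]
      ring
  intro s s'
  obtain ⟨n, hn⟩ := exists_nat_gt (1 / (δ / 4))
  have hn' : ∀ a b : unitInterval, b.1 - a.1 ≤ δ / 2 + n * (δ / 4) := by
    intro a b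
    rw [div_lt_iff₀ (by positivity)] at hn
    have := a.2.1
    have := b.2.2
    linarith
  rcases le_total s s' with h | h
  · exact key n s s' h (hn' _ _)
  · rw [dist_comm, dist_comm s]; exact key n s' s h (hn' _ _)

end H3

namespace H3

variable {p q z : H3}

lemma mem_cthickening_of_mem {A : Set H3} {r : ℝ} (h : p ∈ A) : p ∈ Metric.cthickening r A :=
  Metric.self_subset_cthickening A h

lemma Btw.trans_left {x u w : H3} (h : Btw z u x) (h' : Btw z w u) : Btw z w x := by
  unfold Btw at *
  have := dist_triangle z w x
  have := dist_triangle w u x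
  linarith

lemma Btw.btw_of_le {x a w : H3} (ha : Btw x a q) (hw : Btw x w q) (h : dist x a ≤ dist x w) :
    Btw x a w := by
  obtain ⟨a', ha', hd⟩ := exists_btw x w dist_nonneg h
  rwa [ha.eq_of_dist (hw.trans_left ha') hd.symm]

lemma Btw.btw_mid {x a w b : H3} (ha : Btw x a q) (hw : Btw x w q) (hb : Btw x b q)
    (h : dist x a ≤ dist x w) (h' : dist x w ≤ dist x b) : Btw a w b := by
  have h1 := ha.btw_of_le hw h
  have h2 := hw.btw_of_le hb h'
  have h3 := ha.btw_of_le hb (h.trans h')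
  unfold Btw at *
  linarith

/-! ### Chains of convex sets -/

/-- If two sides of a triangle fellow-travel up to the point where one of them leaves the
neighbourhood of its convex set, that point is close to both convex sets. -/
lemma fellow_travel_false {A B : Set H3} (hA : GeodConvex A) (hB : GeodConvex B)
    {x y u v : H3} {m : ℝ} (hzA : z ∈ A) (hzB : z ∈ B)
    (hxu : Btw z u x) (huA : u ∈ Metric.cthickening (3 / 2) A)
    (hu : ∀ p, dist u p ≤ 3 / 2 → p ∈ Metric.cthickening 3 A → p ∈ Metric.cthickening 3 B → False)
    (hyv : Btw z v y) (hvB : v ∈ Metric.cthickening (3 / 2) B)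
    (hm0 : 0 ≤ m) (hmu : m ≤ dist z u) (hum : dist z u ≤ m + 3 / 2) (hmv : m ≤ dist z v)
    (hmg : 2 * m ≤ dist z x + dist z y - dist x y) : False := by
  obtain ⟨p, hp, hpm⟩ := exists_btw z u hm0 hmu
  obtain ⟨q, hq, hqm⟩ := exists_btw z v hm0 hmv
  have hpA : p ∈ Metric.cthickening (3 / 2) A :=
    (hA.cthickening (by norm_num)).mem (mem_cthickening_of_mem hzA) huA hp
  have hqB : q ∈ Metric.cthickening (3 / 2) B :=
    (hB.cthickening (by norm_num)).mem (mem_cthickening_of_mem hzB) hvB hq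
  have hpq := dist_le_one_of_gromov (hxu.trans_left hp) (hyv.trans_left hq) hpm hqm hmg
  refine hu p ?_ ?_ ?_
  · rw [dist_comm]; unfold Btw at hp; linarith
  · exact Metric.cthickening_mono (by norm_num) _ hpA
  · have := mem_cthickening_add (q := p) (s := 1) (by norm_num) hqB
      (by rw [dist_comm]; exact hpq)
    exact Metric.cthickening_mono (by norm_num) _ this

/-- The contraction constant that makes the bound `3 / 2` in chains self-improving. -/
lemma exp_mul_sinh_le : Real.exp (-(3 / 2)) * Real.sinh (3 / 2) ≤ Real.sinh (1 / 2) := by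
  have h1 : Real.exp (-(3 / 2)) * Real.sinh (3 / 2) ≤ 1 / 2 := by
    rw [Real.sinh_eq]
    have e : Real.exp (-(3 / 2)) * Real.exp (3 / 2) = 1 := by rw [← Real.exp_add]; norm_num
    nlinarith [sq_nonneg (Real.exp (-(3 / 2)))]
  exact h1.trans (Real.self_le_sinh_iff.2 (by norm_num))

lemma mem_cthickening_half {A : Set H3} (hA : GeodConvex A) {x u p : H3} (hzA : z ∈ A)
    (hxu : Btw z u x) (huA : u ∈ Metric.cthickening (3 / 2) A) (hp : Btw z p x)
    (h : dist z p + 3 / 2 ≤ dist z u) : p ∈ Metric.cthickening (1 / 2) A := by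
  have hne : A.Nonempty := ⟨z, hzA⟩
  have hpu : Btw z p u := hp.btw_of_le hxu (by linarith)
  rw [mem_cthickening_iff hne (by norm_num)] at huA ⊢
  have h1 := sinh_infDist_segment hA hne hpu
  rw [Metric.infDist_zero_of_mem hzA, Real.sinh_zero, mul_zero, zero_add] at h1
  have h2 := sinh_le_exp_mul h (by norm_num)
  have h3 := Real.sinh_le_sinh.2 huA
  have hU : 0 < Real.sinh (dist z u) := by
    apply Real.sinh_pos_iff.2; linarith [dist_nonneg (x := z) (y := p)]
  have h4 := Real.sinh_nonneg_iff.2 (dist_nonneg (x := z) (y := p))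
  have h5 : Real.sinh (dist z p) * Real.sinh (Metric.infDist u A)
      ≤ (Real.exp (-(3 / 2)) * Real.sinh (dist z u)) * Real.sinh (3 / 2) :=
    mul_le_mul h2 h3 (Real.sinh_nonneg_iff.2 Metric.infDist_nonneg) (by positivity)
  have h6 : Real.sinh (Metric.infDist p A) * Real.sinh (dist z u)
      ≤ Real.sinh (1 / 2) * Real.sinh (dist z u) := by
    nlinarith [exp_mul_sinh_le]
  exact Real.sinh_le_sinh.1 (le_of_mul_le_mul_right h6 hU)

/-- Let `z` be a common point of the convex sets `A` and `B`. If `[z, x]` stays close to `A` and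
`[z, y]` stays close to `B`, or leave these sets only where `A` and `B` are no longer close to each
other, then the third side of the triangle passes close to both sets. -/
lemma exists_near_both {A B : Set H3} (hA : GeodConvex A) (hB : GeodConvex B)
    {x y u v : H3} (hzA : z ∈ A) (hzB : z ∈ B)
    (hxu : Btw z u x) (huA : u ∈ Metric.cthickening (3 / 2) A)
    (hu : (u = x ∧ x ∈ A) ∨
      ∀ p, dist u p ≤ 3 / 2 → p ∈ Metric.cthickening 3 A → p ∈ Metric.cthickening 3 B → False)
    (hyv : Btw z v y) (hvB : v ∈ Metric.cthickening (3 / 2) B)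
    (hv : (v = y ∧ y ∈ B) ∨
      ∀ p, dist v p ≤ 3 / 2 → p ∈ Metric.cthickening 3 A → p ∈ Metric.cthickening 3 B → False) :
    ∃ c, Btw x c y ∧ c ∈ Metric.cthickening (3 / 2) A ∧ c ∈ Metric.cthickening (3 / 2) B := by
  obtain ⟨g, hg⟩ : ∃ g, g = (dist z x + dist z y - dist x y) / 2 := ⟨_, rfl⟩
  have t1 := dist_triangle x z y
  have t2 := dist_triangle z x y
  have t3 := dist_triangle z y x
  rw [dist_comm x z] at t1
  rw [dist_comm y x] at t3
  have hg0 : 0 ≤ g := by linarith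
  have hgx : g ≤ dist z x := by linarith
  have hgy : g ≤ dist z y := by linarith
  obtain ⟨p, hp, hpg⟩ := exists_btw z x hg0 hgx
  obtain ⟨q, hq, hqg⟩ := exists_btw z y hg0 hgy
  by_cases gx : (u = x ∧ x ∈ A) ∨ g + 3 / 2 ≤ dist z u
  · by_cases gy : (v = y ∧ y ∈ B) ∨ g + 3 / 2 ≤ dist z v
    · have hpA : p ∈ Metric.cthickening (1 / 2) A := by
        rcases gx with ⟨_, h⟩ | h
        · exact mem_cthickening_of_mem (hA.mem hzA h hp)
        · exact mem_cthickening_half hA hzA hxu huA hp (by rw [hpg]; exact h)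
      have hqB : q ∈ Metric.cthickening (1 / 2) B := by
        rcases gy with ⟨_, h⟩ | h
        · exact mem_cthickening_of_mem (hB.mem hzB h hq)
        · exact mem_cthickening_half hB hzB hyv hvB hq (by rw [hqg]; exact h)
      obtain ⟨c, hc, hcd⟩ := exists_btw x y (r := dist z x - g) (by linarith) (by linarith)
      have hpx : dist x p = dist z x - g := by rw [dist_comm]; unfold Btw at hp; linarith
      have hqy : dist y q = dist z y - g := by rw [dist_comm]; unfold Btw at hq; linarith
      have hcy : dist y c = dist z y - g := by rw [dist_comm]; unfold Btw at hc; linarith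
      have d1 := dist_le_one_of_gromov hp.symm hc hpx hcd
        (by rw [dist_comm x z]; linarith)
      have d2 := dist_le_one_of_gromov hq.symm hc.symm hqy hcy
        (by rw [dist_comm y z, dist_comm y x, dist_comm z x]; rw [dist_comm z x] at hg; linarith)
      have e1 := mem_cthickening_add (by norm_num) hpA d1
      have e2 := mem_cthickening_add (by norm_num) hqB d2
      norm_num at e1 e2
      exact ⟨c, hc, e1, e2⟩
    · exfalso
      push Not at gy
      have hv' := hv.resolve_left (fun h => gy.1 h.1 h.2)
      have hUm : min g (dist z v) ≤ dist z u := by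
        rcases gx with ⟨h, _⟩ | h
        · rw [h]; exact (min_le_left _ _).trans hgx
        · exact (min_le_left _ _).trans (by linarith)
      refine fellow_travel_false (m := min g (dist z v)) hB hA hzB hzA hyv hvB
        (fun p h1 h2 h3 => hv' p h1 h3 h2) hxu huA (by positivity) (min_le_right _ _) ?_ hUm ?_
      · rcases min_choice g (dist z v) with h | h <;> rw [h] <;> linarith
      · have := min_le_left g (dist z v); rw [dist_comm y x]; linarith
  · exfalso
    push Not at gx
    have hu' := hu.resolve_left (fun h => gx.1 h.1 h.2)
    by_cases hVm : min g (dist z u) ≤ dist z v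
    · refine fellow_travel_false (m := min g (dist z u)) hA hB hzA hzB hxu huA
        hu' hyv hvB (by positivity) (min_le_right _ _) ?_ hVm ?_
      · rcases min_choice g (dist z u) with h | h <;> rw [h] <;> linarith
      · have := min_le_left g (dist z u); linarith
    · push Not at hVm
      have h1 := min_le_left g (dist z u)
      have h2 := min_le_right g (dist z u)
      have hv' := hv.resolve_left (fun h => by rw [h.1] at hVm; linarith)
      refine fellow_travel_false (m := dist z v) hB hA hzB hzA hyv hvB
        (fun p h1 h2 h3 => hv' p h1 h3 h2) hxu huA dist_nonneg le_rfl (by linarith) (by linarith) ?_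
      rw [dist_comm y x]; linarith

section chain

variable {A : ℕ → Set H3} {k : ℕ}

/-- Along a chain of convex sets, each meeting the next, in which the `3`-neighbourhoods of three
successive members have no common point, geodesics between the ends pass `3 / 2`-close to the
successive intersections. -/
lemma exists_near_of_chain (hconv : ∀ i ≤ k, GeodConvex (A i))
    (hmeet : ∀ i < k, (A i ∩ A (i + 1)).Nonempty)
    (htri : ∀ i, i + 2 ≤ k → ∀ p, p ∈ Metric.cthickening 3 (A i) →
      p ∈ Metric.cthickening 3 (A (i + 1)) → p ∈ Metric.cthickening 3 (A (i + 2)) → False) :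
    ∀ n l, l + n ≤ k → ∀ x ∈ A l, ∀ y ∈ A (l + n), ∀ i < n, ∃ c, Btw x c y ∧
      c ∈ Metric.cthickening (3 / 2) (A (l + i)) ∧
      c ∈ Metric.cthickening (3 / 2) (A (l + i + 1)) := by
  intro n
  induction n using Nat.strong_induction_on with
  | _ n ih =>
  intro l hl x hx y hy i hi
  obtain ⟨z, hz1, hz2⟩ := hmeet (l + i) (by omega)
  have hX : ∃ u, Btw z u x ∧ u ∈ Metric.cthickening (3 / 2) (A (l + i)) ∧
      ((u = x ∧ x ∈ A (l + i)) ∨ ∀ p, dist u p ≤ 3 / 2 → p ∈ Metric.cthickening 3 (A (l + i)) →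
        p ∈ Metric.cthickening 3 (A (l + i + 1)) → False) := by
    rcases Nat.eq_zero_or_pos i with rfl | h0
    · exact ⟨x, btw_right _ _, mem_cthickening_of_mem hx, Or.inl ⟨rfl, hx⟩⟩
    · obtain ⟨i, rfl⟩ : ∃ j, i = j + 1 := ⟨i - 1, by omega⟩
      obtain ⟨u, hu, h1, h2⟩ := ih (i + 1) hi l (by omega) x hx z hz1 i (by omega)
      refine ⟨u, hu.symm, h2, Or.inr fun p hp hp1 hp2 => htri (l + i) (by omega) p ?_ hp1 hp2⟩
      have := mem_cthickening_add (by norm_num) h1 hp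
      exact Metric.cthickening_mono (by norm_num) _ this
  have hY : ∃ v, Btw z v y ∧ v ∈ Metric.cthickening (3 / 2) (A (l + i + 1)) ∧
      ((v = y ∧ y ∈ A (l + i + 1)) ∨ ∀ p, dist v p ≤ 3 / 2 →
        p ∈ Metric.cthickening 3 (A (l + i)) →
        p ∈ Metric.cthickening 3 (A (l + i + 1)) → False) := by
    rcases eq_or_lt_of_le (Nat.succ_le_of_lt hi) with h0 | h0
    · have e : l + n = l + i + 1 := by omega
      rw [e] at hy
      exact ⟨y, btw_right _ _, mem_cthickening_of_mem hy, Or.inl ⟨rfl, hy⟩⟩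
    · obtain ⟨j, hj⟩ : ∃ j, n = i + 1 + (j + 1) := ⟨n - (i + 2), by omega⟩
      have e : l + n = l + i + 1 + (j + 1) := by omega
      rw [e] at hy
      obtain ⟨v, hv, h1, h2⟩ := ih (j + 1) (by omega) (l + i + 1) (by omega) z hz2 y hy 0
        (by omega)
      refine ⟨v, hv, h1, Or.inr fun p hp hp1 hp2 => htri (l + i) (by omega) p hp1 hp2 ?_⟩
      have := mem_cthickening_add (by norm_num) h2 hp
      exact Metric.cthickening_mono (by norm_num) _ this
  obtain ⟨u, hu, huA, hu'⟩ := hX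
  obtain ⟨v, hv, hvB, hv'⟩ := hY
  exact exists_near_both (hconv _ (by omega)) (hconv _ (by omega)) hz1 hz2 hu huA hu' hv hvB hv'

/-- A geodesic between the ends of a chain is covered by segments between points close to the
successive intersections. -/
lemma exists_segment_of_chain (hconv : ∀ i ≤ k, GeodConvex (A i))
    (hmeet : ∀ i < k, (A i ∩ A (i + 1)).Nonempty)
    (htri : ∀ i, i + 2 ≤ k → ∀ p, p ∈ Metric.cthickening 3 (A i) →
      p ∈ Metric.cthickening 3 (A (i + 1)) → p ∈ Metric.cthickening 3 (A (i + 2)) → False)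
    {x y w : H3} (hx : x ∈ A 0) (hy : y ∈ A k) (hw : Btw x w y) :
    ∃ i ≤ k, ∃ a b, Btw a w b ∧ a ∈ Metric.cthickening (3 / 2) (A i) ∧
      b ∈ Metric.cthickening (3 / 2) (A i) ∧
      (a = x ∨ ∃ j, j + 1 = i ∧ a ∈ Metric.cthickening (3 / 2) (A j)) ∧
      (b = y ∨ i + 1 ≤ k ∧ b ∈ Metric.cthickening (3 / 2) (A (i + 1))) := by
  have hc : ∀ j, ∃ c, Btw x c y ∧ (j < k → c ∈ Metric.cthickening (3 / 2) (A j) ∧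
      c ∈ Metric.cthickening (3 / 2) (A (j + 1))) ∧ (j = k → c = y) := by
    intro j
    rcases lt_or_ge j k with h | h
    · obtain ⟨c, h0, h1, h2⟩ := exists_near_of_chain hconv hmeet htri k 0 (by omega) x hx y
        (by simpa using hy) j h
      rw [zero_add] at h1 h2
      exact ⟨c, h0, fun _ => ⟨h1, h2⟩, fun h' => by omega⟩
    · exact ⟨y, btw_right _ _, fun h' => by omega, fun _ => rfl⟩
  choose c hc1 hc2 hc3 using hc
  have hex : ∃ j, dist x w ≤ dist x (c j) := ⟨k, by
    rw [hc3 k rfl]; unfold Btw at hw; linarith [dist_nonneg (x := w) (y := y)]⟩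
  classical
  obtain ⟨i, hi, hmin⟩ : ∃ i, dist x w ≤ dist x (c i) ∧ ∀ j < i, ¬ dist x w ≤ dist x (c j) :=
    ⟨Nat.find hex, Nat.find_spec hex, fun j hj => Nat.find_min hex hj⟩
  have hik : i ≤ k := by
    by_contra h
    refine hmin k (by omega) ?_
    rw [hc3 k rfl]; unfold Btw at hw; linarith [dist_nonneg (x := w) (y := y)]
  have hb : c i ∈ Metric.cthickening (3 / 2) (A i) ∧
      (c i = y ∨ i + 1 ≤ k ∧ c i ∈ Metric.cthickening (3 / 2) (A (i + 1))) := by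
    rcases eq_or_lt_of_le hik with h | h
    · rw [hc3 i h]; subst h; exact ⟨mem_cthickening_of_mem hy, Or.inl rfl⟩
    · exact ⟨(hc2 i h).1, Or.inr ⟨h, (hc2 i h).2⟩⟩
  rcases Nat.eq_zero_or_pos i with h0 | h0
  · subst h0
    exact ⟨0, hik, x, c 0, (btw_left x y).btw_mid hw (hc1 0) (by rw [dist_self]; exact dist_nonneg)
      hi, mem_cthickening_of_mem hx, hb.1, Or.inl rfl, hb.2⟩
  · obtain ⟨j, rfl⟩ : ∃ j, i = j + 1 := ⟨i - 1, by omega⟩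
    have h1 := hc2 j (by omega)
    exact ⟨j + 1, hik, c j, c (j + 1), (hc1 j).btw_mid hw (hc1 _)
      (le_of_not_ge (hmin j (by omega))) hi, h1.2, hb.1, Or.inr ⟨j, rfl, h1.1⟩, hb.2⟩

end chain

end H3

/-! ### Patterns of convex sets -/

/-- A family of nonempty convex subsets of `ℍ³` with a graph on its index set: adjacent members
meet, the graph is bipartite (`zero` is one of the two classes of vertices), and the
`8`-neighbourhoods of the successive members of a path of length two have no common point. -/
structure ConvexPattern (I : Type*) where
  G : SimpleGraph I
  M : I → Set H3
  zero : I → Prop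
  nonempty : ∀ α, (M α).Nonempty
  convex : ∀ α, H3.GeodConvex (M α)
  meet : ∀ α β, G.Adj α β → (M α ∩ M β).Nonempty
  bipartite : ∀ α β, G.Adj α β → (zero α ↔ ¬ zero β)
  separated : ∀ α β γ, G.Adj α β → G.Adj β γ → α ≠ γ → ∀ p, p ∈ Metric.cthickening 8 (M α) →
    p ∈ Metric.cthickening 8 (M β) → p ∈ Metric.cthickening 8 (M γ) → False

namespace ConvexPattern

open H3

variable {I : Type*} (T : ConvexPattern I) {α β γ : I} {x y w p : H3} {ρ e R D : ℝ}

/-- A path of a pattern gives a chain of convex sets. -/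
lemma exists_chain (h : T.G.Reachable α β) : ∃ (k : ℕ) (v : ℕ → I), v 0 = α ∧ v k = β ∧
    (∀ i < k, T.G.Adj (v i) (v (i + 1))) ∧ (∀ i, i + 2 ≤ k → v i ≠ v (i + 2)) ∧
    ∀ i, T.G.Reachable α (v i) := by
  classical
  obtain ⟨p, hp⟩ := h.exists_isPath
  refine ⟨p.length, p.getVert, p.getVert_zero, p.getVert_length,
    fun i hi => p.adj_getVert_succ hi, fun i hi heq => ?_, fun i => ⟨p.take i⟩⟩
  have := hp.getVert_injOn (by simp; omega) (by simp; omega) heq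
  omega

lemma chain_separated {v : ℕ → I} {k : ℕ} (hρ : 0 ≤ ρ) (hρ5 : ρ ≤ 5)
    (hadj : ∀ i < k, T.G.Adj (v i) (v (i + 1))) (hne : ∀ i, i + 2 ≤ k → v i ≠ v (i + 2)) :
    ∀ i, i + 2 ≤ k → ∀ p, p ∈ Metric.cthickening 3 (Metric.cthickening ρ (T.M (v i))) →
      p ∈ Metric.cthickening 3 (Metric.cthickening ρ (T.M (v (i + 1)))) →
      p ∈ Metric.cthickening 3 (Metric.cthickening ρ (T.M (v (i + 2)))) → False := by
  intro i hi p h0 h1 h2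
  have hsub : ∀ A : Set H3, Metric.cthickening 3 (Metric.cthickening ρ A)
      ⊆ Metric.cthickening 8 A := fun A =>
    (Metric.cthickening_cthickening_subset (by norm_num) hρ A).trans
      (Metric.cthickening_mono (by linarith) A)
  exact T.separated _ _ _ (hadj i (by omega)) (hadj (i + 1) (by omega)) (hne i hi) p
    (hsub _ h0) (hsub _ h1) (hsub _ h2)

lemma exists_segment (hρ : 0 ≤ ρ) (hρ5 : ρ ≤ 5) (h : T.G.Reachable α β)
    (hx : x ∈ Metric.cthickening ρ (T.M α)) (hy : y ∈ Metric.cthickening ρ (T.M β))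
    (hw : H3.Btw x w y) : ∃ γ, T.G.Reachable α γ ∧ ∃ a b, H3.Btw a w b ∧
      a ∈ Metric.cthickening (ρ + 3 / 2) (T.M γ) ∧ b ∈ Metric.cthickening (ρ + 3 / 2) (T.M γ) ∧
      (a = x ∨ ∃ γ', T.G.Adj γ γ' ∧ a ∈ Metric.cthickening (ρ + 3 / 2) (T.M γ')) ∧
      (b = y ∨ ∃ γ', T.G.Adj γ γ' ∧ b ∈ Metric.cthickening (ρ + 3 / 2) (T.M γ')) := by
  obtain ⟨k, v, h0, hk, hadj, hne, hreach⟩ := T.exists_chain h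
  have hsub : ∀ A : Set H3, Metric.cthickening (3 / 2) (Metric.cthickening ρ A)
      ⊆ Metric.cthickening (ρ + 3 / 2) A := fun A =>
    (Metric.cthickening_cthickening_subset (by norm_num) hρ A).trans
      (Metric.cthickening_mono (by linarith) A)
  obtain ⟨i, hi, a, b, hab, ha, hb, ha', hb'⟩ := exists_segment_of_chain (k := k)
    (A := fun i => Metric.cthickening ρ (T.M (v i)))
    (fun i _ => (T.convex _).cthickening hρ)
    (fun i hi => by
      obtain ⟨z, h1, h2⟩ := T.meet _ _ (hadj i hi)
      exact ⟨z, mem_cthickening_of_mem h1, mem_cthickening_of_mem h2⟩)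
    (T.chain_separated hρ hρ5 hadj hne) (by rw [h0]; exact hx) (by rw [hk]; exact hy) hw
  refine ⟨v i, hreach i, a, b, hab, hsub _ ha, hsub _ hb, ?_, ?_⟩
  · rcases ha' with h | ⟨j, rfl, h⟩
    · exact Or.inl h
    · exact Or.inr ⟨_, (hadj j (by omega)).symm, hsub _ h⟩
  · rcases hb' with h | ⟨h, h'⟩
    · exact Or.inl h
    · exact Or.inr ⟨_, hadj i (by omega), hsub _ h'⟩

/-- The `5`-neighbourhoods of the members of a connected pattern meet only if the members are
adjacent. -/
lemma eq_or_adj (h : T.G.Reachable α β) (hα : p ∈ Metric.cthickening 5 (T.M α))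
    (hβ : p ∈ Metric.cthickening 5 (T.M β)) : α = β ∨ T.G.Adj α β := by
  obtain ⟨k, v, h0, hk, hadj, hne, -⟩ := T.exists_chain h
  have hsep := T.chain_separated (by norm_num) le_rfl hadj hne
  rcases k with _ | _ | k
  · left; rw [← h0, ← hk]
  · right; rw [← h0, ← hk]; exact hadj 0 (by omega)
  exfalso
  have key := exists_near_of_chain (k := k + 2)
    (A := fun i => Metric.cthickening 5 (T.M (v i)))
    (fun i _ => (T.convex _).cthickening (by norm_num))
    (fun i hi => by
      obtain ⟨z, h1, h2⟩ := T.meet _ _ (hadj i hi)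
      exact ⟨z, mem_cthickening_of_mem h1, mem_cthickening_of_mem h2⟩)
    hsep (k + 2) 0 (by omega) p (by rw [h0]; exact hα) p (by rw [zero_add, hk]; exact hβ)
  obtain ⟨c, hc, c0, c1⟩ := key 0 (by omega)
  obtain ⟨c', hc', c0', c1'⟩ := key 1 (by omega)
  rw [btw_self_iff] at hc hc'
  subst hc
  subst hc'
  have hm : ∀ A : Set H3, Metric.cthickening (3 / 2) A ⊆ Metric.cthickening 3 A := fun A =>
    Metric.cthickening_mono (by norm_num) A
  simp only [zero_add] at c0 c1 c1'
  exact hsep 0 (by omega) _ (hm _ c0) (hm _ c1) (hm _ c1')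

/-- The union of the `ρ`-neighbourhoods of the members in the component of `α`. -/
def nhd (α : I) (ρ : ℝ) : Set H3 := {p | ∃ β, T.G.Reachable α β ∧ p ∈ Metric.cthickening ρ (T.M β)}

/-- Adding the segments between points of the `ρ`-neighbourhood costs `3/2` in the radius. -/
lemma join_nhd_subset (hρ : 0 ≤ ρ) (hρ5 : ρ ≤ 5) : join (T.nhd α ρ) ⊆ T.nhd α (ρ + 3 / 2) := by
  rintro w ⟨x, ⟨β, hβ, hx⟩, y, ⟨γ, hγ, hy⟩, hw⟩
  obtain ⟨δ, hδ, a, b, hab, ha, hb, -, -⟩ := T.exists_segment hρ hρ5 (hβ.symm.trans hγ) hx hy hw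
  exact ⟨δ, hβ.trans hδ, ((T.convex δ).cthickening (by linarith)).mem ha hb hab⟩

lemma join_mono {S S' : Set H3} (h : S ⊆ S') : join S ⊆ join S' :=
  fun _ ⟨p, hp, q, hq, hz⟩ => ⟨p, h hp, q, h hq, hz⟩

/-- In dimension three the convex hull is reached by adding segments three times, whence the radius
`1/4 + 3 · 3/2 = 19/4`. -/
lemma hull_nhd_subset : hull (T.nhd α (1 / 4)) ⊆ T.nhd α (19 / 4) := by
  refine (hull_subset_join _).trans ?_
  have h1 : join (T.nhd α (1 / 4)) ⊆ T.nhd α (7 / 4) := by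
    have := T.join_nhd_subset (α := α) (ρ := 1 / 4) (by norm_num) (by norm_num)
    norm_num at this; exact this
  have h2 : join (T.nhd α (7 / 4)) ⊆ T.nhd α (13 / 4) := by
    have := T.join_nhd_subset (α := α) (ρ := 7 / 4) (by norm_num) (by norm_num)
    norm_num at this; exact this
  have h3 : join (T.nhd α (13 / 4)) ⊆ T.nhd α (19 / 4) := by
    have := T.join_nhd_subset (α := α) (ρ := 13 / 4) (by norm_num) (by norm_num)
    norm_num at this; exact this
  exact (join_mono ((join_mono h1).trans h2)).trans h3

/-- The points of the `ρ`-neighbourhood that are `R`-close to a member outside the class `zero`,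
or very close (the hyperbolic sine of the distance is at most `e`) to a member of that class. -/
def fine (α : I) (ρ e R : ℝ) : Set H3 := {p | p ∈ T.nhd α ρ ∧
  ((∃ β, T.G.Reachable α β ∧ ¬ T.zero β ∧ Metric.infDist p (T.M β) ≤ R) ∨
    ∃ β, T.G.Reachable α β ∧ T.zero β ∧ p ∈ Metric.cthickening ρ (T.M β) ∧
      Real.sinh (Metric.infDist p (T.M β)) ≤ e)}

/-- One end of a segment close to a member `γ` of the class `zero`: the contribution of this end to
the distance of `w` from `γ`, unless `w` is close to a member of the other class. -/
lemma end_estimate {a b : H3} (hD : 0 ≤ D) (he : 0 ≤ e) (hab : H3.Btw a w b)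
    (ha8 : Metric.infDist a (T.M γ) ≤ 8)
    (ha : (∃ β, T.G.Reachable α β ∧ ¬ T.zero β ∧ Metric.infDist a (T.M β) ≤ R) ∨
      Real.sinh (Metric.infDist a (T.M γ)) ≤ e) :
    (∃ β, T.G.Reachable α β ∧ ¬ T.zero β ∧ Metric.infDist w (T.M β) ≤ R + D) ∨
      (Real.sinh (Metric.infDist a (T.M γ)) ≤ e ∨ D ≤ dist a w) ∧
      Real.sinh (dist w b) * Real.sinh (Metric.infDist a (T.M γ))
        ≤ Real.sinh (dist w b) * e + Real.exp (-D) * Real.sinh 8 * Real.sinh (dist a b) := by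
  have s1 := Real.sinh_nonneg_iff.2 (dist_nonneg (x := w) (y := b))
  have s2 := Real.sinh_nonneg_iff.2 (dist_nonneg (x := a) (y := b))
  have s3 : 0 ≤ Real.sinh 8 := Real.sinh_nonneg_iff.2 (by norm_num)
  rcases ha with ⟨β, h1, h2, h3⟩ | h
  · rcases le_or_gt (dist a w) D with h | h
    · left
      refine ⟨β, h1, h2, ?_⟩
      have := Metric.infDist_le_infDist_add_dist (s := T.M β) (x := w) (y := a)
      rw [dist_comm] at this
      linarith
    · refine Or.inr ⟨Or.inr h.le, ?_⟩
      have k1 : Real.sinh (dist w b) ≤ Real.exp (-D) * Real.sinh (dist a b) :=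
        sinh_le_exp_mul (by unfold H3.Btw at hab; linarith) hD
      have k2 := Real.sinh_le_sinh.2 ha8
      have k3 := mul_le_mul k1 k2 (Real.sinh_nonneg_iff.2 Metric.infDist_nonneg) (by positivity)
      have := mul_nonneg s1 he
      linarith
  · refine Or.inr ⟨Or.inl h, ?_⟩
    have := mul_le_mul_of_nonneg_left h s1
    have : 0 ≤ Real.exp (-D) * Real.sinh 8 * Real.sinh (dist a b) := by positivity
    linarith

/-- Either a point of the segment is within `R + D` of a nonzero model, or it is deep inside a
subsegment near a zero model, where each far end contributes at most `exp (-D) * sinh 8`. -/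
lemma join_fine_subset (hρ : 0 ≤ ρ) (hρ5 : ρ + 3 / 2 ≤ 5) (he : 0 ≤ e) (hR : 8 ≤ R) (hD : 0 < D) :
    join (T.fine α ρ e R)
      ⊆ T.fine α (ρ + 3 / 2) (e + 2 * (Real.exp (-D) * Real.sinh 8)) (R + D) := by
  rintro w ⟨x, ⟨⟨β₁, hβ₁, hx⟩, hx'⟩, y, ⟨⟨β₂, hβ₂, hy⟩, hy'⟩, hw⟩
  obtain ⟨γ, hγ, a, b, hab, ha, hb, ha', hb'⟩ :=
    T.exists_segment hρ (by linarith) (hβ₁.symm.trans hβ₂) hx hy hw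
  have hγ' : T.G.Reachable α γ := hβ₁.trans hγ
  have hwγ : w ∈ Metric.cthickening (ρ + 3 / 2) (T.M γ) :=
    ((T.convex γ).cthickening (by linarith)).mem ha hb hab
  refine ⟨⟨γ, hγ', hwγ⟩, ?_⟩
  by_cases hz : T.zero γ
  swap
  · left
    rw [mem_cthickening_iff (T.nonempty γ) (by linarith)] at hwγ
    exact ⟨γ, hγ', hz, by linarith⟩
  have hend : ∀ c x : H3, c ∈ Metric.cthickening (ρ + 3 / 2) (T.M γ) →
      ((∃ β, T.G.Reachable α β ∧ ¬ T.zero β ∧ Metric.infDist x (T.M β) ≤ R) ∨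
        ∃ β, T.G.Reachable α β ∧ T.zero β ∧ x ∈ Metric.cthickening ρ (T.M β) ∧
          Real.sinh (Metric.infDist x (T.M β)) ≤ e) →
      (c = x ∨ ∃ γ', T.G.Adj γ γ' ∧ c ∈ Metric.cthickening (ρ + 3 / 2) (T.M γ')) →
      (∃ β, T.G.Reachable α β ∧ ¬ T.zero β ∧ Metric.infDist c (T.M β) ≤ R) ∨
      Real.sinh (Metric.infDist c (T.M γ)) ≤ e := by
    rintro c x hc hx (rfl | ⟨γ', hadj, hc'⟩)
    · rcases hx with h | ⟨β, h1, h2, h3, h4⟩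
      · exact Or.inl h
      · right
        rcases T.eq_or_adj (p := c) (hγ'.symm.trans h1)
          (Metric.cthickening_mono hρ5 _ hc)
          (Metric.cthickening_mono (by linarith) _ h3) with h | h
        · rw [h]; exact h4
        · exact absurd h2 ((T.bipartite _ _ h).1 hz)
    · left
      rw [mem_cthickening_iff (T.nonempty γ') (by linarith)] at hc'
      exact ⟨γ', hγ'.trans hadj.reachable, (T.bipartite _ _ hadj).1 hz, by linarith⟩
  have ha8 := (mem_cthickening_iff (T.nonempty γ) (by linarith)).1 ha
  have hb8 := (mem_cthickening_iff (T.nonempty γ) (by linarith)).1 hb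
  rcases T.end_estimate hD.le he hab (by linarith) (hend a x ha hx' ha') with h | ⟨h0, h1⟩
  · exact Or.inl h
  rcases T.end_estimate hD.le he hab.symm (by linarith) (hend b y hb hy' hb') with h | ⟨-, h2⟩
  · exact Or.inl h
  right
  refine ⟨γ, hγ', hz, hwγ, ?_⟩
  have s0 : 0 ≤ Real.exp (-D) * Real.sinh 8 :=
    mul_nonneg (Real.exp_pos _).le (Real.sinh_nonneg_iff.2 (by norm_num))
  rcases eq_or_lt_of_le (dist_nonneg (x := a) (y := b)) with hL | hL
  · have e1 : dist a w = 0 := by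
      unfold H3.Btw at hab
      linarith [dist_nonneg (x := a) (y := w), dist_nonneg (x := w) (y := b)]
    rcases h0 with h | h
    · rw [← dist_eq_zero.1 e1]; linarith
    · linarith
  have h3 := sinh_infDist_segment (T.convex γ) (T.nonempty γ) hab
  have h4 := sinh_add_le (dist_nonneg (x := a) (y := w)) (dist_nonneg (x := w) (y := b))
  rw [show dist a w + dist w b = dist a b from hab] at h4
  rw [dist_comm w a, dist_comm b a] at h2
  have hS := Real.sinh_pos_iff.2 hL
  refine le_of_mul_le_mul_right ?_ hS
  have h5 := mul_le_mul_of_nonneg_right h4 he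
  linarith

/-- Three rounds of adding segments, from `e = 0` and `R = 8`. -/
lemma hull_subset_fine (hD : 0 < D) :
    hull (⋃ β ∈ {β | T.G.Reachable α β}, T.M β)
      ⊆ T.fine α (9 / 2) (6 * (Real.exp (-D) * Real.sinh 8)) (8 + 3 * D) := by
  refine (hull_subset_join _).trans ?_
  have s0 : 0 ≤ Real.exp (-D) * Real.sinh 8 :=
    mul_nonneg (Real.exp_pos _).le (Real.sinh_nonneg_iff.2 (by norm_num))
  have h0 : (⋃ β ∈ {β | T.G.Reachable α β}, T.M β) ⊆ T.fine α 0 0 8 := by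
    intro p hp
    simp only [mem_iUnion] at hp
    obtain ⟨β, hβ, hp⟩ := hp
    refine ⟨⟨β, hβ, mem_cthickening_of_mem hp⟩, ?_⟩
    by_cases hz : T.zero β
    · exact Or.inr ⟨β, hβ, hz, mem_cthickening_of_mem hp, by
        rw [Metric.infDist_zero_of_mem hp]; simp⟩
    · exact Or.inl ⟨β, hβ, hz, by rw [Metric.infDist_zero_of_mem hp]; norm_num⟩
  have h1 := T.join_fine_subset (α := α) (ρ := 0) (e := 0) (R := 8) (D := D) (by norm_num)
    (by norm_num) le_rfl le_rfl hD
  have h2 := T.join_fine_subset (α := α) (ρ := 0 + 3 / 2)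
    (e := 0 + 2 * (Real.exp (-D) * Real.sinh 8)) (R := 8 + D) (D := D)
    (by norm_num) (by norm_num) (by linarith) (by linarith) hD
  have h3 := T.join_fine_subset (α := α) (ρ := 0 + 3 / 2 + 3 / 2)
    (e := 0 + 2 * (Real.exp (-D) * Real.sinh 8) + 2 * (Real.exp (-D) * Real.sinh 8))
    (R := 8 + D + D) (D := D) (by norm_num) (by norm_num) (by linarith) (by linarith) hD
  have h4 := (join_mono ((join_mono ((join_mono h0).trans h1)).trans h2)).trans h3
  convert h4 using 2 <;> ring

end ConvexPattern

section ChartGerms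

variable {X : Type u} [TopologicalSpace X] [HypStructure X] {x : X} {φ ψ : X → H3}

lemma IsChartAt.congr (h : IsChartAt φ x) (e : φ =ᶠ[𝓝 x] ψ) : IsChartAt ψ x := by
  obtain ⟨c, hc, hx, g, hg⟩ := h
  exact ⟨c, hc, hx, g, by filter_upwards [e, hg] with y h1 h2; rw [← h1, h2]⟩

lemma IsChartAt.comp_iso (h : IsChartAt φ x) (g : H3 ≃ᵢ H3) : IsChartAt (fun y => g (φ y)) x := by
  obtain ⟨c, hc, hx, g', hg⟩ := h
  exact ⟨c, hc, hx, g * g', by filter_upwards [hg] with y h1; rw [h1]; rfl⟩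

lemma IsChartAt.eventually (h : IsChartAt φ x) : ∀ᶠ y in 𝓝 x, IsChartAt φ y := by
  obtain ⟨c, hc, hx, g, hg⟩ := h
  filter_upwards [c.isOpen_source.mem_nhds hx, eventually_eventually_nhds.2 hg] with y h1 h2
  exact ⟨c, hc, h1, g, h2⟩

lemma IsChartAt.exists_iso (h : IsChartAt φ x) (h' : IsChartAt ψ x) :
    ∃ g : H3 ≃ᵢ H3, ∀ᶠ y in 𝓝 x, ψ y = g (φ y) := by
  obtain ⟨c, hc, hx, g, hg⟩ := h
  obtain ⟨c', hc', hx', g', hg'⟩ := h'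
  obtain ⟨t, ht⟩ := HypStructure.compat c hc c' hc' x ⟨hx, hx'⟩
  refine ⟨g' * t * g⁻¹, ?_⟩
  filter_upwards [hg, hg', ht] with y h1 h2 h3
  rw [h1, h2, h3]
  change _ = g' (t (g.symm (g (c.toFun y))))
  rw [g.symm_apply_apply]

lemma IsChartAt.exists_embedding (h : IsChartAt φ x) :
    ∃ U, IsOpen U ∧ x ∈ U ∧ IsEmbedding (U.domRestrict φ) := by
  obtain ⟨c, hc, hx, g, hg⟩ := h
  obtain ⟨V, hV, hVo, hxV⟩ := eventually_nhds_iff.1 hg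
  refine ⟨c.source ∩ V, c.isOpen_source.inter hVo, ⟨hx, hxV⟩, ?_⟩
  have e : (c.source ∩ V).domRestrict φ
      = g ∘ (c.source.domRestrict c.toFun) ∘ inclusion inter_subset_left := by
    ext1 y; exact hV y y.2.2
  rw [e]
  exact g.toHomeomorph.isEmbedding.comp (c.isEmbedding.comp (IsEmbedding.inclusion _))

lemma IsChartAt.continuousAt (h : IsChartAt φ x) : ContinuousAt φ x := by
  obtain ⟨U, hU, hx, he⟩ := h.exists_embedding
  have := he.continuous
  exact (continuousOn_iff_continuous_domRestrict.2 this).continuousAt (hU.mem_nhds hx)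

lemma IsChartAt.exists_injOn (h : IsChartAt φ x) : ∃ U, IsOpen U ∧ x ∈ U ∧ InjOn φ U := by
  obtain ⟨U, hU, hx, he⟩ := h.exists_embedding
  exact ⟨U, hU, hx, injOn_iff_injective.2 he.injective⟩

lemma IsChartAt.restrict {A : Set X} {x : A} (h : IsChartAt φ x.1) :
    IsChartAt (fun y : A => φ y) x := by
  obtain ⟨c, hc, hx, g, hg⟩ := h
  exact ⟨c.restrict A, ⟨c, hc, rfl⟩, hx, g, (continuous_subtype_val.tendsto x).eventually hg⟩

lemma IsChartAt.exists_extension {A : Set X} {x : A} {φ : A → H3} (h : IsChartAt φ x) :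
    ∃ ψ : X → H3, IsChartAt ψ x.1 ∧ φ =ᶠ[𝓝 x] fun y => ψ y := by
  obtain ⟨_, ⟨c, hc, rfl⟩, hx, g, hg⟩ := h
  exact ⟨fun y => g (c.toFun y), ⟨c, hc, hx, g, Eventually.of_forall fun _ => rfl⟩, hg⟩

variable (X) in
/-- A hyperbolic structure is rigid if an isometry is determined by its restriction to the image
of any chart germ. This holds when the images of charts have codimension zero. -/
class Rigid : Prop where
  eq_of_eventuallyEq : ∀ {x : X} {φ : X → H3}, IsChartAt φ x → ∀ {g g' : H3 ≃ᵢ H3},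
    (∀ᶠ y in 𝓝 x, g (φ y) = g' (φ y)) → g = g'

lemma IsHyp3Manifold.rigid (h : IsHyp3Manifold X) : Rigid X where
  eq_of_eventuallyEq := by
    rintro x φ ⟨c, hc, hx, t, ht⟩ g g' hg
    obtain ⟨U, hU, hUo, hxU⟩ := eventually_nhds_iff.1 (hg.and ht)
    obtain ⟨O, hO, hOU⟩ := c.isEmbedding.isInducing.isOpen_iff.1
      (hUo.preimage (continuous_subtype_val (p := fun y => y ∈ c.source)))
    have hmem : ∀ y (hy : y ∈ c.source), c.toFun y ∈ O ↔ y ∈ U := fun y hy =>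
      Set.ext_iff.1 hOU ⟨y, hy⟩
    have hcl := h.codimZero c hc ⟨x, hx, rfl⟩
    have hne : (O ∩ interior (c.toFun '' c.source)).Nonempty :=
      mem_closure_iff.1 hcl O hO ((hmem x hx).2 hxU)
    have : g * t = g' * t := by
      refine H3.isometry_eq_of_eqOn (hO.inter isOpen_interior) hne ?_
      rintro p ⟨hp, hp'⟩
      obtain ⟨y, hy, rfl⟩ := interior_subset hp'
      obtain ⟨h1, h2⟩ := hU y ((hmem y hy).1 hp)
      rw [h2] at h1
      exact h1
    exact mul_right_cancel this

end ChartGerms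

/-! ### The space of chart germs -/

/-- A chart germ of the hyperbolic space `X`: a point together with an isometry of `ℍ³`, which
stands for the germ at this point of the chosen chart followed by the isometry. With the topology
below, this is a covering space of `X` on which the developing map is defined. -/
@[ext] structure GermSpace (X : Type u) [TopologicalSpace X] [HypStructure X] where
  pt : X
  iso : H3 ≃ᵢ H3

namespace GermSpace

variable {X : Type u} [TopologicalSpace X] [HypStructure X] {x : X} {φ ψ : X → H3}

/-- The chosen chart at a point. -/
noncomputable def baseChart (x : X) : X → H3 := (HypStructure.cover x).choose.toFun

lemma isChartAt_baseChart (x : X) : IsChartAt (baseChart x) x :=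
  ⟨_, (HypStructure.cover x).choose_spec.1, (HypStructure.cover x).choose_spec.2, 1,
    Eventually.of_forall fun _ => rfl⟩

/-- A representative of a chart germ. -/
noncomputable def chart (a : GermSpace X) (y : X) : H3 := a.iso (baseChart a.pt y)

lemma isChartAt (a : GermSpace X) : IsChartAt a.chart a.pt :=
  (isChartAt_baseChart a.pt).comp_iso a.iso

/-- The germ at `x` of a chart `φ`. -/
noncomputable def germAt (x : X) (φ : X → H3) : GermSpace X :=
  ⟨x, Classical.epsilon fun g : H3 ≃ᵢ H3 => ∀ᶠ y in 𝓝 x, φ y = g (baseChart x y)⟩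

lemma chart_germAt (h : IsChartAt φ x) : (germAt x φ).chart =ᶠ[𝓝 x] φ := by
  have := Classical.epsilon_spec ((isChartAt_baseChart x).exists_iso h)
  exact EventuallyEq.symm this

lemma germAt_congr (h : φ =ᶠ[𝓝 x] ψ) : germAt x φ = germAt x ψ := by
  have : (fun g : H3 ≃ᵢ H3 => ∀ᶠ y in 𝓝 x, φ y = g (baseChart x y))
      = fun g : H3 ≃ᵢ H3 => ∀ᶠ y in 𝓝 x, ψ y = g (baseChart x y) := by
    ext g
    exact ⟨fun h' => h.symm.trans h', fun h' => h.trans h'⟩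
  rw [germAt, germAt, this]

/-- The developing map, on chart germs: the value of the germ. -/
noncomputable def dev (a : GermSpace X) : H3 := a.chart a.pt

lemma dev_germAt (h : IsChartAt φ x) : (germAt x φ).dev = φ x := (chart_germAt h).eq_of_nhds

noncomputable instance : TopologicalSpace (GermSpace X) :=
  TopologicalSpace.mkOfNhds fun a => map (fun y => germAt y a.chart) (𝓝 a.pt)

noncomputable instance : MulAction (H3 ≃ᵢ H3) (GermSpace X) where
  smul g a := ⟨a.pt, g * a.iso⟩
  one_smul a := by
    change GermSpace.mk a.pt (1 * a.iso) = a
    rw [one_mul]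
  mul_smul g h a := by
    change GermSpace.mk a.pt (g * h * a.iso) = GermSpace.mk a.pt (g * (h * a.iso))
    rw [mul_assoc]

lemma smul_chart (g : H3 ≃ᵢ H3) (a : GermSpace X) (y : X) : (g • a).chart y = g (a.chart y) := rfl

@[simp] lemma smul_dev (g : H3 ≃ᵢ H3) (a : GermSpace X) : (g • a).dev = g a.dev := rfl

lemma exists_smul_eq {a b : GermSpace X} (h : a.pt = b.pt) : ∃ g : H3 ≃ᵢ H3, g • a = b := by
  refine ⟨b.iso * a.iso⁻¹, ?_⟩
  refine GermSpace.ext h ?_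
  change b.iso * a.iso⁻¹ * a.iso = b.iso
  group

variable [Rigid X]

lemma eq_of_chart {a b : GermSpace X} (h : a.pt = b.pt) (e : a.chart =ᶠ[𝓝 a.pt] b.chart) :
    a = b := by
  obtain ⟨x, g⟩ := a
  obtain ⟨y, g'⟩ := b
  obtain rfl : x = y := h
  congr 1
  exact Rigid.eq_of_eventuallyEq (isChartAt_baseChart x) e

@[simp] lemma germAt_chart (a : GermSpace X) : germAt a.pt a.chart = a :=
  eq_of_chart rfl (chart_germAt a.isChartAt)

lemma nhds_eq (a : GermSpace X) : 𝓝 a = map (fun y => germAt y a.chart) (𝓝 a.pt) := by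
  refine TopologicalSpace.nhds_mkOfNhds _ _ ?_ ?_
  · intro a s hs
    have h : ∀ᶠ y in 𝓝 a.pt, germAt y a.chart ∈ s := hs
    simpa using h.self_of_nhds
  · intro a s hs
    have h1 := eventually_eventually_nhds.2 (mem_map.1 hs)
    rw [eventually_map]
    filter_upwards [h1, a.isChartAt.eventually] with y h2 h3
    have h4 := eventually_eventually_nhds.2 (chart_germAt h3)
    change ∀ᶠ z in 𝓝 y, germAt z (germAt y a.chart).chart ∈ s
    filter_upwards [h2, h4] with z h5 h6
    rw [germAt_congr h6]; exact h5

lemma tendsto_nhds_iff {T : Type*} {l : Filter T} {f : T → GermSpace X} {a : GermSpace X} :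
    Tendsto f l (𝓝 a) ↔ Tendsto (fun t => (f t).pt) l (𝓝 a.pt) ∧
      ∀ᶠ t in l, (f t).chart =ᶠ[𝓝 (f t).pt] a.chart := by
  constructor
  · intro h
    constructor
    · have : Tendsto (pt : GermSpace X → X) (𝓝 a) (𝓝 a.pt) := by
        rw [nhds_eq, tendsto_map'_iff]; exact tendsto_id
      exact this.comp h
    · refine h.eventually (p := fun b => b.chart =ᶠ[𝓝 b.pt] a.chart) ?_
      rw [nhds_eq, eventually_map]
      filter_upwards [a.isChartAt.eventually] with y hy
      exact chart_germAt hy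
  · rintro ⟨h1, h2⟩ s hs
    rw [nhds_eq] at hs
    change ∀ᶠ t in l, f t ∈ s
    filter_upwards [h1.eventually (mem_map.1 hs), h2] with t h3 h4
    change germAt (f t).pt a.chart ∈ s at h3
    rw [← germAt_congr h4, germAt_chart] at h3
    exact h3

lemma continuous_pt : Continuous (pt : GermSpace X → X) :=
  continuous_iff_continuousAt.2 fun _ => (tendsto_nhds_iff.1 tendsto_id).1

lemma continuous_dev : Continuous (dev : GermSpace X → H3) := by
  rw [continuous_iff_continuousAt]
  intro a
  rw [ContinuousAt, nhds_eq, tendsto_map'_iff]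
  refine Tendsto.congr' ?_ a.isChartAt.continuousAt
  filter_upwards [a.isChartAt.eventually] with y hy
  exact (dev_germAt hy).symm

lemma isLocallyInjective_dev : IsLocallyInjective (dev : GermSpace X → H3) := by
  rw [isLocallyInjective_iff_nhds]
  intro a
  obtain ⟨U, hU, hx, hinj⟩ := a.isChartAt.exists_injOn
  refine ⟨{b | b.pt ∈ U ∧ b.chart =ᶠ[𝓝 b.pt] a.chart}, ?_, ?_⟩
  · have h := tendsto_nhds_iff.1 (tendsto_id (x := 𝓝 a))
    exact (h.1.eventually (hU.mem_nhds hx)).and h.2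
  · rintro b ⟨hb, hb'⟩ b' ⟨hc, hc'⟩ h
    have e : a.chart b.pt = a.chart b'.pt := by
      rw [← hb'.eq_of_nhds, ← hc'.eq_of_nhds]; exact h
    have e' := hinj hb hc e
    refine eq_of_chart e' ?_
    rw [← e'] at hc'
    exact hb'.trans hc'.symm

lemma isOpenMap_pt : IsOpenMap (pt : GermSpace X → X) := by
  refine IsOpenMap.of_nhds_le fun a => ?_
  rw [nhds_eq, map_map]
  exact le_of_eq (map_id (f := 𝓝 a.pt)).symm

instance : ContinuousConstSMul (H3 ≃ᵢ H3) (GermSpace X) where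
  continuous_const_smul g := by
    rw [continuous_iff_continuousAt]
    intro a
    have h := tendsto_nhds_iff.1 (tendsto_id (x := 𝓝 a))
    refine tendsto_nhds_iff.2 ⟨h.1, ?_⟩
    filter_upwards [h.2] with b hb
    filter_upwards [hb] with y hy
    rw [smul_chart, smul_chart]
    exact congrArg g hy

lemma eq_one_of_smul {g : H3 ≃ᵢ H3} {a : GermSpace X} (h : g • a = a) : g = 1 :=
  Rigid.eq_of_eventuallyEq a.isChartAt (g' := 1) (Eventually.of_forall fun y => by
    rw [← smul_chart, h]; rfl)

lemma smul_left_injective {g g' : H3 ≃ᵢ H3} {a : GermSpace X} (h : g • a = g' • a) : g = g' := by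
  have : (g'⁻¹ * g) • a = a := by rw [mul_smul, h, inv_smul_smul]
  exact (inv_mul_eq_one.1 (eq_one_of_smul this)).symm

lemma isQuotientCoveringMap_pt : IsQuotientCoveringMap (pt : GermSpace X → X) (H3 ≃ᵢ H3) where
  toIsQuotientMap := isOpenMap_pt.isQuotientMap continuous_pt
    fun x => ⟨germAt x (baseChart x), rfl⟩
  toContinuousConstSMul := inferInstance
  apply_eq_iff_mem_orbit {a b} := by
    constructor
    · intro h
      obtain ⟨g, hg⟩ := exists_smul_eq h.symm
      exact ⟨g, hg⟩
    · rintro ⟨g, rfl⟩; rfl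
  disjoint a := by
    refine ⟨{b | b.chart =ᶠ[𝓝 b.pt] a.chart}, (tendsto_nhds_iff.1 (tendsto_id (x := 𝓝 a))).2, ?_⟩
    rintro g ⟨_, ⟨b, hb, rfl⟩, hb'⟩
    have h1 : (g • b).chart =ᶠ[𝓝 b.pt] a.chart := hb'
    exact Rigid.eq_of_eventuallyEq b.isChartAt (g' := 1) (h1.trans hb.symm)

lemma isCoveringMap_pt : IsCoveringMap (pt : GermSpace X → X) :=
  isQuotientCoveringMap_pt.isCoveringMap

instance [T2Space X] : T2Space (GermSpace X) where
  t2 a b h := by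
    by_cases e : a.pt = b.pt
    · exact isCoveringMap_pt.isSeparatedMap a b e h
    · obtain ⟨U, V, hU, hV, ha, hb, hd⟩ := t2_separation e
      exact ⟨_, _, hU.preimage continuous_pt, hV.preimage continuous_pt, ha, hb,
        hd.preimage _⟩

/-- Maps to the space of germs are determined by their developments and one value. -/
lemma eqOn_of_dev [T2Space X] {T : Type*} [TopologicalSpace T] {S : Set T} (hS : IsPreconnected S)
    {f f' : T → GermSpace X} (hf : ContinuousOn f S) (hf' : ContinuousOn f' S)
    (h : ∀ t ∈ S, (f t).dev = (f' t).dev) {t : T} (ht : t ∈ S) (e : f t = f' t) : EqOn f f' S :=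
  (T2Space.isSeparatedMap dev).eqOn_of_comp_eqOn isLocallyInjective_dev hS hf hf' h ht e

/-- The lift to the space of germs of a path. -/
lemma exists_lift {a : GermSpace X} {y : X} (γ : Path a.pt y) :
    ∃ (b : GermSpace X) (σ : Path a b), b.pt = y ∧ ∀ t, (σ t).pt = γ t := by
  obtain ⟨Γ, h1, h2⟩ := isCoveringMap_pt.exists_path_lifts γ.toContinuousMap a γ.source
  have h3 : ∀ t, (Γ t).pt = γ t := fun t => congrFun h1 t
  exact ⟨Γ 1, ⟨Γ, h2, rfl⟩, by rw [h3, γ.target], h3⟩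

/-- Lifts of homotopic paths end at the same germ. -/
lemma lift_unique_of_homotopic {a b b' : GermSpace X} {y : X} {γ γ' : Path a.pt y}
    (h : γ.Homotopic γ') (σ : Path a b) (σ' : Path a b') (hσ : ∀ t, (σ t).pt = γ t)
    (hσ' : ∀ t, (σ' t).pt = γ' t) : b = b' := by
  have e1 : σ.toContinuousMap = isCoveringMap_pt.liftPath γ.toContinuousMap a γ.source :=
    (isCoveringMap_pt.eq_liftPath_iff' _).2 ⟨funext hσ, σ.source⟩
  have e2 : σ'.toContinuousMap = isCoveringMap_pt.liftPath γ'.toContinuousMap a γ'.source :=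
    (isCoveringMap_pt.eq_liftPath_iff' _).2 ⟨funext hσ', σ'.source⟩
  have := isCoveringMap_pt.liftPath_apply_one_eq_of_homotopicRel h a γ.source γ'.source
  rw [← e1, ← e2] at this
  have h1 : σ.toContinuousMap 1 = b := σ.target
  have h2 : σ'.toContinuousMap 1 = b' := σ'.target
  rw [h1, h2] at this
  exact this

/-- A continuation of chart germs is a path in the space of germs. -/
lemma continuous_of_isContinuation {x y : X} {γ : Path x y} {Φ : unitInterval → X → H3}
    (h : IsContinuation γ Φ) : Continuous fun t => germAt (γ t) (Φ t) := by
  rw [continuous_iff_continuousAt]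
  intro t
  obtain ⟨h1, h2⟩ := h t
  refine tendsto_nhds_iff.2 ⟨γ.continuous.tendsto t, ?_⟩
  have h3 := (γ.continuous.tendsto t).eventually (eventually_eventually_nhds.2 (chart_germAt h1))
  filter_upwards [h2, h3] with s h4 h5
  exact (chart_germAt (h s).1).trans (h4.trans (EventuallyEq.symm h5))

lemma isContinuation_of_path {a b : GermSpace X} (σ : Path a b) :
    IsContinuation (σ.map continuous_pt) fun t => (σ t).chart := by
  intro t
  have := tendsto_nhds_iff.1 (σ.continuous.tendsto t)
  exact ⟨(σ t).isChartAt, this.2⟩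

end GermSpace

/-! ### Germs over a subspace -/

namespace BaseGerm

open GermSpace

variable {X : Type u} [TopologicalSpace X] [HypStructure X] [Rigid X] {A : Set X} [Rigid A]
  (b : BaseGerm A)

/-- The germ `a` of the ambient space extends the base germ `b` of the subspace. -/
def Extends (a : GermSpace X) : Prop := a.pt = b.pt ∧ ∀ᶠ y : A in 𝓝 b.pt, a.chart y = b.chart y

lemma exists_extends : ∃ a : GermSpace X, b.Extends a := by
  obtain ⟨ψ, h1, h2⟩ := b.isChartAt.exists_extension
  refine ⟨germAt b.pt ψ, rfl, ?_⟩
  filter_upwards [h2, (continuous_subtype_val.tendsto b.pt).eventually (chart_germAt h1)]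
    with y h3 h4
  rw [h3, h4]

variable {b} {a : GermSpace X}

lemma Extends.exists_of_continuesTo (ha : b.Extends a) {y : A} {γ : Path b.pt y} {ψ : A → H3}
    (h : b.ContinuesTo γ ψ) : ∃ a' : GermSpace X, JoinedIn (GermSpace.pt ⁻¹' A) a a' ∧ a'.pt = y ∧
      (∀ᶠ z : A in 𝓝 y, a'.chart z = ψ z) ∧ a'.dev = ψ y := by
  obtain ⟨Φ, hΦ, h0, h1⟩ := h
  obtain ⟨hpt, hch⟩ := ha
  obtain ⟨a', σ, e, hσ⟩ := exists_lift (a := a)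
    ((γ.map continuous_subtype_val).cast hpt rfl : Path a.pt y.1)
  have hσ' : ∀ t, (σ t).pt = γ t := hσ
  have hc : IsContinuation γ fun t (z : A) => (σ t).chart z := by
    intro t
    have h2 := isContinuation_of_path σ t
    refine ⟨?_, ?_⟩
    · have := h2.1
      simp only [Path.map_coe, Function.comp_apply, hσ'] at this
      exact this.restrict
    · filter_upwards [h2.2] with s hs
      simp only [Path.map_coe, Function.comp_apply, hσ'] at hs
      exact (continuous_subtype_val.tendsto (γ s)).eventually hs
  have key : (fun t => germAt (γ t) (fun z : A => (σ t).chart z))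
      = fun t => germAt (γ t) (Φ t) := by
    refine isCoveringMap_pt.eq_of_comp_eq (continuous_of_isContinuation hc)
      (continuous_of_isContinuation hΦ) rfl 0 ?_
    refine germAt_congr ?_
    rw [γ.source, σ.source]
    exact EventuallyEq.trans hch h0.symm
  have k1 := congrFun key 1
  have hch' : ∀ᶠ z : A in 𝓝 y, a'.chart z = ψ z := by
    have e1 := chart_germAt (hc 1).1
    have e2 := chart_germAt (hΦ 1).1
    simp only [γ.target, σ.target] at k1 e1 e2
    rw [k1] at e1
    exact e1.symm.trans (e2.trans h1)
  refine ⟨a', ⟨σ, fun t => ?_⟩, e, hch', ?_⟩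
  · change (σ t).pt ∈ A
    rw [hσ']; exact (γ t).2
  · have := hch'.self_of_nhds
    rw [← this, dev, e]

lemma Extends.exists_continuesTo (ha : b.Extends a) {a' : GermSpace X} {y : A}
    (h : JoinedIn (GermSpace.pt ⁻¹' A) a a') (hy : a'.pt = y) :
    ∃ γ : Path b.pt y, b.ContinuesTo γ fun z => a'.chart z := by
  obtain ⟨σ, hσ⟩ := h
  obtain ⟨hpt, hch⟩ := ha
  let γ : Path b.pt y :=
    { toFun := fun t => ⟨(σ t).pt, hσ t⟩
      continuous_toFun := (continuous_pt.comp σ.continuous).subtype_mk _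
      source' := Subtype.ext (by simp [hpt])
      target' := Subtype.ext (by simp [hy]) }
  have hγ : ∀ t, (γ t).1 = (σ t).pt := fun _ => rfl
  refine ⟨γ, fun t z => (σ t).chart z, ?_, ?_, ?_⟩
  · intro t
    have h2 := isContinuation_of_path σ t
    refine ⟨IsChartAt.restrict (x := γ t) h2.1, ?_⟩
    filter_upwards [h2.2] with s hs
    exact (continuous_subtype_val.tendsto (γ s)).eventually hs
  · simp only [σ.source]; exact hch
  · simp only [σ.target]; rfl

/-- The developing image of a subspace, in terms of germs of the ambient space. -/
lemma Extends.devImage_eq (ha : b.Extends a) :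
    b.devImage = dev '' {a' | JoinedIn (GermSpace.pt ⁻¹' A) a a'} := by
  ext p
  constructor
  · rintro ⟨y, γ, ψ, h, rfl⟩
    obtain ⟨a', h1, -, -, h2⟩ := ha.exists_of_continuesTo h
    exact ⟨a', h1, h2⟩
  · rintro ⟨a', h, rfl⟩
    obtain ⟨γ, hγ⟩ := ha.exists_continuesTo (y := ⟨a'.pt, h.target_mem⟩) h rfl
    exact ⟨_, γ, _, hγ, rfl⟩

end BaseGerm

lemma H3.GeodConvex.isPathConnected {S : Set H3} (h : H3.GeodConvex S) (hne : S.Nonempty) :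
    IsPathConnected S := by
  rw [H3.isOpenEmbedding_klein.isInducing.isPathConnected_iff]
  exact (H3.geodConvex_iff.1 h).isPathConnected (hne.image _)

namespace GermSpace

variable {X : Type u} [TopologicalSpace X] [HypStructure X] [Rigid X] {A B : Set X}
  {a b c : GermSpace X}

/-! ### Germs over a subspace that are joined over it -/

lemma continuousOn_germAt {φ : X → H3} {U : Set X} (h : ∀ y ∈ U, IsChartAt φ y) :
    ContinuousOn (fun y => germAt y φ) U := by
  intro y hy
  refine tendsto_nhds_iff.2 ⟨tendsto_nhdsWithin_of_tendsto_nhds tendsto_id, ?_⟩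
  have h1 := eventually_eventually_nhds.2 (chart_germAt (h y hy))
  filter_upwards [mem_nhdsWithin_of_mem_nhds h1, self_mem_nhdsWithin] with z h2 h3
  exact (chart_germAt (h z h3)).trans (EventuallyEq.symm h2)

lemma eventually_joinedIn_germAt [LocallyPathConnectedSpace A] (ha : a.pt ∈ A) :
    ∀ᶠ y in 𝓝[A] a.pt, JoinedIn (pt ⁻¹' A) a (germAt y a.chart) := by
  have h1 : Subtype.val ⁻¹' {y | IsChartAt a.chart y} ∈ 𝓝 (⟨a.pt, ha⟩ : A) :=
    continuous_subtype_val.continuousAt.preimage_mem_nhds a.isChartAt.eventually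
  obtain ⟨V, ⟨hV, hVp⟩, hVs⟩ := (path_connected_basis (⟨a.pt, ha⟩ : A)).mem_iff.1 h1
  rw [nhdsWithin_eq_map_subtype_coe ha, eventually_map]
  filter_upwards [hV] with y hy
  have h2 : JoinedIn V ⟨a.pt, ha⟩ y := hVp.joinedIn _ (mem_of_mem_nhds hV) _ hy
  have h3 : ContinuousOn (fun y : A => germAt y.1 a.chart) V :=
    (continuousOn_germAt (U := {y | IsChartAt a.chart y}) fun _ h => h).comp
      continuous_subtype_val.continuousOn fun z hz => hVs hz
  have h4 := h2.map_continuousOn h3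
  simp only [germAt_chart] at h4
  refine h4.mono ?_
  rintro _ ⟨z, -, rfl⟩
  exact z.2

lemma _root_.JoinedIn.smul_germ (h : JoinedIn (pt ⁻¹' A) a b) (g : H3 ≃ᵢ H3) :
    JoinedIn (pt ⁻¹' A) (g • a) (g • b) := by
  refine (h.map (continuous_const_smul g)).mono ?_
  rintro _ ⟨c, hc, rfl⟩
  exact hc

lemma exists_path_of_joinedIn (h : JoinedIn (pt ⁻¹' A) a b) :
    ∃ (σ : Path a b) (γ : Path (⟨a.pt, h.source_mem⟩ : A) ⟨b.pt, h.target_mem⟩),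
      ∀ t, (σ t).pt = γ t := by
  obtain ⟨σ, hσ⟩ := h
  exact ⟨σ, { toFun := fun t => ⟨(σ t).pt, hσ t⟩
              continuous_toFun := (continuous_pt.comp σ.continuous).subtype_mk _
              source' := Subtype.ext (by simp)
              target' := Subtype.ext (by simp) }, fun _ => rfl⟩

lemma exists_lift_subset (ha : a.pt ∈ A) {v : A} (γ : Path (⟨a.pt, ha⟩ : A) v) :
    ∃ (b : GermSpace X) (σ : Path a b), b.pt = v ∧ ∀ t, (σ t).pt = γ t :=
  exists_lift (a := a) (γ.map continuous_subtype_val)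

lemma lift_unique_of_homotopic' {x y : X} (hx : a.pt = x) {γ γ' : Path x y} (h : γ.Homotopic γ')
    (σ : Path a b) (σ' : Path a c) (hσ : ∀ t, (σ t).pt = γ t) (hσ' : ∀ t, (σ' t).pt = γ' t) :
    b = c := by
  subst hx
  exact lift_unique_of_homotopic h σ σ' hσ hσ'

lemma eq_of_lift_homotopic {ha : a.pt ∈ A} {v : A} {γ γ' : Path (⟨a.pt, ha⟩ : A) v}
    (h : γ.Homotopic γ') (σ : Path a b) (σ' : Path a c) (hσ : ∀ t, (σ t).pt = γ t)
    (hσ' : ∀ t, (σ' t).pt = γ' t) : b = c :=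
  lift_unique_of_homotopic (h.map ⟨Subtype.val, continuous_subtype_val⟩) σ σ' hσ hσ'

/-- Over a convex subspace `A`, germs joined over `A` are joined by a path over `A` that develops
to a geodesic of `ℍ³`. -/
lemma exists_geodesic (hA : IsConvexHyp3Manifold A) (h : JoinedIn (pt ⁻¹' A) a b) :
    ∃ σ : Path a b, (∀ t, (σ t).pt ∈ A) ∧
      ∃ v : ℝ, ∀ s t, dist (σ s).dev (σ t).dev = v * dist s t := by
  obtain ⟨τ, γ, hτ⟩ := exists_path_of_joinedIn h
  obtain ⟨γ', ⟨v, hv⟩, e⟩ := hA.convex ⟨a.pt, h.source_mem⟩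
    ⟨⟨a.pt, h.source_mem⟩, Path.Homotopic.Quotient.refl _⟩
    ⟨⟨b.pt, h.target_mem⟩, Path.Homotopic.Quotient.mk γ⟩
  have hh : γ'.Homotopic γ := by
    have e' : (Path.Homotopic.Quotient.refl (⟨a.pt, h.source_mem⟩ : A)).trans
      (Path.Homotopic.Quotient.mk γ') = Path.Homotopic.Quotient.mk γ := e
    rw [Path.Homotopic.Quotient.refl_trans] at e'
    exact Path.Homotopic.Quotient.exact e'
  obtain ⟨b', σ, hb', hσ⟩ := exists_lift_subset h.source_mem γ'
  obtain rfl : b' = b := eq_of_lift_homotopic hh σ τ hσ hτ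
  refine ⟨σ, fun t => by rw [hσ]; exact (γ' t).2, v, ?_⟩
  refine H3.dist_eq_of_locally fun t => ?_
  obtain ⟨φ, hφ, U, hU, hd⟩ := hv t
  obtain ⟨ψ, hψ, hφψ⟩ := hφ.exists_extension
  have ht := (σ t).isChartAt
  rw [hσ] at ht
  obtain ⟨g, hg⟩ := hψ.exists_iso ht
  have h1 := (tendsto_nhds_iff.1 (σ.continuous.tendsto t)).2
  have h2 : ∀ᶠ s in 𝓝 t, φ (γ' s) = ψ (γ' s) := (γ'.continuous.tendsto t).eventually hφψ
  have h3 : ∀ᶠ s in 𝓝 t, (σ t).chart (γ' s).1 = g (ψ (γ' s).1) :=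
    ((continuous_subtype_val.comp γ'.continuous).tendsto t).eventually hg
  have h4 : ∀ᶠ s in 𝓝 t, (σ s).dev = g (φ (γ' s)) := by
    filter_upwards [h1, h2, h3] with s e1 e2 e3
    rw [e2, ← e3, ← hσ]
    exact e1.self_of_nhds
  refine ⟨_, inter_mem hU h4, ?_⟩
  rintro s ⟨hs, es⟩ s' ⟨hs', es'⟩
  have es : (σ s).dev = g (φ (γ' s)) := es
  have es' : (σ s').dev = g (φ (γ' s')) := es'
  rw [es, es', g.dist_eq, hd s hs s' hs']

/-- The developing map is injective over a convex subspace. -/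
lemma eq_of_dev_eq [T2Space X] (hA : IsConvexHyp3Manifold A) (h : JoinedIn (pt ⁻¹' A) a b)
    (e : a.dev = b.dev) : a = b := by
  obtain ⟨σ, -, v, hv⟩ := exists_geodesic hA h
  have h0 := hv 0 1
  rw [σ.source, σ.target, e, dist_self] at h0
  have hv0 : v = 0 := by
    have : dist (0 : unitInterval) 1 ≠ 0 := dist_ne_zero.2 zero_ne_one
    exact (mul_eq_zero.1 h0.symm).resolve_right this
  have h1 : ∀ t, (σ t).dev = a.dev := fun t => by
    have := hv t 0
    rw [hv0, zero_mul, σ.source] at this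
    exact dist_eq_zero.1 this
  have h2 := eqOn_of_dev (isPreconnected_univ (α := unitInterval)) σ.continuous.continuousOn
    (continuousOn_const (c := a)) (fun t _ => h1 t) (mem_univ 0) σ.source (mem_univ 1)
  exact h2.symm.trans σ.target

/-- The developing image of a convex subspace is convex. -/
lemma geodConvex_dev_image (hA : IsConvexHyp3Manifold A) (a : GermSpace X) :
    H3.GeodConvex (dev '' {b | JoinedIn (pt ⁻¹' A) a b}) := by
  rintro _ ⟨b, hb, rfl⟩ _ ⟨c, hc, rfl⟩ z hz
  obtain ⟨σ, hσ, v, hv⟩ := exists_geodesic hA (hb.symm.trans hc)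
  have h01 : dist (0 : unitInterval) 1 = 1 := by
    rw [Subtype.dist_eq]; simp
  have h1 : dist b.dev c.dev = v := by
    have := hv 0 1
    rwa [σ.source, σ.target, h01, mul_one] at this
  have hz' : H3.Btw b.dev z c.dev := hz
  rcases eq_or_lt_of_le (dist_nonneg (x := b.dev) (y := c.dev)) with h0 | h0
  · refine ⟨b, hb, ?_⟩
    rw [← h0] at hz
    exact dist_eq_zero.1 (by
      linarith [dist_nonneg (x := b.dev) (y := z), dist_nonneg (x := z) (y := c.dev)])
  · have hle : dist b.dev z ≤ dist b.dev c.dev := by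
      linarith [dist_nonneg (x := z) (y := c.dev)]
    let t : unitInterval := ⟨dist b.dev z / dist b.dev c.dev, by positivity,
      div_le_one_of_le₀ hle dist_nonneg⟩
    have ht0 : dist (0 : unitInterval) t = dist b.dev z / dist b.dev c.dev := by
      rw [Subtype.dist_eq, Real.dist_eq, Set.Icc.coe_zero, zero_sub, abs_neg, abs_of_nonneg t.2.1]
    have ht1 : dist t (1 : unitInterval) = 1 - dist b.dev z / dist b.dev c.dev := by
      rw [dist_comm, Subtype.dist_eq, Real.dist_eq, Set.Icc.coe_one,
        abs_of_nonneg (by linarith [t.2.2])]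
    have e0 : dist b.dev (σ t).dev = dist b.dev z := by
      have := hv 0 t
      rw [σ.source, ht0, ← h1] at this
      rw [this]; field_simp
    have e1 : dist (σ t).dev c.dev = dist b.dev c.dev - dist b.dev z := by
      have := hv t 1
      rw [σ.target, ht1, ← h1] at this
      rw [this]; field_simp
    refine ⟨σ t, (hb.trans ⟨σ.subpath 0 t |>.cast (by simp) (by simp), fun s => ?_⟩), ?_⟩
    · exact hσ _
    · refine H3.Btw.eq_of_dist (p := b.dev) (q := c.dev) ?_ hz' e0
      unfold H3.Btw
      rw [e0, e1]; ring

end GermSpace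

/-! ### A convex submanifold with a convex thickening -/

/-- `B` is a convex thickening of the convex `A` and contains the `8`-thickening of `A`. -/
structure ThickPair {X : Type u} [TopologicalSpace X] [HypStructure X] (A B : Set X) : Prop where
  subset : A ⊆ B
  convex_left : IsConvexHyp3Manifold A
  convex_right : IsConvexHyp3Manifold B
  equiv : ∃ e : A ≃ₕ B, (e : A → B) = inclusion subset
  realization : ∀ b : BaseGerm A, ∃ j : b.thickening 8 → B,
    b.IsRealization (inclusion subset) (b.thickening 8) j

lemma IsHyp3Manifold.locallyPathConnectedSpace {X : Type u} [TopologicalSpace X] [HypStructure X]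
    (h : IsHyp3Manifold X) : LocallyPathConnectedSpace X := by
  obtain ⟨hc⟩ := h.manifold
  exact ChartedSpace.locallyPathConnectedSpace (EuclideanHalfSpace 3) X

lemma IsConvexHyp3Manifold.pathConnectedSpace {X : Type u} [TopologicalSpace X] [HypStructure X]
    (h : IsConvexHyp3Manifold X) : PathConnectedSpace X := by
  have := h.manifold.locallyPathConnectedSpace
  exact pathConnectedSpace_iff_connectedSpace.2 h.connected

lemma H3.cthickening_subset_closure_interior {M : Set H3} :
    Metric.cthickening 8 M ⊆ closure (interior (Metric.cthickening 8 M)) := by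
  intro p hp
  rcases M.eq_empty_or_nonempty with rfl | hne
  · simp at hp
  refine closure_mono (s := Metric.thickening 8 M)
    (interior_maximal (Metric.thickening_subset_cthickening _ _) Metric.isOpen_thickening) ?_
  rw [H3.mem_cthickening_iff hne (by norm_num)] at hp
  rw [Metric.mem_closure_iff]
  intro δ hδ
  obtain ⟨q, hq, hpq⟩ := (Metric.infDist_lt_iff hne (r := 8 + min δ 1 / 2)).1
    (lt_of_le_of_lt hp (by have := lt_min hδ one_pos; linarith))
  rcases lt_or_ge (dist p q) 8 with h8 | h8
  · exact ⟨p, Metric.mem_thickening_iff.2 ⟨q, hq, h8⟩, by simpa using hδ⟩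
  have hm := lt_min hδ one_pos
  have hm1 := min_le_left δ 1
  have hm2 := min_le_right δ 1
  obtain ⟨z, hz, hd⟩ := H3.exists_btw p q (r := min δ 1 / 2) (by linarith) (by linarith)
  refine ⟨z, Metric.mem_thickening_iff.2 ⟨q, hq, ?_⟩, by rw [hd]; linarith⟩
  have : dist p z + dist z q = dist p q := hz
  linarith

/-- A homotopy equivalence is full on fundamental groupoids. -/
lemma ContinuousMap.HomotopyEquiv.exists_path_homotopic {S T : Type u} [TopologicalSpace S]
    [TopologicalSpace T] (e : S ≃ₕ T) {x y : S} (γ : Path (e x) (e y)) :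
    ∃ γ' : Path x y, (γ'.map e.toFun.continuous).Homotopic γ := by
  have hs := (FundamentalGroupoidFunctor.equivOfHomotopyEquiv e).functor.map_surjective
    (X := ⟨x⟩) (Y := ⟨y⟩)
  obtain ⟨f, hf⟩ := hs (Path.Homotopic.Quotient.mk γ :
    Path.Homotopic.Quotient (e x) (e y))
  obtain ⟨γ', rfl⟩ := Path.Homotopic.Quotient.mk_surjective f
  exact ⟨γ', Path.Homotopic.Quotient.exact hf⟩

namespace ThickPair

open GermSpace

variable {X : Type u} [TopologicalSpace X] [HypStructure X] [Rigid X] {A B : Set X}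
  {a b c : GermSpace X}

/-- The part over `A` of a component of the germs over `B` is connected, since `A ↪ B` is surjective
on fundamental groups. -/
lemma joinedIn (h : ThickPair A B) (hab : JoinedIn (pt ⁻¹' B) a b) (ha : a.pt ∈ A)
    (hb : b.pt ∈ A) : JoinedIn (pt ⁻¹' A) a b := by
  obtain ⟨τ, γ, hτ⟩ := exists_path_of_joinedIn hab
  obtain ⟨e, he⟩ := h.equiv
  have hA : ∀ u : A, e u = inclusion h.subset u := fun u => congrFun he u
  obtain ⟨γ', hh⟩ := e.exists_path_homotopic
    (γ.cast (hA ⟨a.pt, ha⟩) (hA ⟨b.pt, hb⟩))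
  obtain ⟨c, σ, hc, hσ⟩ := exists_lift_subset ha γ'
  have hcb : c = b := by
    refine lift_unique_of_homotopic' (by rw [hA]; rfl)
      (hh.map ⟨Subtype.val, continuous_subtype_val⟩) σ τ (fun t => ?_) hτ
    rw [hσ]
    change _ = (e (γ' t)).1
    rw [hA]
  subst hcb
  exact ⟨σ, fun t => by change (σ t).pt ∈ A; rw [hσ]; exact (γ' t).2⟩

lemma exists_joinedIn (h : ThickPair A B) (ha : a.pt ∈ B) :
    ∃ c, JoinedIn (pt ⁻¹' B) a c ∧ c.pt ∈ A := by
  have := h.convex_right.pathConnectedSpace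
  have := h.convex_left.connected
  obtain ⟨u⟩ : Nonempty A := inferInstance
  obtain ⟨γ⟩ := PathConnectedSpace.joined (⟨a.pt, ha⟩ : B) (inclusion h.subset u)
  obtain ⟨c, σ, hc, hσ⟩ := exists_lift_subset ha γ
  refine ⟨c, ⟨σ, fun t => ?_⟩, ?_⟩
  · change (σ t).pt ∈ B; rw [hσ]; exact (γ t).2
  · rw [hc]; exact u.2

/-- The `8`-neighbourhood in `ℍ³` of a developing image of `A` lifts to germs over `B`. -/
lemma exists_section [T2Space X] (h : ThickPair A B) (hc : c.pt ∈ A) : ∃ s : H3 → GermSpace X,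
    ContinuousOn s (Metric.cthickening 8 (dev '' {b | JoinedIn (pt ⁻¹' A) c b})) ∧
    (∀ p ∈ Metric.cthickening 8 (dev '' {b | JoinedIn (pt ⁻¹' A) c b}),
      JoinedIn (pt ⁻¹' B) c (s p) ∧ (s p).dev = p) ∧
    ∀ b, JoinedIn (pt ⁻¹' A) c b → s b.dev = b := by
  have := h.convex_left.manifold.rigid
  have := h.convex_left.manifold.locallyPathConnectedSpace
  let b₀ : BaseGerm A := ⟨⟨c.pt, hc⟩, fun y => c.chart y, c.isChartAt.restrict (x := ⟨c.pt, hc⟩)⟩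
  have hext : b₀.Extends c := ⟨rfl, Eventually.of_forall fun _ => rfl⟩
  obtain ⟨j, hj⟩ := h.realization b₀
  have hdev := hext.devImage_eq
  rw [← hdev]
  obtain ⟨N, hN⟩ : ∃ N, N = Metric.cthickening 8 b₀.devImage := ⟨_, rfl⟩
  have hmem : ∀ p ∈ N, b₀.proj p ∈ b₀.thickening 8 := fun p hp => ⟨p, hN ▸ hp, rfl⟩
  have hloc : ∀ p : N, ∃ ψ : X → H3, IsChartAt ψ (j ⟨b₀.proj p, hmem p p.2⟩ : X) ∧
      ∀ᶠ q : N in 𝓝 p, ψ (j ⟨b₀.proj q, hmem q q.2⟩) = q := by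
    intro p
    obtain ⟨ψ, h1, h2⟩ := hj.localIsometry p (hmem p p.2)
    obtain ⟨ψ', h3, h4⟩ := h1.exists_extension
    refine ⟨ψ', h3, ?_⟩
    have hcont : Continuous fun q : N => j ⟨b₀.proj q, hmem q q.2⟩ :=
      hj.isEmbedding.continuous.comp
        ((continuous_quotient_mk'.comp continuous_subtype_val).subtype_mk _)
    filter_upwards [(continuous_subtype_val.tendsto p).eventually h2,
      (hcont.tendsto p).eventually h4] with q h5 h6
    rw [← h6, h5]
  choose ψ hψ hψj using hloc
  have hjc : Continuous fun q : N => (j ⟨b₀.proj q, hmem q q.2⟩ : X) :=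
    continuous_subtype_val.comp (hj.isEmbedding.continuous.comp
        ((continuous_quotient_mk'.comp continuous_subtype_val).subtype_mk _))
  let S : N → GermSpace X := fun p => germAt (j ⟨b₀.proj p, hmem p p.2⟩ : X) (ψ p)
  have hSch : ∀ p : N, ∀ᶠ q : N in 𝓝 p, (S p).chart (S q).pt = q := by
    intro p
    filter_upwards [hψj p, (hjc.tendsto p).eventually (chart_germAt (hψ p))] with q h1 h2
    exact h2.trans h1
  have hSdev : ∀ p, (S p).dev = p := fun p => (hSch p).self_of_nhds
  have hNint : N ⊆ closure (interior N) := hN ▸ H3.cthickening_subset_closure_interior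
  have hScont : Continuous S := by
    rw [continuous_iff_continuousAt]
    intro p
    refine tendsto_nhds_iff.2 ⟨hjc.tendsto p, ?_⟩
    have h1 : ∀ᶠ q : N in 𝓝 p, IsChartAt (S p).chart (S q).pt :=
      (hjc.tendsto p).eventually (S p).isChartAt.eventually
    filter_upwards [h1, eventually_eventually_nhds.2 (hSch p)] with q h2 h3
    obtain ⟨g, hg⟩ := (S q).isChartAt.exists_iso h2
    have hg' : ∀ᶠ r : N in 𝓝 q, (r : H3) = g r := by
      filter_upwards [h3, hSch q, (hjc.tendsto q).eventually hg] with r h4 h5 h6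
      have h7 : (S p).chart (S r).pt = g ((S q).chart (S r).pt) := h6
      rw [← h5, ← h7, h4, h5]
    have hg1 : g = 1 := by
      rw [nhds_subtype_eq_comap, eventually_comap] at hg'
      obtain ⟨O, hO', hO, hqO⟩ := eventually_nhds_iff.1 hg'
      refine H3.isometry_eq_of_eqOn (hO.inter isOpen_interior)
        (mem_closure_iff.1 (hNint q.2) O hO hqO) ?_
      rintro r ⟨hr, hr'⟩
      exact (hO' r hr ⟨r, interior_subset hr'⟩ rfl).symm
    subst hg1
    filter_upwards [hg] with z hz
    exact hz.symm
  have hdN : ∀ d, JoinedIn (pt ⁻¹' A) c d → d.dev ∈ N := fun d hd => by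
    rw [hN, hdev]
    exact H3.mem_cthickening_of_mem ⟨d, hd, rfl⟩
  have hpt : ∀ d (hd : JoinedIn (pt ⁻¹' A) c d), (S ⟨d.dev, hdN d hd⟩).pt = d.pt := by
    intro d hd
    obtain ⟨γ, hγ⟩ := hext.exists_continuesTo (y := ⟨d.pt, hd.target_mem⟩) hd rfl
    obtain ⟨h1, h2⟩ := hj.extends_inclusion _ γ _ hγ
    exact congrArg Subtype.val h2
  have hSd : ∀ d (hd : JoinedIn (pt ⁻¹' A) c d), S ⟨d.dev, hdN d hd⟩ = d := by
    intro d hd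
    refine eq_of_chart (hpt d hd) ?_
    have h1 := (S ⟨d.dev, hdN d hd⟩).isChartAt
    rw [hpt d hd] at h1 ⊢
    obtain ⟨g, hg⟩ := h1.exists_iso d.isChartAt
    have hg1 : g = 1 := by
      refine Rigid.eq_of_eventuallyEq (X := A) (h1.restrict (x := ⟨d.pt, hd.target_mem⟩)) ?_
      have h2 := hSch ⟨d.dev, hdN d hd⟩
      rw [nhds_subtype_eq_comap, eventually_comap] at h2
      have h3 : ∀ᶠ y : A in 𝓝 ⟨d.pt, hd.target_mem⟩,
          JoinedIn (pt ⁻¹' A) d (germAt y.1 d.chart) := by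
        have := eventually_joinedIn_germAt (A := A) (a := d) hd.target_mem
        have hdA : d.pt ∈ A := hd.target_mem
        rwa [nhdsWithin_eq_map_subtype_coe hdA, eventually_map] at this
      have ht := continuous_subtype_val.tendsto (⟨d.pt, hd.target_mem⟩ : A)
      filter_upwards [h3, ht.eventually hg, ht.eventually d.isChartAt.eventually,
        ht.eventually (d.isChartAt.continuousAt.eventually h2)] with y h4 h5 h6 h7
      have h8 := h7 ⟨_, hdN _ (hd.trans h4)⟩ (dev_germAt h6)
      rw [hpt _ (hd.trans h4)] at h8
      have h8 : (S ⟨d.dev, hdN d hd⟩).chart y = d.chart y := h8.trans (dev_germAt h6)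
      rw [← h5, ← h8]
      rfl
    subst hg1
    filter_upwards [hg] with z hz
    exact hz.symm
  classical
  refine ⟨fun p => if hp : p ∈ N then S ⟨p, hp⟩ else c, ?_, ?_, ?_⟩
  · rw [← hN, continuousOn_iff_continuous_domRestrict]
    convert hScont using 1
    ext1 p
    exact dif_pos p.2
  · rw [← hN]
    intro p hp
    simp only [dif_pos hp]
    refine ⟨?_, hSdev _⟩
    have hconv : H3.GeodConvex N := by
      rw [hN, hdev]
      exact (geodConvex_dev_image h.convex_left c).cthickening (by norm_num)
    have hcA : JoinedIn (pt ⁻¹' A) c c := JoinedIn.refl hc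
    have h1 := ((hconv.isPathConnected ⟨p, hp⟩).joinedIn _ (hdN c hcA) p hp).joined_subtype
    obtain ⟨τ⟩ := h1
    refine ⟨(τ.map hScont).cast (hSd c hcA).symm rfl, fun t => ?_⟩
    exact (j _).2
  · intro d hd
    simp only [dif_pos (hdN d hd)]
    exact hSd d hd

end ThickPair

/-! ### Pieces: components of the germs over the `Yᵢ` -/

/-- The hypotheses on the families `Mᵢ` and `Yᵢ` that the argument uses; `M` is the union of the
`Mᵢ`. -/
structure Decomposition {Y : Type u} [TopologicalSpace Y] [HypStructure Y] {m : ℕ}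
    (Mp Yp : Fin (m + 1) → Set Y) : Prop where
  manifold : IsHyp3Manifold Y
  manifold_M : IsHyp3Manifold (⋃ i, Mp i)
  connected_M : ConnectedSpace (⋃ i, Mp i)
  pair : ∀ i, ThickPair (Mp i) (Yp i)
  eq_or_zero : ∀ i j, (Yp i ∩ Yp j).Nonempty → i = j ∨ i = 0 ∨ j = 0
  component : ∀ i j, ∀ x ∈ Yp i ∩ Yp j,
    (connectedComponentIn (Yp i ∩ Yp j) x ∩ (Mp i ∩ Mp j)).Nonempty

/-- A piece is a path component of the set of germs over some `Yᵢ`. -/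
@[ext] structure Piece {Y : Type u} [TopologicalSpace Y] [HypStructure Y] {m : ℕ}
    (Yp : Fin (m + 1) → Set Y) where
  idx : Fin (m + 1)
  carrier : Set (GermSpace Y)
  exists_eq : ∃ a, a.pt ∈ Yp idx ∧ carrier = {b | JoinedIn (GermSpace.pt ⁻¹' Yp idx) a b}

section Pieces

open GermSpace

variable {Y : Type u} [TopologicalSpace Y] [HypStructure Y] {m : ℕ}
  {Mp Yp : Fin (m + 1) → Set Y} {P Q S : Piece Yp} {a b c : GermSpace Y} {p : H3} {g : H3 ≃ᵢ H3}

namespace Piece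

/-- The piece that contains a given germ. -/
def of (i : Fin (m + 1)) (ha : a.pt ∈ Yp i) : Piece Yp :=
  ⟨i, {b | JoinedIn (GermSpace.pt ⁻¹' Yp i) a b}, a, ha, rfl⟩

lemma mem_of {i : Fin (m + 1)} (ha : a.pt ∈ Yp i) : a ∈ (of i ha).carrier := JoinedIn.refl ha

lemma pt_mem (ha : a ∈ P.carrier) : a.pt ∈ Yp P.idx := by
  obtain ⟨c, hc, e⟩ := P.exists_eq
  rw [e] at ha
  exact ha.target_mem

lemma carrier_eq (ha : a ∈ P.carrier) :
    P.carrier = {b | JoinedIn (GermSpace.pt ⁻¹' Yp P.idx) a b} := by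
  obtain ⟨c, hc, e⟩ := P.exists_eq
  rw [e] at ha ⊢
  ext b
  exact ⟨fun h => ha.symm.trans h, fun h => ha.trans h⟩

lemma joinedIn (ha : a ∈ P.carrier) (hb : b ∈ P.carrier) :
    JoinedIn (GermSpace.pt ⁻¹' Yp P.idx) a b := by
  rw [carrier_eq ha] at hb
  exact hb

lemma mem_of_joinedIn (ha : a ∈ P.carrier) (h : JoinedIn (GermSpace.pt ⁻¹' Yp P.idx) a b) :
    b ∈ P.carrier := by
  rw [carrier_eq ha]
  exact h

lemma eq_of_mem (hi : P.idx = Q.idx) (ha : a ∈ P.carrier) (hb : a ∈ Q.carrier) : P = Q := by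
  refine Piece.ext hi ?_
  rw [carrier_eq ha, carrier_eq hb, hi]

variable (Mp P) in
/-- The germs of a piece over the corresponding `Mᵢ`. -/
def core : Set (GermSpace Y) := P.carrier ∩ GermSpace.pt ⁻¹' Mp P.idx

variable (Mp P) in
/-- The developing image in `ℍ³` of the part of a piece over the corresponding `Mᵢ`. -/
def model : Set H3 := dev '' P.core Mp

variable [Rigid Y]

/-- Isometries of `ℍ³` act on pieces. -/
noncomputable instance : SMul (H3 ≃ᵢ H3) (Piece Yp) where
  smul g P := ⟨P.idx, {b | g⁻¹ • b ∈ P.carrier}, by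
    obtain ⟨a, ha, e⟩ := P.exists_eq
    refine ⟨g • a, ha, ?_⟩
    rw [e]
    ext b
    constructor
    · intro h
      have := JoinedIn.smul_germ h g
      rwa [smul_inv_smul] at this
    · intro h
      have := JoinedIn.smul_germ h g⁻¹
      rwa [inv_smul_smul] at this⟩

lemma mem_smul : b ∈ (g • P).carrier ↔ g⁻¹ • b ∈ P.carrier := Iff.rfl

lemma smul_mem_smul : g • a ∈ (g • P).carrier ↔ a ∈ P.carrier := by
  rw [mem_smul, inv_smul_smul]

lemma smul_inv_smul' : g⁻¹ • (g • P) = P := by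
  refine Piece.ext rfl ?_
  ext b
  rw [mem_smul, inv_inv, smul_mem_smul]

lemma smul_mem_core : g • a ∈ (g • P).core Mp ↔ a ∈ P.core Mp :=
  and_congr smul_mem_smul Iff.rfl

lemma model_smul : (g • P).model Mp = g '' P.model Mp := by
  ext p
  constructor
  · rintro ⟨b, hb, rfl⟩
    refine ⟨_, ⟨g⁻¹ • b, ?_, rfl⟩, ?_⟩
    · rw [← smul_mem_core (g := g), smul_inv_smul]; exact hb
    · rw [← smul_dev, smul_inv_smul]
  · rintro ⟨_, ⟨b, hb, rfl⟩, rfl⟩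
    exact ⟨g • b, smul_mem_core.2 hb, rfl⟩

lemma cthickening_model_smul {r : ℝ} (h : p ∈ Metric.cthickening r (P.model Mp)) :
    g p ∈ Metric.cthickening r ((g • P).model Mp) := by
  rw [model_smul, Metric.cthickening, mem_ofPred_eq, Metric.infEDist_image g.isometry]
  exact h

end Piece

namespace Decomposition

variable [Rigid Y] [T2Space Y] (D : Decomposition Mp Yp)

include D

lemma core_nonempty (P : Piece Yp) : (P.core Mp).Nonempty := by
  obtain ⟨a, ha, e⟩ := P.exists_eq
  obtain ⟨c, hc, hcM⟩ := (D.pair P.idx).exists_joinedIn ha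
  exact ⟨c, by rw [e]; exact hc, hcM⟩

lemma core_eq (hc : c ∈ P.core Mp) :
    P.core Mp = {b | JoinedIn (GermSpace.pt ⁻¹' Mp P.idx) c b} := by
  ext b
  constructor
  · exact fun hb => (D.pair P.idx).joinedIn (Piece.joinedIn hc.1 hb.1) hc.2 hb.2
  · intro hb
    exact ⟨Piece.mem_of_joinedIn hc.1 (hb.mono (preimage_mono (D.pair P.idx).subset)),
      hb.target_mem⟩

lemma model_nonempty (P : Piece Yp) : (P.model Mp).Nonempty := (D.core_nonempty P).image _

lemma geodConvex_model (P : Piece Yp) : H3.GeodConvex (P.model Mp) := by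
  obtain ⟨c, hc⟩ := D.core_nonempty P
  rw [Piece.model, D.core_eq hc]
  exact geodConvex_dev_image (D.pair P.idx).convex_left c

lemma exists_section (P : Piece Yp) : ∃ s : H3 → GermSpace Y,
    ContinuousOn s (Metric.cthickening 8 (P.model Mp)) ∧
    (∀ p ∈ Metric.cthickening 8 (P.model Mp), s p ∈ P.carrier ∧ (s p).dev = p) ∧
    ∀ b ∈ P.core Mp, s b.dev = b := by
  obtain ⟨c, hc⟩ := D.core_nonempty P
  obtain ⟨s, h1, h2, h3⟩ := (D.pair P.idx).exists_section hc.2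
  rw [← D.core_eq hc] at h1 h2
  refine ⟨s, h1, fun p hp => ⟨Piece.mem_of_joinedIn hc.1 (h2 p hp).1, (h2 p hp).2⟩, ?_⟩
  intro b hb
  rw [D.core_eq hc] at hb
  exact h3 b hb

/-- The lift of the `8`-neighbourhood of the model of a piece to the piece. -/
noncomputable def sec (P : Piece Yp) : H3 → GermSpace Y := (D.exists_section P).choose

lemma continuousOn_sec (P : Piece Yp) :
    ContinuousOn (D.sec P) (Metric.cthickening 8 (P.model Mp)) :=
  (D.exists_section P).choose_spec.1

lemma sec_mem (hp : p ∈ Metric.cthickening 8 (P.model Mp)) : D.sec P p ∈ P.carrier :=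
  ((D.exists_section P).choose_spec.2.1 p hp).1

lemma dev_sec (hp : p ∈ Metric.cthickening 8 (P.model Mp)) : (D.sec P p).dev = p :=
  ((D.exists_section P).choose_spec.2.1 p hp).2

lemma eq_of_mem_carrier (ha : a ∈ P.carrier) (hb : b ∈ P.carrier) (e : a.dev = b.dev) : a = b :=
  eq_of_dev_eq (D.pair P.idx).convex_right (Piece.joinedIn ha hb) e

lemma sec_dev (ha : a ∈ P.carrier) (hp : a.dev ∈ Metric.cthickening 8 (P.model Mp)) :
    D.sec P a.dev = a :=
  D.eq_of_mem_carrier (D.sec_mem hp) ha (D.dev_sec hp)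

lemma sec_smul (hp : p ∈ Metric.cthickening 8 (P.model Mp)) :
    D.sec (g • P) (g p) = g • D.sec P p := by
  have h1 := D.sec_dev (Piece.smul_mem_smul (g := g).2 (D.sec_mem hp)) (by
    rw [smul_dev, D.dev_sec hp]; exact Piece.cthickening_model_smul hp)
  rwa [smul_dev, D.dev_sec hp] at h1

lemma isOpen_carrier_inter :
    IsOpen (P.carrier ∩ dev ⁻¹' Metric.thickening 8 (P.model Mp)) := by
  rw [isOpen_iff_mem_nhds]
  rintro a ⟨ha, hd⟩
  have h1 : ∀ᶠ b in 𝓝 a, b.dev ∈ Metric.thickening 8 (P.model Mp) :=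
    continuous_dev.continuousAt.preimage_mem_nhds (Metric.isOpen_thickening.mem_nhds hd)
  have hsub := Metric.thickening_subset_cthickening 8 (P.model Mp)
  obtain ⟨U, hU, hinj⟩ := isLocallyInjective_iff_nhds.1 (isLocallyInjective_dev (X := Y)) a
  have h2 : Tendsto (fun b : GermSpace Y => D.sec P b.dev) (𝓝 a) (𝓝 a) := by
    have h3 : ContinuousAt (D.sec P) a.dev := (D.continuousOn_sec P).continuousAt
      (mem_of_superset (Metric.isOpen_thickening.mem_nhds hd) hsub)
    have h4 := h3.tendsto.comp (continuous_dev.tendsto a)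
    rwa [D.sec_dev ha (hsub hd)] at h4
  filter_upwards [h1, hU, h2.eventually hU] with b hb hbU hsU
  have : D.sec P b.dev = b := hinj hsU hbU (D.dev_sec (hsub hb))
  exact ⟨this ▸ D.sec_mem (hsub hb), hb⟩

/-- Two pieces that meet do so over `Mᵢ ∩ Mⱼ`. -/
lemma exists_mem_core_inter (ha : a ∈ P.carrier) (hb : a ∈ Q.carrier) :
    ∃ c, c ∈ P.core Mp ∧ c ∈ Q.core Mp := by
  obtain ⟨y, hyc, hyP, hyQ⟩ := D.component P.idx Q.idx a.pt ⟨Piece.pt_mem ha, Piece.pt_mem hb⟩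
  have := (D.pair P.idx).convex_right.manifold.locallyPathConnectedSpace
  have := (D.pair Q.idx).convex_right.manifold.locallyPathConnectedSpace
  obtain ⟨K, hK⟩ : ∃ K, K = connectedComponentIn (Yp P.idx ∩ Yp Q.idx) a.pt := ⟨_, rfl⟩
  have hKsub : K ⊆ Yp P.idx ∩ Yp Q.idx := hK ▸ connectedComponentIn_subset _ _
  let R : Y → Y → Prop := fun u v => ∀ a : GermSpace Y, a.pt = u → ∃ b : GermSpace Y, b.pt = v ∧
    JoinedIn (GermSpace.pt ⁻¹' Yp P.idx) a b ∧ JoinedIn (GermSpace.pt ⁻¹' Yp Q.idx) a b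
  have hR : R a.pt y := by
    refine IsPreconnected.induction₂' (s := K) (hK ▸ isPreconnected_connectedComponentIn) R
      ?_ ?_ (hK ▸ mem_connectedComponentIn ⟨Piece.pt_mem ha, Piece.pt_mem hb⟩) (hK ▸ hyc)
    · intro x hx
      let c : GermSpace Y := germAt x (baseChart x)
      have h1 : ∀ᶠ z in 𝓝[K] x, JoinedIn (GermSpace.pt ⁻¹' Yp P.idx) c (germAt z c.chart) :=
        nhdsWithin_mono x (fun z hz => (hKsub hz).1)
          (eventually_joinedIn_germAt (a := c) (hKsub hx).1)
      have h2 : ∀ᶠ z in 𝓝[K] x, JoinedIn (GermSpace.pt ⁻¹' Yp Q.idx) c (germAt z c.chart) :=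
        nhdsWithin_mono x (fun z hz => (hKsub hz).2)
          (eventually_joinedIn_germAt (a := c) (hKsub hx).2)
      filter_upwards [h1, h2] with z h3 h4
      constructor
      · intro d hd
        obtain ⟨g, rfl⟩ := exists_smul_eq (a := c) (b := d) hd.symm
        exact ⟨g • germAt z c.chart, rfl, h3.smul_germ g, h4.smul_germ g⟩
      · intro d hd
        obtain ⟨g, rfl⟩ := exists_smul_eq (a := germAt z c.chart) (b := d) hd.symm
        exact ⟨g • c, rfl, h3.symm.smul_germ g, h4.symm.smul_germ g⟩
    · intro x y z _ _ _ h1 h2 d hd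
      obtain ⟨e, he, h3, h4⟩ := h1 d hd
      obtain ⟨f, hf, h5, h6⟩ := h2 e he
      exact ⟨f, hf, h3.trans h5, h4.trans h6⟩
  obtain ⟨c, hc, h1, h2⟩ := hR a rfl
  refine ⟨c, ⟨Piece.mem_of_joinedIn ha h1, ?_⟩, Piece.mem_of_joinedIn hb h2, ?_⟩
  · change c.pt ∈ Mp P.idx; rw [hc]; exact hyP
  · change c.pt ∈ Mp Q.idx; rw [hc]; exact hyQ

/-- Two different pieces that meet have different indices, so exactly one of them has index `0`. -/
lemma zero_iff_of_mem (ha : a ∈ P.carrier) (hb : a ∈ Q.carrier) (hne : P ≠ Q) :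
    P.idx = 0 ↔ ¬ Q.idx = 0 := by
  have hi : P.idx ≠ Q.idx := fun h => hne (Piece.eq_of_mem h ha hb)
  rcases D.eq_or_zero _ _ ⟨a.pt, Piece.pt_mem ha, Piece.pt_mem hb⟩ with h | h | h
  · exact absurd h hi
  · exact ⟨fun _ h' => hi (h.trans h'.symm), fun _ => h⟩
  · exact ⟨fun h' _ => hi (h'.trans h.symm), fun h' => absurd h h'⟩

/-- The lifts of the neighbourhoods of the models of two pieces that meet agree. -/
lemma sec_eq_sec (ha : a ∈ P.carrier) (hb : a ∈ Q.carrier)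
    (hp : p ∈ Metric.cthickening 8 (P.model Mp)) (hq : p ∈ Metric.cthickening 8 (Q.model Mp)) :
    D.sec P p = D.sec Q p := by
  obtain ⟨c, hcP, hcQ⟩ := D.exists_mem_core_inter ha hb
  have h1 : c.dev ∈ Metric.cthickening 8 (P.model Mp) := H3.mem_cthickening_of_mem ⟨c, hcP, rfl⟩
  have h2 : c.dev ∈ Metric.cthickening 8 (Q.model Mp) := H3.mem_cthickening_of_mem ⟨c, hcQ, rfl⟩
  refine eqOn_of_dev (S := Metric.cthickening 8 (P.model Mp) ∩ Metric.cthickening 8 (Q.model Mp))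
    ?_ ((D.continuousOn_sec P).mono inter_subset_left)
    ((D.continuousOn_sec Q).mono inter_subset_right) (fun t ht => ?_) ⟨h1, h2⟩ ?_ ⟨hp, hq⟩
  · exact (((D.geodConvex_model P).cthickening (by norm_num)).inter
      ((D.geodConvex_model Q).cthickening (by norm_num))).isPreconnected
  · rw [D.dev_sec ht.1, D.dev_sec ht.2]
  · rw [D.sec_dev hcP.1 h1, D.sec_dev hcQ.1 h2]

/-- The models of the pieces form a pattern of convex sets; two pieces are adjacent if they
meet. -/
noncomputable def pattern : ConvexPattern (Piece Yp) where
  G := { Adj := fun P Q => P ≠ Q ∧ (P.carrier ∩ Q.carrier).Nonempty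
         symm := ⟨fun P Q h => ⟨h.1.symm, by rw [inter_comm]; exact h.2⟩⟩
         loopless := ⟨fun P h => h.1 rfl⟩ }
  M P := P.model Mp
  zero P := P.idx = 0
  nonempty := D.model_nonempty
  convex := D.geodConvex_model
  meet := by
    rintro P Q ⟨-, a, ha, hb⟩
    obtain ⟨c, h1, h2⟩ := D.exists_mem_core_inter ha hb
    exact ⟨c.dev, ⟨c, h1, rfl⟩, ⟨c, h2, rfl⟩⟩
  bipartite := by
    rintro P Q ⟨hne, a, ha, hb⟩
    exact D.zero_iff_of_mem ha hb hne
  separated := by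
    rintro P Q S ⟨hPQ, a, ha, ha'⟩ ⟨hQS, b, hb, hb'⟩ hPS p hP hQ hS
    have h1 := D.sec_eq_sec ha ha' hP hQ
    have h2 := D.sec_eq_sec hb hb' hQ hS
    have h3 : D.sec P p ∈ S.carrier := by rw [h1, h2]; exact D.sec_mem hS
    have e1 := D.zero_iff_of_mem ha ha' hPQ
    have e2 := D.zero_iff_of_mem hb hb' hQS
    have e3 := D.zero_iff_of_mem (D.sec_mem hP) h3 hPS
    tauto

lemma pattern_adj : D.pattern.G.Adj P Q ↔ P ≠ Q ∧ (P.carrier ∩ Q.carrier).Nonempty := Iff.rfl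

lemma reachable_of_mem (ha : a ∈ P.carrier) (hb : a ∈ Q.carrier) : D.pattern.G.Reachable P Q := by
  by_cases h : P = Q
  · rw [h]
  · exact SimpleGraph.Adj.reachable (D.pattern_adj.2 ⟨h, a, ha, hb⟩)

lemma reachable_smul (h : D.pattern.G.Reachable P Q) :
    D.pattern.G.Reachable (g • P) (g • Q) := by
  refine h.map ⟨fun P => g • P, ?_⟩
  rintro P Q ⟨hne, a, ha, hb⟩
  refine ⟨fun h => hne ?_, g • a, Piece.smul_mem_smul.2 ha, Piece.smul_mem_smul.2 hb⟩
  rw [← Piece.smul_inv_smul' (g := g) (P := P), h, Piece.smul_inv_smul']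

end Decomposition

end Pieces

/-! ### The universal cover of `M` and its convex hull -/

namespace Decomposition

open GermSpace

variable {Y : Type u} [TopologicalSpace Y] [HypStructure Y] {m : ℕ}
  {Mp Yp : Fin (m + 1) → Set Y} {P Q S α β : Piece Yp} {a a₀ b c : GermSpace Y} {p q : H3}
  {g : H3 ≃ᵢ H3} [Rigid Y] [T2Space Y] (D : Decomposition Mp Yp)

variable (Mp a₀) in
/-- The germs joined to `a₀` over `M`: the covering of `M` that belongs to the kernel of the
holonomy, on which the developing map is defined. -/
def hat : Set (GermSpace Y) := {b | JoinedIn (GermSpace.pt ⁻¹' ⋃ i, Mp i) a₀ b}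

include D

lemma exists_core (h : a.pt ∈ ⋃ i, Mp i) : ∃ P : Piece Yp, a ∈ P.core Mp := by
  obtain ⟨i, hi⟩ := mem_iUnion.1 h
  exact ⟨Piece.of i ((D.pair i).subset hi), Piece.mem_of _, hi⟩

lemma joinedIn_of_reachable (ha : a₀ ∈ α.core Mp) (h : D.pattern.G.Reachable α β)
    (hb : b ∈ β.core Mp) : b ∈ hat Mp a₀ := by
  have hstep : ∀ {P : Piece Yp} {c d}, c ∈ P.core Mp → d ∈ P.core Mp →
      JoinedIn (GermSpace.pt ⁻¹' ⋃ i, Mp i) c d := by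
    intro P c d hc hd
    rw [D.core_eq hc] at hd
    exact JoinedIn.mono hd (preimage_mono (subset_iUnion Mp P.idx))
  rw [SimpleGraph.reachable_iff_reflTransGen] at h
  induction h generalizing b with
  | refl => exact hstep ha hb
  | tail _ hadj ih =>
    obtain ⟨-, d, hd, hd'⟩ := hadj
    obtain ⟨e, he, he'⟩ := D.exists_mem_core_inter hd hd'
    exact JoinedIn.trans (ih he) (hstep he' hb)

lemma reachable_of_hat (ha : a₀ ∈ α.carrier) (hb : b ∈ hat Mp a₀) (hβ : b ∈ β.carrier) :
    D.pattern.G.Reachable α β := by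
  obtain ⟨σ, hσ⟩ := hb
  have key : ∀ t : unitInterval, ∀ γ : Piece Yp, σ t ∈ γ.carrier →
      D.pattern.G.Reachable α γ := by
    have := PreconnectedSpace.induction₂ (α := unitInterval)
      (fun s t => (∀ γ : Piece Yp, σ s ∈ γ.carrier → D.pattern.G.Reachable α γ) ↔
        (∀ γ : Piece Yp, σ t ∈ γ.carrier → D.pattern.G.Reachable α γ)) ?_
      ⟨fun _ _ _ h h' => h.trans h'⟩ 0
    · refine fun t => (this t).1 fun γ hγ => ?_
      rw [σ.source] at hγ
      exact D.reachable_of_mem ha hγ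
    · intro t
      obtain ⟨γ, hγ⟩ := D.exists_core (hσ t)
      have h1 : ∀ᶠ s in 𝓝 t, σ s ∈ γ.carrier := by
        have h2 : σ t ∈ γ.carrier ∩ dev ⁻¹' Metric.thickening 8 (γ.model Mp) :=
          ⟨hγ.1, Metric.self_subset_thickening (by norm_num) _ ⟨_, hγ, rfl⟩⟩
        filter_upwards [σ.continuous.continuousAt.preimage_mem_nhds
          (D.isOpen_carrier_inter.mem_nhds h2)] with s hs
        exact hs.1
      filter_upwards [h1] with s hs
      have h3 : ∀ r, σ r ∈ γ.carrier →
          ((∀ γ : Piece Yp, σ r ∈ γ.carrier → D.pattern.G.Reachable α γ) ↔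
            D.pattern.G.Reachable α γ) := fun r hr =>
        ⟨fun h => h γ hr, fun h γ' hγ' => h.trans (D.reachable_of_mem hr hγ')⟩
      rw [h3 t hγ.1, h3 s hs]
  exact key 1 β (by rw [σ.target]; exact hβ)

/-- The pieces met by the component of `a₀` over `M` are those that a chain of meeting pieces joins
to a piece of `a₀`. -/
lemma mem_hat_iff (ha : a₀ ∈ α.core Mp) :
    b ∈ hat Mp a₀ ↔ ∃ β, D.pattern.G.Reachable α β ∧ b ∈ β.core Mp := by
  constructor
  · intro hb
    obtain ⟨β, hβ⟩ := D.exists_core hb.target_mem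
    exact ⟨β, D.reachable_of_hat ha.1 hb hβ.1, hβ⟩
  · rintro ⟨β, h, hb⟩
    exact D.joinedIn_of_reachable ha h hb

lemma dev_image_hat (ha : a₀ ∈ α.core Mp) :
    dev '' hat Mp a₀ = ⋃ β ∈ {β | D.pattern.G.Reachable α β}, β.model Mp := by
  ext p
  simp only [mem_iUnion, Piece.model]
  constructor
  · rintro ⟨b, hb, rfl⟩
    obtain ⟨β, h, hb⟩ := (D.mem_hat_iff ha).1 hb
    exact ⟨β, h, b, hb, rfl⟩
  · rintro ⟨β, h, b, hb, rfl⟩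
    exact ⟨b, (D.mem_hat_iff ha).2 ⟨β, h, hb⟩, rfl⟩

/-- An isometry that maps `a₀` to a germ joined to it over `M` permutes the pieces reachable from
the piece of `a₀`. -/
lemma reachable_smul_of_hat (ha : a₀ ∈ α.carrier) (hg : g • a₀ ∈ hat Mp a₀)
    (h : D.pattern.G.Reachable α β) : D.pattern.G.Reachable α (g • β) :=
  (D.reachable_of_hat ha hg (Piece.smul_mem_smul.2 ha)).trans (D.reachable_smul h)

lemma smul_mem_hat_of_reachable (ha : a₀ ∈ α.core Mp) (h : D.pattern.G.Reachable α β)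
    (h' : D.pattern.G.Reachable α (g • β)) : g • a₀ ∈ hat Mp a₀ :=
  D.joinedIn_of_reachable ha (h'.trans (D.reachable_smul h.symm)) (Piece.smul_mem_core.2 ha)

omit D [T2Space Y] in
lemma smul_mem_hat (hg : g • a₀ ∈ hat Mp a₀) (hb : b ∈ hat Mp a₀) : g • b ∈ hat Mp a₀ :=
  JoinedIn.trans hg (JoinedIn.smul_germ hb g)

omit D [T2Space Y] in
lemma inv_smul_mem_hat (hg : g • a₀ ∈ hat Mp a₀) : g⁻¹ • a₀ ∈ hat Mp a₀ := by
  have := JoinedIn.smul_germ hg g⁻¹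
  rw [inv_smul_smul] at this
  exact this.symm

/-! ### The lift of the hull -/

variable (α) in
/-- The lift to germs of the `5`-neighbourhood of the developing image of `M`. -/
noncomputable def lift (p : H3) : GermSpace Y :=
  open Classical in
  if h : ∃ β, D.pattern.G.Reachable α β ∧ p ∈ Metric.cthickening 5 (β.model Mp) then
    D.sec h.choose p else D.sec α p

/-- The sections of the pieces agree where the `5`-neighbourhoods of the models overlap, because two
reachable pieces whose models are that close are equal or meet. -/
lemma lift_eq (h : D.pattern.G.Reachable α β) (hp : p ∈ Metric.cthickening 5 (β.model Mp)) :
    D.lift α p = D.sec β p := by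
  have hex : ∃ β, D.pattern.G.Reachable α β ∧ p ∈ Metric.cthickening 5 (β.model Mp) := ⟨β, h, hp⟩
  rw [lift, dif_pos hex]
  obtain ⟨h1, h2⟩ := hex.choose_spec
  have h58 : ∀ P : Piece Yp,
      Metric.cthickening 5 (P.model Mp) ⊆ Metric.cthickening 8 (P.model Mp) :=
    fun P => Metric.cthickening_mono (by norm_num) _
  rcases D.pattern.eq_or_adj (h1.symm.trans h) h2 hp with e | ⟨-, a, ha, hb⟩
  · rw [e]
  · exact D.sec_eq_sec ha hb (h58 _ h2) (h58 _ hp)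

variable (α) in
/-- An open neighbourhood of the developing image of `M` to which its inclusion extends. -/
def near : Set H3 := {p | ∃ β, D.pattern.G.Reachable α β ∧ p ∈ Metric.thickening 5 (β.model Mp)}

lemma isOpen_near : IsOpen (D.near α) := by
  have : D.near α = ⋃ β ∈ {β | D.pattern.G.Reachable α β}, Metric.thickening 5 (β.model Mp) := by
    ext p; simp [near]
  rw [this]
  exact isOpen_biUnion fun _ _ => Metric.isOpen_thickening

lemma lift_eq_of_thickening (h : D.pattern.G.Reachable α β)
    (hp : p ∈ Metric.thickening 5 (β.model Mp)) : D.lift α p = D.sec β p :=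
  D.lift_eq h (Metric.thickening_subset_cthickening _ _ hp)

lemma dev_lift (hp : p ∈ D.near α) : (D.lift α p).dev = p := by
  obtain ⟨β, h, hp⟩ := hp
  rw [D.lift_eq_of_thickening h hp]
  exact D.dev_sec (Metric.thickening_subset_cthickening_of_le (by norm_num) _ hp)

lemma lift_mem (h : D.pattern.G.Reachable α β) (hp : p ∈ Metric.cthickening 5 (β.model Mp)) :
    D.lift α p ∈ β.carrier := by
  rw [D.lift_eq h hp]
  exact D.sec_mem (Metric.cthickening_mono (by norm_num) _ hp)

lemma continuousOn_lift : ContinuousOn (D.lift α) (D.near α) := by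
  rintro p ⟨β, h, hp⟩
  refine ContinuousAt.continuousWithinAt ?_
  have hn := Metric.isOpen_thickening.mem_nhds hp
  have h1 : ContinuousAt (D.sec β) p := (D.continuousOn_sec β).continuousAt
    (mem_of_superset hn (Metric.thickening_subset_cthickening_of_le (by norm_num) _))
  refine h1.congr ?_
  filter_upwards [hn] with q hq
  exact (D.lift_eq_of_thickening h hq).symm

lemma continuousAt_lift (hp : p ∈ D.near α) : ContinuousAt (D.lift α) p :=
  D.continuousOn_lift.continuousAt (D.isOpen_near.mem_nhds hp)

lemma lift_dev_eventually (hp : p ∈ D.near α) :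
    ∀ᶠ b in 𝓝 (D.lift α p), b.dev ∈ D.near α ∧ D.lift α b.dev = b := by
  obtain ⟨β, h, hp⟩ := hp
  have h58 := Metric.thickening_subset_cthickening_of_le (show (5 : ℝ) ≤ 8 by norm_num)
    (β.model Mp)
  have h0 := D.dev_lift ⟨β, h, hp⟩
  have h1 : ∀ᶠ b in 𝓝 (D.lift α p), b.dev ∈ Metric.thickening 5 (β.model Mp) :=
    continuous_dev.continuousAt.preimage_mem_nhds
      (Metric.isOpen_thickening.mem_nhds (by rw [h0]; exact hp))
  have h2 : D.lift α p ∈ β.carrier ∩ dev ⁻¹' Metric.thickening 8 (β.model Mp) :=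
    ⟨D.lift_mem h (Metric.thickening_subset_cthickening _ _ hp), by
      change (D.lift α p).dev ∈ Metric.thickening 8 (β.model Mp)
      rw [h0]; exact Metric.thickening_mono (by norm_num) _ hp⟩
  filter_upwards [h1, D.isOpen_carrier_inter.mem_nhds h2] with b h3 h4
  refine ⟨⟨β, h, h3⟩, ?_⟩
  rw [D.lift_eq_of_thickening h h3]
  exact D.sec_dev h4.1 (h58 h3)

lemma nhds_lift (hp : p ∈ D.near α) : 𝓝 (D.lift α p) = map (D.lift α) (𝓝 p) := by
  refine le_antisymm ?_ (D.continuousAt_lift hp)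
  have h1 : Tendsto dev (𝓝 (D.lift α p)) (𝓝 p) := by
    have := continuous_dev.tendsto (D.lift α p)
    rwa [D.dev_lift hp] at this
  intro s hs
  filter_upwards [h1.eventually hs, D.lift_dev_eventually hp] with b h2 h3
  rw [← h3.2]
  exact h2

lemma lift_map (ha : a₀ ∈ α.carrier) (hg : g • a₀ ∈ hat Mp a₀) (hp : p ∈ D.near α) :
    D.lift α (g p) = g • D.lift α p := by
  obtain ⟨β, h, hp⟩ := hp
  have hp' := Metric.thickening_subset_cthickening _ _ hp
  rw [D.lift_eq h hp', D.lift_eq (D.reachable_smul_of_hat ha hg h)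
    (Piece.cthickening_model_smul hp')]
  exact D.sec_smul (Metric.cthickening_mono (by norm_num) _ hp')

lemma lift_dev (ha : a₀ ∈ α.core Mp) (hb : b ∈ hat Mp a₀) : D.lift α b.dev = b := by
  obtain ⟨β, h, hb⟩ := (D.mem_hat_iff ha).1 hb
  have hm : b.dev ∈ β.model Mp := ⟨b, hb, rfl⟩
  rw [D.lift_eq h (H3.mem_cthickening_of_mem hm)]
  exact D.sec_dev hb.1 (H3.mem_cthickening_of_mem hm)

lemma exists_map_eq (ha : a₀ ∈ α.core Mp) (hp : p ∈ D.near α) (hq : q ∈ D.near α)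
    (e : (D.lift α p).pt = (D.lift α q).pt) :
    ∃ g : H3 ≃ᵢ H3, g • a₀ ∈ hat Mp a₀ ∧ g p = q := by
  obtain ⟨g, hg⟩ := exists_smul_eq e
  have hd := congrArg dev hg
  rw [smul_dev, D.dev_lift hp, D.dev_lift hq] at hd
  refine ⟨g, ?_, hd⟩
  obtain ⟨β, h, hp⟩ := hp
  obtain ⟨β', h', hq⟩ := hq
  have h1 := D.lift_mem h (Metric.thickening_subset_cthickening _ _ hp)
  have h2 := D.lift_mem h' (Metric.thickening_subset_cthickening _ _ hq)
  rw [← hg] at h2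
  exact D.smul_mem_hat_of_reachable ha h
    (h'.trans (D.reachable_of_mem h2 (Piece.smul_mem_smul.2 h1)))

variable (α) in
/-- An open convex neighbourhood of the developing image of `M`. The radius `1/4` is chosen so that
the hull stays within `19/4 < 5` of the models. -/
def dom : Set H3 :=
  H3.hull (⋃ β ∈ {β | D.pattern.G.Reachable α β}, Metric.thickening (1 / 4) (β.model Mp))

lemma isOpen_dom : IsOpen (D.dom α) :=
  H3.isOpen_hull (isOpen_biUnion fun _ _ => Metric.isOpen_thickening)

lemma geodConvex_dom : H3.GeodConvex (D.dom α) := H3.geodConvex_hull _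

lemma thickening_subset_dom (h : D.pattern.G.Reachable α β) :
    Metric.thickening (1 / 4) (β.model Mp) ⊆ D.dom α :=
  (subset_biUnion_of_mem (u := fun β : Piece Yp => Metric.thickening (1 / 4) (β.model Mp))
    h).trans (H3.subset_hull _)

lemma dom_subset_nhd : D.dom α ⊆ D.pattern.nhd α (19 / 4) := by
  refine (H3.hull_mono ?_).trans D.pattern.hull_nhd_subset
  refine iUnion₂_subset fun β hβ p hp => ⟨β, hβ, ?_⟩
  exact Metric.thickening_subset_cthickening _ _ hp

lemma dom_subset_near : D.dom α ⊆ D.near α := by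
  intro p hp
  obtain ⟨β, h, hp⟩ := D.dom_subset_nhd hp
  exact ⟨β, h, Metric.cthickening_subset_thickening' (by norm_num) (by norm_num) _ hp⟩

lemma hull_subset_dom (ha : a₀ ∈ α.core Mp) : H3.hull (dev '' hat Mp a₀) ⊆ D.dom α := by
  rw [D.dev_image_hat ha]
  refine H3.hull_mono (iUnion₂_mono fun β hβ => ?_)
  exact Metric.self_subset_thickening (by norm_num) _

lemma map_mem_dom (ha : a₀ ∈ α.carrier) (hg : g • a₀ ∈ hat Mp a₀) (hp : p ∈ D.dom α) :
    g p ∈ D.dom α := by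
  have h1 : g p ∈ g '' D.dom α := ⟨p, hp, rfl⟩
  rw [dom, ← H3.hull_image] at h1
  refine H3.hull_mono ?_ h1
  rintro _ ⟨q, hq, rfl⟩
  obtain ⟨β, h, hq⟩ := mem_iUnion₂.1 hq
  refine mem_iUnion₂.2 ⟨g • β, D.reachable_smul_of_hat ha hg h, ?_⟩
  rw [Piece.model_smul, Metric.thickening, mem_ofPred_eq, Metric.infEDist_image g.isometry]
  exact hq

end Decomposition

/-! ### Geodesic paths in `ℍ³` and the path metric -/

namespace H3

/-- The constant speed geodesic of `ℍ³` between two points. -/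
lemma exists_geodesic_path (p q : H3) : ∃ σ : Path p q, (∀ t, Btw p (σ t) q) ∧
    ∀ s t, dist (σ s) (σ t) = dist p q * dist s t := by
  have hex : ∀ t : unitInterval, ∃ z, Btw p z q ∧ dist p z = dist p q * t := fun t =>
    exists_btw p q (mul_nonneg dist_nonneg t.2.1) (mul_le_of_le_one_right dist_nonneg t.2.2)
  choose f hf hd using hex
  have hle : ∀ s t : unitInterval, s ≤ t → dist (f s) (f t) = dist p q * dist s t := by
    intro s t hst
    have hst' : (s : ℝ) ≤ t := hst
    have h1 : Btw p (f s) (f t) := (hf s).btw_of_le (hf t) (by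
      rw [hd, hd]; exact mul_le_mul_of_nonneg_left hst' dist_nonneg)
    have h2 : dist p (f s) + dist (f s) (f t) = dist p (f t) := h1
    rw [hd, hd] at h2
    rw [dist_comm s t, Subtype.dist_eq, Real.dist_eq, abs_of_nonneg (by linarith)]
    linarith
  have hdist : ∀ s t, dist (f s) (f t) = dist p q * dist s t := by
    intro s t
    rcases le_total s t with h | h
    · exact hle s t h
    · rw [dist_comm, hle t s h, dist_comm t s]
  have hlip : LipschitzWith ⟨dist p q, dist_nonneg⟩ f :=
    LipschitzWith.of_dist_le_mul fun s t => (hdist s t).le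
  refine ⟨⟨⟨f, hlip.continuous⟩, ?_, ?_⟩, hf, hdist⟩
  · have := hd 0
    rw [Icc.coe_zero, mul_zero] at this
    exact (dist_eq_zero.1 this).symm
  · have h1 := hd 1
    rw [Icc.coe_one, mul_one] at h1
    have h2 : dist p (f 1) + dist (f 1) q = dist p q := hf 1
    exact dist_eq_zero.1 (by linarith)

end H3

lemma eVariationOn_le_of_lipschitz {E : Type*} [PseudoEMetricSpace E] {C : NNReal}
    {f : unitInterval → E} (h : LipschitzWith C f) : eVariationOn f univ ≤ C := by
  have h1 := (h.lipschitzOnWith (s := univ)).comp_eVariationOn_le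
    (mapsTo_univ (id : unitInterval → unitInterval) univ)
  have h2 : eVariationOn (id : unitInterval → unitInterval) univ ≤ 1 := by
    have h3 : MonotoneOn (Subtype.val : unitInterval → ℝ) univ := fun _ _ _ _ h => h
    have h4 := (h3.eVariationOn_eq (mem_univ 0) (mem_univ 1)).le
    have h5 : (univ : Set unitInterval) ∩ Icc 0 1 = univ :=
      eq_univ_of_forall fun t => ⟨mem_univ t, t.2.1, t.2.2⟩
    rw [h5] at h4
    refine le_trans (le_of_eq ?_) (h4.trans (by simp))
    rfl
  calc eVariationOn f univ ≤ C * eVariationOn (id : unitInterval → unitInterval) univ := h1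
    _ ≤ C * 1 := by gcongr
    _ = C := mul_one _

/-- The path metric is bounded by the length of the development of a path of germs. -/
lemma GermSpace.hypEDist_le {X : Type u} [TopologicalSpace X] [HypStructure X] [Rigid X]
    {a b : GermSpace X} (σ : Path a b) :
    hypEDist a.pt b.pt ≤ eVariationOn (fun t => (σ t).dev) univ :=
  iInf_le_of_le (σ.map continuous_pt) (iInf_le_of_le (fun t => (σ t).chart)
    (iInf_le_of_le (isContinuation_of_path σ) le_rfl))

lemma isEmbedding_domRestrict_of_nhds {S T : Type*} [TopologicalSpace S] [TopologicalSpace T]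
    {f : S → T} {U V : Set S} (hU : IsOpen U) (hn : ∀ x ∈ U, 𝓝 (f x) = map f (𝓝 x))
    (hinj : InjOn f U) (hV : V ⊆ U) : IsEmbedding (V.domRestrict f) := by
  have h1 : IsOpenEmbedding (U.domRestrict f) := by
    refine IsOpenEmbedding.of_continuous_injective_isOpenMap ?_ (injOn_iff_injective.1 hinj) ?_
    · rw [← continuousOn_iff_continuous_domRestrict]
      exact fun x hx => ContinuousAt.continuousWithinAt (hn x hx).ge
    · refine IsOpenMap.of_nhds_le fun x => le_of_eq ?_
      calc 𝓝 (f x) = map f (map Subtype.val (𝓝 x)) := by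
            rw [hU.isOpenEmbedding_subtypeVal.map_nhds_eq x, hn x x.2]
        _ = _ := map_map
  exact h1.isEmbedding.comp (IsEmbedding.inclusion hV)

namespace Decomposition

open GermSpace

variable {Y : Type u} [TopologicalSpace Y] [HypStructure Y] {m : ℕ}
  {Mp Yp : Fin (m + 1) → Set Y} {α β : Piece Yp} {a₀ : GermSpace Y} {p q : H3}
  {g : H3 ≃ᵢ H3} [Rigid Y] [T2Space Y] (D : Decomposition Mp Yp)

include D

lemma hypEDist_lift_le (hp : p ∈ D.dom α) (hq : q ∈ D.dom α) :
    hypEDist (D.lift α p).pt (D.lift α q).pt ≤ ENNReal.ofReal (dist p q) := by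
  obtain ⟨σ, h1, h2⟩ := H3.exists_geodesic_path p q
  have hdom : ∀ t, σ t ∈ D.dom α := fun t => D.geodConvex_dom p hp q hq _ (h1 t)
  have hsub : range σ ⊆ D.near α := by
    rintro _ ⟨t, rfl⟩
    exact D.dom_subset_near (hdom t)
  have h3 := GermSpace.hypEDist_le (σ.map' (D.continuousOn_lift.mono hsub))
  have h4 : (fun t => ((σ.map' (D.continuousOn_lift.mono hsub)) t).dev) = σ := by
    ext1 t
    exact D.dev_lift (D.dom_subset_near (hdom t))
  rw [h4] at h3
  refine h3.trans ((eVariationOn_le_of_lipschitz (C := ⟨dist p q, dist_nonneg⟩)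
    (LipschitzWith.of_dist_le_mul fun s t => (h2 s t).le)).trans (le_of_eq ?_))
  rw [ENNReal.ofReal, Real.toNNReal_of_nonneg dist_nonneg]
  rfl

lemma pt_lift_mem (hβ : D.pattern.G.Reachable α β) (hq : q ∈ β.model Mp) :
    (D.lift α q).pt ∈ Mp β.idx := by
  rw [D.lift_eq hβ (H3.mem_cthickening_of_mem hq)]
  obtain ⟨b, hb, rfl⟩ := hq
  rw [D.sec_dev hb.1 (H3.mem_cthickening_of_mem ⟨b, hb, rfl⟩)]
  exact hb.2

lemma lift_mem_hypNhd {A : Set Y} {r : ℝ} (hr : 0 ≤ r) (hβ : D.pattern.G.Reachable α β)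
    (hA : Mp β.idx ⊆ A) (hp : p ∈ D.dom α) (h : Metric.infDist p (β.model Mp) ≤ r) :
    (D.lift α p).pt ∈ hypNhd r A := by
  refine ENNReal.le_of_forall_pos_le_add fun δ hδ _ => ?_
  obtain ⟨q, hq, hpq⟩ := (Metric.infDist_lt_iff (D.model_nonempty β) (r := r + δ)).1
    (lt_of_le_of_lt h (by simpa using hδ))
  have hq' : q ∈ D.dom α :=
    D.thickening_subset_dom hβ (Metric.self_subset_thickening (by norm_num) _ hq)
  have hqA : (D.lift α q).pt ∈ A := hA (D.pt_lift_mem hβ hq)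
  refine (iInf₂_le _ hqA).trans ((D.hypEDist_lift_le hp hq').trans ?_)
  rw [← ENNReal.ofReal_coe_nnreal, ← ENNReal.ofReal_add hr (NNReal.coe_nonneg δ)]
  exact ENNReal.ofReal_le_ofReal hpq.le

/-! ### Realization of the hull -/

variable {b : BaseGerm (⋃ i, Mp i)}

lemma mem_holonomy_iff (hb : b.Extends a₀) : g ∈ b.holonomy ↔ g • a₀ ∈ hat Mp a₀ := by
  have := D.manifold_M.rigid
  have h0 : a₀.pt ∈ ⋃ i, Mp i := by rw [hb.1]; exact b.pt.2
  constructor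
  · intro hg
    refine Subgroup.closure_induction (p := fun g _ => g • a₀ ∈ hat Mp a₀) ?_ ?_ ?_ ?_ hg
    · rintro g ⟨γ, hγ⟩
      obtain ⟨a', h1, h2, h3, -⟩ := hb.exists_of_continuesTo hγ
      obtain ⟨g', rfl⟩ := exists_smul_eq (a := a₀) (b := a') (hb.1.trans h2.symm)
      have : g' = g := by
        refine Rigid.eq_of_eventuallyEq b.isChartAt ?_
        filter_upwards [h3, hb.2] with z h4 h5
        rw [smul_chart, h5] at h4
        exact h4
      rw [← this]
      exact h1
    · rw [one_smul]; exact JoinedIn.refl h0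
    · intro x y _ _ hx hy
      rw [mul_smul]
      exact smul_mem_hat hx hy
    · intro x _ hx
      exact inv_smul_mem_hat hx
  · intro hg
    obtain ⟨γ, Φ, h1, h2, h3⟩ := hb.exists_continuesTo (y := b.pt) hg hb.1
    refine Subgroup.subset_closure ⟨γ, Φ, h1, h2, h3.trans ?_⟩
    filter_upwards [hb.2] with z h5
    rw [smul_chart, h5]
    rfl

omit D [Rigid Y] [T2Space Y] in
lemma proj_eq_iff : b.proj p = b.proj q ↔ ∃ g ∈ b.holonomy, g p = q := Quotient.eq

omit D [Rigid Y] [T2Space Y] in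
lemma isOpenMap_proj : IsOpenMap b.proj := by
  intro V hV
  have : b.proj ⁻¹' (b.proj '' V) = ⋃ g ∈ b.holonomy, g '' V := by
    ext p
    simp only [mem_preimage, mem_image, mem_iUnion, proj_eq_iff]
    exact ⟨fun ⟨x, hx, g, hg, e⟩ => ⟨g, hg, x, hx, e⟩, fun ⟨g, hg, x, hx, e⟩ => ⟨x, hx, g, hg, e⟩⟩
  refine isOpen_coinduced.2 ?_
  change IsOpen (b.proj ⁻¹' (b.proj '' V))
  rw [this]
  exact isOpen_biUnion fun g _ => g.toHomeomorph.isOpenMap V hV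

omit D [Rigid Y] [T2Space Y] in
lemma continuous_proj : Continuous b.proj := continuous_quotient_mk'

variable (α b) in
/-- The map to `Y` of the quotient by the holonomy of the neighbourhood `dom`. -/
noncomputable def toY (x : b.UnivThickening) : Y := (D.lift α (Quotient.out x)).pt

lemma out_proj (p : H3) : ∃ g ∈ b.holonomy, Quotient.out (b.proj p) = g p := by
  obtain ⟨g, hg, e⟩ := proj_eq_iff.1 (show b.proj p = b.proj (Quotient.out (b.proj p)) from
    (Quotient.out_eq (b.proj p)).symm)
  exact ⟨g, hg, e.symm⟩

lemma toY_proj (hb : b.Extends a₀) (ha : a₀ ∈ α.core Mp) (hp : p ∈ D.dom α) :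
    D.toY α b (b.proj p) = (D.lift α p).pt := by
  obtain ⟨g, hg, e⟩ := D.out_proj (b := b) p
  rw [D.mem_holonomy_iff hb] at hg
  rw [toY, e, D.lift_map ha.1 hg (D.dom_subset_near hp)]
  rfl

/-- The map to `Y` is injective modulo the holonomy: two points of `dom` over the same point of `Y`
lift to germs of reachable pieces that differ by an isometry, which lies in the holonomy. -/
lemma proj_eq_of_pt_eq (hb : b.Extends a₀) (ha : a₀ ∈ α.core Mp) (hp : p ∈ D.dom α)
    (hq : q ∈ D.dom α) (e : (D.lift α p).pt = (D.lift α q).pt) : b.proj p = b.proj q := by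
  obtain ⟨g, hg, e⟩ := D.exists_map_eq ha (D.dom_subset_near hp) (D.dom_subset_near hq) e
  exact proj_eq_iff.2 ⟨g, (D.mem_holonomy_iff hb).2 hg, e⟩

lemma nhds_toY (hb : b.Extends a₀) (ha : a₀ ∈ α.core Mp) (hp : p ∈ D.dom α) :
    𝓝 (D.toY α b (b.proj p)) = map (D.toY α b) (𝓝 (b.proj p)) := by
  have h1 : map b.proj (𝓝 p) = 𝓝 (b.proj p) :=
    le_antisymm continuous_proj.continuousAt (isOpenMap_proj.nhds_le p)
  have h2 : map (pt : GermSpace Y → Y) (𝓝 (D.lift α p)) = 𝓝 (D.lift α p).pt :=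
    le_antisymm continuous_pt.continuousAt (isOpenMap_pt.nhds_le _)
  rw [D.toY_proj hb ha hp, ← h2, D.nhds_lift (D.dom_subset_near hp), ← h1, map_map, map_map]
  refine map_congr ?_
  filter_upwards [D.isOpen_dom.mem_nhds hp] with q hq
  exact (D.toY_proj hb ha hq).symm

lemma isEmbedding_toY (hb : b.Extends a₀) (ha : a₀ ∈ α.core Mp) {S : Set b.UnivThickening}
    (hS : S ⊆ b.proj '' D.dom α) : IsEmbedding fun x : S => D.toY α b x := by
  have hn : ∀ x ∈ b.proj '' D.dom α, 𝓝 (D.toY α b x) = map (D.toY α b) (𝓝 x) := by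
    rintro _ ⟨p, hp, rfl⟩
    exact D.nhds_toY hb ha hp
  have hinj : InjOn (D.toY α b) (b.proj '' D.dom α) := by
    rintro _ ⟨p, hp, rfl⟩ _ ⟨q, hq, rfl⟩ e
    rw [D.toY_proj hb ha hp, D.toY_proj hb ha hq] at e
    exact D.proj_eq_of_pt_eq hb ha hp hq e
  exact isEmbedding_domRestrict_of_nhds (isOpenMap_proj _ D.isOpen_dom) hn hinj hS

lemma convexHull_subset (hb : b.Extends a₀) (ha : a₀ ∈ α.core Mp) :
    b.convexHull ⊆ b.proj '' D.dom α := by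
  have := D.manifold_M.rigid
  rw [BaseGerm.convexHull, hb.devImage_eq]
  exact image_mono (D.hull_subset_dom ha)

lemma mem_dom_of_proj (hb : b.Extends a₀) (ha : a₀ ∈ α.core Mp)
    (h : b.proj p ∈ b.convexHull) : p ∈ D.dom α := by
  obtain ⟨q, hq, e⟩ := D.convexHull_subset hb ha h
  obtain ⟨g, hg, rfl⟩ := proj_eq_iff.1 e
  exact D.map_mem_dom ha.1 ((D.mem_holonomy_iff hb).1 hg) hq

/-- The lift descends to a locally isometric embedding of the convex hull into `Y` that extends the
inclusion of `M`. -/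
theorem isRealization (hb : b.Extends a₀) (ha : a₀ ∈ α.core Mp) :
    b.IsRealization Subtype.val b.convexHull fun x => D.toY α b x where
  isEmbedding := D.isEmbedding_toY hb ha (D.convexHull_subset hb ha)
  localIsometry p hp := by
    have hpd := D.mem_dom_of_proj hb ha hp
    refine ⟨(D.lift α p).chart, ?_, ?_⟩
    · rw [D.toY_proj hb ha hpd]
      exact (D.lift α p).isChartAt
    · have h1 := (tendsto_nhds_iff.1 (D.continuousAt_lift (D.dom_subset_near hpd))).2
      filter_upwards [h1, D.isOpen_dom.mem_nhds hpd] with q h2 hq _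
      rw [D.toY_proj hb ha hq, ← h2.self_of_nhds]
      exact D.dev_lift (D.dom_subset_near hq)
  extends_inclusion y γ ψ h := by
    have := D.manifold_M.rigid
    obtain ⟨a', h1, h2, -, h3⟩ := hb.exists_of_continuesTo h
    rw [← h3]
    have h4 : a'.dev ∈ H3.hull (dev '' hat Mp a₀) := H3.subset_hull _ ⟨a', h1, rfl⟩
    refine ⟨⟨a'.dev, ?_, rfl⟩, ?_⟩
    · rw [hb.devImage_eq]; exact h4
    · change D.toY α b (b.proj a'.dev) = y
      rw [D.toY_proj hb ha (D.hull_subset_dom ha h4), D.lift_dev ha h1, h2]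

/-- The estimate on distances in `ℍ³` passes to `Y`, since the lift of a geodesic in `dom` is a path
of the same length. -/
theorem range_subset (hb : b.Extends a₀) (ha : a₀ ∈ α.core Mp) {ε d : ℝ} (hd : 0 < d)
    (hε : 6 * (Real.exp (-d) * Real.sinh 8) ≤ ε) :
    range (fun x : b.convexHull => D.toY α b x) ⊆
      hypNhd ε (Mp 0) ∪ hypNhd (8 + 3 * d) (⋃ i ∈ {i : Fin (m + 1) | i ≠ 0}, Mp i) := by
  have := D.manifold_M.rigid
  rintro _ ⟨⟨_, p, hp, rfl⟩, rfl⟩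
  rw [hb.devImage_eq] at hp
  have hpd := D.hull_subset_dom ha hp
  have hp' : p ∈ H3.hull (dev '' hat Mp a₀) := hp
  rw [D.dev_image_hat ha] at hp'
  have h := (D.pattern.hull_subset_fine hd hp').2
  change D.toY α b (b.proj p) ∈ _
  rw [D.toY_proj hb ha hpd]
  rcases h with ⟨β, hβ, hz, hle⟩ | ⟨β, hβ, hz, -, hle⟩
  · right
    exact D.lift_mem_hypNhd (by linarith) hβ
      (subset_biUnion_of_mem (u := Mp) (show β.idx ∈ {i : Fin (m + 1) | i ≠ 0} from hz)) hpd hle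
  · left
    have hz' : β.idx = 0 := hz
    have h1 := Real.self_le_sinh_iff.2 (Metric.infDist_nonneg (x := p) (s := β.model Mp))
    have h2 : Metric.infDist p (β.model Mp) ≤ ε := h1.trans (hle.trans hε)
    exact D.lift_mem_hypNhd (Metric.infDist_nonneg.trans h2) hβ (by rw [hz']) hpd h2

end Decomposition

/-! ### The convex neighbourhood of `M` -/

/-- An open subset of a hyperbolic 3-manifold is a hyperbolic 3-manifold. -/
lemma IsHyp3Manifold.of_isOpen {X : Type u} [TopologicalSpace X] [HypStructure X]
    (h : IsHyp3Manifold X) {U : Set X} (hU : IsOpen U) : IsHyp3Manifold U where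
  t2 := by have := h.t2; infer_instance
  secondCountable := by have := h.secondCountable; infer_instance
  manifold := by
    obtain ⟨hc⟩ := h.manifold
    exact ⟨inferInstanceAs (ChartedSpace (EuclideanHalfSpace 3)
      (⟨U, hU⟩ : TopologicalSpace.Opens X))⟩
  codimZero := by
    rintro _ ⟨c, hc, rfl⟩
    obtain ⟨O, hO, hOU⟩ := c.isEmbedding.isInducing.isOpen_iff.1
      (hU.preimage (continuous_subtype_val (p := fun y => y ∈ c.source)))
    have hmem : ∀ y (hy : y ∈ c.source), c.toFun y ∈ O ↔ y ∈ U := fun y hy =>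
      Set.ext_iff.1 hOU ⟨y, hy⟩
    have e : (c.restrict U).toFun '' (c.restrict U).source = O ∩ c.toFun '' c.source := by
      ext p
      constructor
      · rintro ⟨y, hy, rfl⟩
        exact ⟨(hmem y hy).2 y.2, y, hy, rfl⟩
      · rintro ⟨hp, y, hy, rfl⟩
        exact ⟨⟨y, (hmem y hy).1 hp⟩, hy, rfl⟩
    rw [e, interior_inter, hO.interior_eq]
    exact (inter_subset_inter_right O (h.codimZero c hc)).trans hO.inter_closure

lemma isIsometricInclusion_inclusion {X : Type u} [TopologicalSpace X] [HypStructure X]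
    {A B : Set X} (h : A ⊆ B) : IsIsometricInclusion (inclusion h) where
  isEmbedding := IsEmbedding.inclusion h
  localIsometry x φ hφ := by
    obtain ⟨ψ, h1, h2⟩ := hφ.exists_extension
    have h3 : ∀ᶠ y in 𝓝 x, φ (inclusion h y) = ψ y :=
      ((continuous_inclusion h).tendsto x).eventually h2
    exact (h1.restrict (x := x)).congr (EventuallyEq.symm h3)

lemma H3.GeodConvex.simplyConnectedSpace {S : Set H3} (h : H3.GeodConvex S) (hne : S.Nonempty) :
    SimplyConnectedSpace S := by
  have := (H3.geodConvex_iff.1 h).contractibleSpace (hne.image _)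
  have := (H3.isOpenEmbedding_klein.isEmbedding.homeomorphImage S).contractibleSpace
  exact SimplyConnectedSpace.ofContractible S

namespace Decomposition

open GermSpace

variable {Y : Type u} [TopologicalSpace Y] [HypStructure Y] {m : ℕ}
  {Mp Yp : Fin (m + 1) → Set Y} {α β : Piece Yp} {a₀ b : GermSpace Y} {p q : H3}
  {g : H3 ≃ᵢ H3} [Rigid Y] [T2Space Y] (D : Decomposition Mp Yp)

variable (α) in
/-- The quotient of `dom` by the holonomy of `M`, as an open subset of `Y`. -/
def hullNhd : Set Y := {y | ∃ p ∈ D.dom α, (D.lift α p).pt = y}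

variable (α) in
/-- The covering map of `hullNhd`. -/
noncomputable def cov (p : D.dom α) : D.hullNhd α := ⟨(D.lift α p).pt, p, p.2, rfl⟩

include D

lemma continuous_lift_dom : Continuous fun p : D.dom α => D.lift α p :=
  continuousOn_iff_continuous_domRestrict.1 (D.continuousOn_lift.mono D.dom_subset_near)

lemma continuous_cov : Continuous (D.cov α) :=
  (continuous_pt.comp D.continuous_lift_dom).subtype_mk _

lemma surjective_cov : Function.Surjective (D.cov α) := by
  rintro ⟨_, p, hp, rfl⟩
  exact ⟨⟨p, hp⟩, rfl⟩

lemma nhds_pt_lift (hp : p ∈ D.near α) :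
    𝓝 (D.lift α p).pt = map (fun p => (D.lift α p).pt) (𝓝 p) := by
  have h2 : map (pt : GermSpace Y → Y) (𝓝 (D.lift α p)) = 𝓝 (D.lift α p).pt :=
    le_antisymm continuous_pt.continuousAt (isOpenMap_pt.nhds_le _)
  rw [← h2, D.nhds_lift hp, map_map]
  rfl

lemma isOpenMap_cov : IsOpenMap (D.cov α) := by
  refine IsOpenMap.of_nhds_le fun p => ?_
  rw [nhds_subtype_eq_comap]
  have h1 : 𝓝 ((D.cov α p).1) = map (Subtype.val ∘ D.cov α) (𝓝 p) := by
    change 𝓝 (D.lift α p).pt = _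
    rw [D.nhds_pt_lift (D.dom_subset_near p.2),
      ← D.isOpen_dom.isOpenEmbedding_subtypeVal.map_nhds_eq p, map_map]
    rfl
  rw [h1, ← map_map, comap_map Subtype.val_injective]

lemma isOpen_hullNhd : IsOpen (D.hullNhd α) := by
  rw [isOpen_iff_mem_nhds]
  rintro _ ⟨p, hp, rfl⟩
  rw [D.nhds_pt_lift (D.dom_subset_near hp), mem_map]
  filter_upwards [D.isOpen_dom.mem_nhds hp] with q hq
  exact ⟨q, hq, rfl⟩

lemma isOpenQuotientMap_cov : IsOpenQuotientMap (D.cov α) :=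
  ⟨D.surjective_cov, D.continuous_cov, D.isOpenMap_cov⟩

lemma dom_nonempty : (D.dom α).Nonempty := by
  obtain ⟨p, hp⟩ := D.model_nonempty α
  exact ⟨p, D.thickening_subset_dom (SimpleGraph.Reachable.refl α)
    (Metric.self_subset_thickening (by norm_num) _ hp)⟩

lemma smul_lift_mem (ha : a₀ ∈ α.core Mp) (hp : p ∈ D.dom α) (hq : q ∈ D.dom α)
    (h : g • D.lift α p = D.lift α q) : g • a₀ ∈ hat Mp a₀ := by
  have hp' := D.dom_subset_near hp
  have hq' := D.dom_subset_near hq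
  obtain ⟨g', hg', e⟩ := D.exists_map_eq ha hp' hq' (by rw [← h]; rfl)
  have : g' = g := by
    refine smul_left_injective (a := D.lift α p) ?_
    rw [h, ← e, D.lift_map ha.1 hg' hp']
  rwa [← this]

/-- Paths over `hullNhd` that start in the lift of `dom` remain there. -/
lemma mem_of_joinedIn (ha : a₀ ∈ α.core Mp) (hp : p ∈ D.dom α)
    (σ : Path (D.lift α p) b) (hσ : ∀ t, (σ t).pt ∈ D.hullNhd α) (t : unitInterval) :
    (σ t).dev ∈ D.dom α ∧ D.lift α (σ t).dev = σ t := by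
  let W : Set (GermSpace Y) := {b | b.dev ∈ D.dom α ∧ D.lift α b.dev = b}
  have hW : ∀ q ∈ D.dom α, D.lift α q ∈ W ∧ W ∈ 𝓝 (D.lift α q) := by
    intro q hq
    have hd := D.dev_lift (D.dom_subset_near hq)
    have h1 : ∀ᶠ b in 𝓝 (D.lift α q), b.dev ∈ D.dom α :=
      continuous_dev.continuousAt.preimage_mem_nhds (D.isOpen_dom.mem_nhds (by rwa [hd]))
    have h2 : W ∈ 𝓝 (D.lift α q) := by
      filter_upwards [h1, D.lift_dev_eventually (D.dom_subset_near hq)] with b h3 h4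
      exact ⟨h3, h4.2⟩
    exact ⟨mem_of_mem_nhds h2, h2⟩
  -- a translate of the lift of `dom` that meets it is equal to it
  have hWg : ∀ g : H3 ≃ᵢ H3, ∀ b ∈ W, g • b ∈ W → ∀ c ∈ W, g • c ∈ W := by
    intro g b hb hgb c hc
    have h1 : g • a₀ ∈ hat Mp a₀ :=
      D.smul_lift_mem ha hb.1 hgb.1 (by rw [hb.2, hgb.2])
    have h2 := D.lift_map ha.1 h1 (D.dom_subset_near hc.1)
    rw [hc.2] at h2
    rw [← h2]
    exact (hW _ (D.map_mem_dom ha.1 h1 hc.1)).1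
  have := PreconnectedSpace.induction₂ (α := unitInterval) (fun s t => σ s ∈ W ↔ σ t ∈ W) ?_
    ⟨fun _ _ _ h h' => h.trans h'⟩ 0 t
  · refine this.1 ?_
    rw [σ.source]
    exact (hW p hp).1
  · intro t
    obtain ⟨q, hq, e⟩ := hσ t
    obtain ⟨g, hg⟩ := exists_smul_eq e
    have h1 : ∀ᶠ s in 𝓝 t, g⁻¹ • σ s ∈ W := by
      have h2 : Tendsto (fun s => g⁻¹ • σ s) (𝓝 t) (𝓝 (D.lift α q)) := by
        have := ((continuous_const_smul g⁻¹).comp σ.continuous).tendsto t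
        simpa [← hg, Function.comp_def] using this
      exact h2.eventually (hW q hq).2
    have h0 : g⁻¹ • σ t ∈ W := by rw [← hg, inv_smul_smul]; exact (hW q hq).1
    filter_upwards [h1] with s hs
    constructor
    · intro h
      have := hWg g _ h0 (by rwa [smul_inv_smul]) _ hs
      rwa [smul_inv_smul] at this
    · intro h
      have := hWg g _ hs (by rwa [smul_inv_smul]) _ h0
      rwa [smul_inv_smul] at this

/-- Paths in `hullNhd` lift to `dom`. -/
lemma exists_lift_dom (ha : a₀ ∈ α.core Mp) (p : D.dom α) {y : D.hullNhd α}
    (γ : Path (D.cov α p) y) : ∃ (q : D.dom α) (σ : Path p q), ∀ t, D.cov α (σ t) = γ t := by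
  obtain ⟨b, σ, hb, hσ⟩ := exists_lift_subset (a := D.lift α p) (A := D.hullNhd α)
    (D.cov α p).2 γ
  have h := D.mem_of_joinedIn ha p.2 σ (fun t => by rw [hσ]; exact (γ t).2)
  have hd := D.dev_lift (D.dom_subset_near p.2)
  refine ⟨⟨(σ 1).dev, (h 1).1⟩, ⟨⟨fun t => ⟨(σ t).dev, (h t).1⟩, ?_⟩, ?_, rfl⟩, ?_⟩
  · exact (continuous_dev.comp σ.continuous).subtype_mk _
  · exact Subtype.ext (by simp [hd])
  · intro t
    refine Subtype.ext ?_
    exact (congrArg pt (h t).2).trans (hσ t)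

/-- `hullNhd` is convex because its universal cover is `dom`, a convex subset of `ℍ³`. -/
theorem isConvexHyp3Manifold_hullNhd (ha : a₀ ∈ α.core Mp) :
    IsConvexHyp3Manifold (D.hullNhd α) where
  manifold := D.manifold.of_isOpen D.isOpen_hullNhd
  connected := by
    have h1 : ConnectedSpace (D.dom α) := Subtype.connectedSpace
      (D.geodConvex_dom.isPathConnected D.dom_nonempty).isConnected
    exact D.surjective_cov.connectedSpace D.continuous_cov
  convex := by
    rintro x₀ ⟨x, c⟩ ⟨y, d⟩
    obtain ⟨γ, rfl⟩ := Path.Homotopic.Quotient.mk_surjective c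
    obtain ⟨δ, rfl⟩ := Path.Homotopic.Quotient.mk_surjective d
    obtain ⟨p, rfl⟩ := D.surjective_cov x₀
    obtain ⟨q, σ, hσ⟩ := D.exists_lift_dom ha p γ
    obtain ⟨r, τ, hτ⟩ := D.exists_lift_dom ha p δ
    obtain rfl : D.cov α q = x := by rw [← σ.target, hσ, γ.target]
    obtain rfl : D.cov α r = y := by rw [← τ.target, hτ, δ.target]
    obtain ⟨ζ, h1, h2⟩ := H3.exists_geodesic_path q.1 r.1
    have hζ : ∀ t, ζ t ∈ D.dom α := fun t => D.geodConvex_dom q q.2 r r.2 _ (h1 t)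
    let ξ : Path q r := ⟨⟨fun t => ⟨ζ t, hζ t⟩, ζ.continuous.subtype_mk _⟩,
      Subtype.ext ζ.source, Subtype.ext ζ.target⟩
    refine ⟨ξ.map D.continuous_cov, ⟨dist q.1 r.1, fun t => ?_⟩, ?_⟩
    · refine ⟨fun z => (D.lift α (ζ t)).chart z,
        IsChartAt.restrict (x := D.cov α (ξ t)) (D.lift α (ζ t)).isChartAt, ?_⟩
      have h3 := (tendsto_nhds_iff.1 (D.continuous_lift_dom.tendsto (ξ t))).2
      refine ⟨_, (ξ.continuous.tendsto t).eventually h3, ?_⟩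
      have h4 : ∀ s, (D.lift α (ζ s)).chart =ᶠ[𝓝 (D.lift α (ζ s)).pt] (D.lift α (ζ t)).chart →
          (D.lift α (ζ t)).chart (D.lift α (ζ s)).pt = ζ s := fun s hs => by
        rw [← hs.self_of_nhds]
        exact D.dev_lift (D.dom_subset_near (hζ s))
      intro s hs s' hs'
      refine Eq.trans ?_ (h2 s s')
      exact congrArg₂ dist (h4 s hs) (h4 s' hs')
    · have := D.geodConvex_dom.simplyConnectedSpace (D.dom_nonempty (α := α))
      have h3 : ((σ.trans ξ).map D.continuous_cov).Homotopic (τ.map D.continuous_cov) :=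
        (SimplyConnectedSpace.paths_homotopic (σ.trans ξ) τ).map ⟨_, D.continuous_cov⟩
      rw [Path.map_trans] at h3
      have e1 : σ.map D.continuous_cov = γ := Path.ext (funext hσ)
      have e2 : τ.map D.continuous_cov = δ := Path.ext (funext hτ)
      rw [e1, e2] at h3
      exact Path.Homotopic.Quotient.eq.2 h3

lemma exists_mem_model (ha : a₀ ∈ α.core Mp) {x : Y} (hx : x ∈ ⋃ i, Mp i) :
    ∃ β, D.pattern.G.Reachable α β ∧ ∃ q ∈ β.model Mp, (D.lift α q).pt = x := by
  have := D.manifold_M.locallyPathConnectedSpace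
  have := D.connected_M
  have hpc : PathConnectedSpace (⋃ i, Mp i) := pathConnectedSpace_iff_connectedSpace.2 this
  have ha' : a₀.pt ∈ ⋃ i, Mp i := mem_iUnion.2 ⟨_, ha.2⟩
  obtain ⟨γ⟩ := hpc.joined ⟨a₀.pt, ha'⟩ ⟨x, hx⟩
  obtain ⟨b, σ, hb, hσ⟩ := exists_lift_subset ha' γ
  have hb' : b ∈ hat Mp a₀ := ⟨σ, fun t => by
    change (σ t).pt ∈ ⋃ i, Mp i; rw [hσ]; exact (γ t).2⟩
  obtain ⟨β, h, hβ⟩ := (D.mem_hat_iff ha).1 hb'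
  exact ⟨β, h, b.dev, ⟨b, hβ, rfl⟩, by rw [D.lift_dev ha hb', hb]⟩

lemma model_subset_dom (h : D.pattern.G.Reachable α β) : β.model Mp ⊆ D.dom α :=
  (Metric.self_subset_thickening (by norm_num) _).trans (D.thickening_subset_dom h)

lemma union_subset_hullNhd (ha : a₀ ∈ α.core Mp) : (⋃ i, Mp i) ⊆ D.hullNhd α := by
  intro x hx
  obtain ⟨β, h, q, hq, e⟩ := D.exists_mem_model ha hx
  exact ⟨q, D.model_subset_dom h hq, e⟩

end Decomposition

/-! ### Deformation of the convex neighbourhood onto `M` -/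

namespace H3

lemma center_congr {ι : Type*} {s s' : Finset ι} {w w' : ι → ℝ} {a a' : ι → H3}
    (h : ∑ i ∈ s, w i • (a i).lin = ∑ i ∈ s', w' i • (a' i).lin) :
    center s w a = center s' w' a' := by
  rw [center, center, h]

lemma continuous_lin : Continuous (lin : H3 → ℝ × EuclideanSpace ℝ (Fin 3)) :=
  continuous_time.prodMk continuous_vec

lemma continuousAt_center {ι T : Type*} [TopologicalSpace T] {s : Finset ι} {w : T → ι → ℝ}
    {a : T → ι → H3} {t : T} (hw : ∀ i ∈ s, ContinuousAt (fun t => w t i) t)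
    (ha : ∀ i ∈ s, ContinuousAt (fun t => a t i) t) (h0 : ∀ i ∈ s, 0 ≤ w t i)
    (h : ∃ i ∈ s, 0 < w t i) : ContinuousAt (fun t => center s (w t) (a t)) t := by
  have hu : ContinuousAt (fun t => ∑ i ∈ s, w t i • (a t i).lin) t :=
    tendsto_finsetSum s fun i hi =>
      (hw i hi).smul (continuous_lin.continuousAt.comp (ha i hi))
  have hm : ContinuousAt (fun t => mink (∑ i ∈ s, w t i • (a t i).lin)
      (∑ i ∈ s, w t i • (a t i).lin)) t := by
    unfold mink
    exact (hu.fst.mul hu.fst).sub (hu.snd.inner hu.snd)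
  have hpos := mink_sum_pos (a := a t) h0 h
  have hr : ContinuousAt (fun t => (Real.sqrt (mink (∑ i ∈ s, w t i • (a t i).lin)
      (∑ i ∈ s, w t i • (a t i).lin)))⁻¹) t :=
    (Real.continuous_sqrt.continuousAt.comp hm).inv₀ (Real.sqrt_pos.2 hpos).ne'
  exact continuous_mk.continuousAt.comp (hr.smul hu.snd)

/-- The points of the segment from `p` to `q` (with a projective parametrization). -/
noncomputable def mid (t : ℝ) (p q : H3) : H3 :=
  center Finset.univ (fun i : Bool => cond i t (1 - t)) fun i => cond i q p

variable {t : ℝ} {p q : H3}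

lemma mid_weight_nonneg (ht : t ∈ Icc (0 : ℝ) 1) :
    ∀ i ∈ (Finset.univ : Finset Bool), 0 ≤ cond i t (1 - t) := by
  rintro (_ | _) -
  · exact sub_nonneg.2 ht.2
  · exact ht.1

lemma mid_weight_pos (t : ℝ) : ∃ i ∈ (Finset.univ : Finset Bool), 0 < cond i t (1 - t) := by
  rcases lt_or_ge 0 t with h | h
  · exact ⟨true, Finset.mem_univ _, h⟩
  · exact ⟨false, Finset.mem_univ _, by change 0 < 1 - t; linarith⟩

lemma mid_mem {S : Set H3} (hS : GeodConvex S) (ht : t ∈ Icc (0 : ℝ) 1) (hp : p ∈ S) (hq : q ∈ S) :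
    mid t p q ∈ S :=
  center_mem hS (mid_weight_nonneg ht) (mid_weight_pos t) (by rintro (_ | _) -; exacts [hp, hq])

lemma map_mid (g : H3 ≃ᵢ H3) (ht : t ∈ Icc (0 : ℝ) 1) : g (mid t p q) = mid t (g p) (g q) := by
  rw [mid, map_center g (mid_weight_nonneg ht) (mid_weight_pos t)]
  refine center_congr (Finset.sum_congr rfl ?_)
  rintro (_ | _) - <;> rfl

lemma mid_zero : mid 0 p q = p := by
  obtain ⟨c, hc, e⟩ := lin_center (a := fun i => cond i q p)
    (mid_weight_nonneg ⟨le_rfl, zero_le_one⟩) (mid_weight_pos 0)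
  refine eq_of_lin_eq_smul (c := c) ?_ hc.le
  rw [mid, e]
  simp

lemma mid_one : mid 1 p q = q := by
  obtain ⟨c, hc, e⟩ := lin_center (a := fun i => cond i q p)
    (mid_weight_nonneg ⟨zero_le_one, le_rfl⟩) (mid_weight_pos 1)
  refine eq_of_lin_eq_smul (c := c) ?_ hc.le
  rw [mid, e]
  simp

lemma continuous_mid {T : Type*} [TopologicalSpace T] {f : T → unitInterval} {p q : T → H3}
    (hf : Continuous f) (hp : Continuous p) (hq : Continuous q) :
    Continuous fun x => mid (f x) (p x) (q x) := by
  rw [continuous_iff_continuousAt]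
  intro x
  refine continuousAt_center ?_ ?_ (mid_weight_nonneg (f x).2) (mid_weight_pos _)
  · have hf' := continuous_subtype_val.comp hf
    rintro (_ | _) -
    · exact (continuous_const.sub hf').continuousAt
    · exact hf'.continuousAt
  · rintro (_ | _) -
    · exact hp.continuousAt
    · exact hq.continuousAt

end H3

/-- A homotopy of the identity that preserves a subspace and ends in it gives a homotopy
equivalence. -/
lemma exists_homotopyEquiv_of_deformation {X : Type u} [TopologicalSpace X] {A B : Set X}
    (h : A ⊆ B) (H : C(unitInterval × B, B)) (h0 : ∀ x, H (0, x) = x)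
    (h1 : ∀ x, (H (1, x) : X) ∈ A) (hA : ∀ t (x : B), (x : X) ∈ A → (H (t, x) : X) ∈ A) :
    ∃ e : A ≃ₕ B, (e : A → B) = inclusion h := by
  let i : C(A, B) := ⟨inclusion h, continuous_inclusion h⟩
  let r : C(B, A) := ⟨fun x => ⟨H (1, x), h1 x⟩,
    (continuous_subtype_val.comp (H.continuous.comp (by fun_prop))).subtype_mk _⟩
  refine ⟨⟨i, r, ⟨ContinuousMap.Homotopy.symm ?_⟩, ⟨ContinuousMap.Homotopy.symm ?_⟩⟩, rfl⟩
  · exact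
      { toFun := fun x => ⟨H (x.1, i x.2), hA _ _ x.2.2⟩
        continuous_toFun :=
          (continuous_subtype_val.comp (H.continuous.comp (by fun_prop))).subtype_mk _
        map_zero_left := fun x => Subtype.ext (by simp [h0, i])
        map_one_left := fun x => rfl }
  · exact
      { toFun := fun x => H (x.1, x.2)
        continuous_toFun := H.continuous
        map_zero_left := fun x => h0 x
        map_one_left := fun x => rfl }

namespace Decomposition

open GermSpace

variable {Y : Type u} [TopologicalSpace Y] [HypStructure Y] {m : ℕ}
  {Mp Yp : Fin (m + 1) → Set Y} {α β : Piece Yp} {a₀ b : GermSpace Y} {p q : H3}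
  {g : H3 ≃ᵢ H3} [Rigid Y] [T2Space Y] (D : Decomposition Mp Yp)

include D

/-- At most two models come close to a given point, and these have a common point. -/
lemma exists_mem_models (hp : p ∈ D.dom α) : ∃ a : H3, ∀ y, dist y p ≤ 1 / 4 →
    ∀ β, D.pattern.G.Reachable α β → y ∈ Metric.cthickening (19 / 4) (β.model Mp) →
      a ∈ β.model Mp := by
  suffices h : ∃ a : H3, ∀ β, D.pattern.G.Reachable α β →
      p ∈ Metric.cthickening 5 (β.model Mp) → a ∈ β.model Mp by
    obtain ⟨a, ha⟩ := h
    -- `19/4 + 1/4 = 5` is the radius up to which reachable pieces close to a point are adjacent.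
    refine ⟨a, fun y hy β hβ hyβ => ha β hβ ?_⟩
    have := H3.mem_cthickening_add (by norm_num) hyβ hy
    rwa [show (19 / 4 + 1 / 4 : ℝ) = 5 by norm_num] at this
  obtain ⟨β, hβ, hpβ⟩ := D.dom_subset_nhd hp
  have hpβ5 : p ∈ Metric.cthickening 5 (β.model Mp) :=
    Metric.cthickening_mono (by norm_num) _ hpβ
  by_cases h : ∃ γ, D.pattern.G.Reachable α γ ∧ γ ≠ β ∧ p ∈ Metric.cthickening 5 (γ.model Mp)
  · obtain ⟨γ, hγ, hne, hpγ⟩ := h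
    have hadj : D.pattern.G.Adj β γ :=
      (D.pattern.eq_or_adj (hβ.symm.trans hγ) hpβ5 hpγ).resolve_left hne.symm
    obtain ⟨a, ha1, ha2⟩ := D.pattern.meet _ _ hadj
    refine ⟨a, fun δ hδ hpδ => ?_⟩
    rcases D.pattern.eq_or_adj (hβ.symm.trans hδ) hpβ5 hpδ with rfl | h1
    · exact ha1
    rcases D.pattern.eq_or_adj (hγ.symm.trans hδ) hpγ hpδ with rfl | h2
    · exact ha2
    have e1 := D.pattern.bipartite _ _ hadj
    have e2 := D.pattern.bipartite _ _ h1
    have e3 := D.pattern.bipartite _ _ h2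
    tauto
  · obtain ⟨a, ha⟩ := D.model_nonempty β
    refine ⟨a, fun δ hδ hpδ => ?_⟩
    by_contra hc
    exact h ⟨δ, hδ, fun e => hc (e ▸ ha), hpδ⟩

/-- Locally in `dom` there is a constant map into the developing image of `M` that respects the
models of all nearby pieces, on a set that is disjoint from its nontrivial translates. -/
lemma exists_local_data (i : D.dom α) : ∃ (W : Set H3) (a : H3), IsOpen W ∧ i.1 ∈ W ∧ W ⊆ D.dom α ∧
    (∀ y ∈ W, ∀ β, D.pattern.G.Reachable α β → y ∈ Metric.cthickening (19 / 4) (β.model Mp) →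
      a ∈ β.model Mp) ∧
    ∀ g : H3 ≃ᵢ H3, ∀ y ∈ W, g y ∈ W → D.lift α (g y) = g • D.lift α y → g = 1 := by
  obtain ⟨a, ha⟩ := D.exists_mem_models i.2
  obtain ⟨U, hU, hUd⟩ := isQuotientCoveringMap_pt.disjoint (D.lift α i)
  have h1 : ∀ᶠ y in 𝓝 i.1, y ∈ D.dom α ∧ y ∈ Metric.ball i.1 (1 / 4) ∧ D.lift α y ∈ U :=
    inter_mem (D.isOpen_dom.mem_nhds i.2) (inter_mem (Metric.ball_mem_nhds _ (by norm_num))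
      (D.continuousAt_lift (D.dom_subset_near i.2) hU))
  obtain ⟨W, hW, hWo, hiW⟩ := eventually_nhds_iff.1 h1
  refine ⟨W, a, hWo, hiW, fun y hy => (hW y hy).1, ?_, ?_⟩
  · exact fun y hy => ha y (Metric.mem_ball.1 (hW y hy).2.1).le
  · intro g y hy hgy e
    refine hUd g ⟨g • D.lift α y, ⟨_, (hW y hy).2.2, rfl⟩, ?_⟩
    rw [← e]
    exact (hW _ hgy).2.2

lemma cov_eq_iff (ha : a₀ ∈ α.core Mp) {y y' : D.dom α} :
    D.cov α y = D.cov α y' ↔ ∃ g : H3 ≃ᵢ H3, g • a₀ ∈ hat Mp a₀ ∧ g y = y' := by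
  constructor
  · intro h
    exact D.exists_map_eq ha (D.dom_subset_near y.2) (D.dom_subset_near y'.2)
      (congrArg Subtype.val h)
  · rintro ⟨g, hg, e⟩
    refine Subtype.ext ?_
    change (D.lift α y).pt = (D.lift α y').pt
    rw [← e, D.lift_map ha.1 hg (D.dom_subset_near y.2)]
    rfl

lemma paracompact_hullNhd : ParacompactSpace (D.hullNhd α) ∧ NormalSpace (D.hullNhd α) := by
  have h := D.manifold.of_isOpen (D.isOpen_hullNhd (α := α))
  have := h.t2
  have := h.secondCountable
  obtain ⟨hc⟩ := h.manifold
  have : LocallyCompactSpace (EuclideanHalfSpace 3) :=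
    ModelWithCorners.locallyCompactSpace (modelWithCornersEuclideanHalfSpace 3)
  have := ChartedSpace.locallyCompactSpace (EuclideanHalfSpace 3) (D.hullNhd α)
  exact ⟨inferInstance, inferInstance⟩

/-- A continuous map from `dom` to the developing image of `M` that is equivariant under the
holonomy and maps the points close to the model of a piece to this model. It is obtained by
averaging locally constant maps by means of a partition of unity on the quotient. -/
theorem exists_equivariant (ha : a₀ ∈ α.core Mp) : ∃ F : D.dom α → H3, Continuous F ∧
    (∀ g : H3 ≃ᵢ H3, g • a₀ ∈ hat Mp a₀ → ∀ y y' : D.dom α, g y = y' → F y' = g (F y)) ∧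
    ∀ β, D.pattern.G.Reachable α β → ∀ y : D.dom α,
      (y : H3) ∈ Metric.cthickening (19 / 4) (β.model Mp) → F y ∈ β.model Mp := by
  classical
  choose W a hWo hiW hWd hWa hWg using D.exists_local_data (α := α)
  obtain ⟨hpara, hnorm⟩ := D.paracompact_hullNhd (α := α)
  let V : D.dom α → Set (D.hullNhd α) := fun i => D.cov α '' (Subtype.val ⁻¹' W i)
  obtain ⟨ρ, hρ⟩ := PartitionOfUnity.exists_isSubordinate isClosed_univ V
    (fun i => D.isOpenMap_cov _ ((hWo i).preimage continuous_subtype_val)) (fun x _ => by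
      obtain ⟨i, rfl⟩ := D.surjective_cov x
      exact mem_iUnion.2 ⟨i, i, hiW i, rfl⟩)
  have hV : ∀ i (y : D.dom α), D.cov α y ∈ V i →
      ∃ g : H3 ≃ᵢ H3, g • a₀ ∈ hat Mp a₀ ∧ ∃ w ∈ W i, g w = y := by
    rintro i y ⟨w, hw, e⟩
    obtain ⟨g, hg, e'⟩ := (D.cov_eq_iff ha).1 e
    exact ⟨g, hg, w, hw, e'⟩
  -- the locally constant map on the orbit of `W i` with value `a i` on `W i`
  let b : D.dom α → H3 → H3 := fun i y =>
    if h : ∃ g : H3 ≃ᵢ H3, g • a₀ ∈ hat Mp a₀ ∧ g.symm y ∈ W i then h.choose (a i) else y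
  have hb : ∀ i (g : H3 ≃ᵢ H3), g • a₀ ∈ hat Mp a₀ → ∀ w ∈ W i, b i (g w) = g (a i) := by
    intro i g hg w hw
    have hex : ∃ g' : H3 ≃ᵢ H3, g' • a₀ ∈ hat Mp a₀ ∧ g'.symm (g w) ∈ W i :=
      ⟨g, hg, by rwa [g.symm_apply_apply]⟩
    have e0 : b i (g w) = hex.choose (a i) := dif_pos hex
    obtain ⟨h1, h2⟩ := hex.choose_spec
    rw [e0]
    obtain ⟨g', hg'⟩ : ∃ g', g' = hex.choose := ⟨_, rfl⟩
    rw [← hg'] at h1 h2 ⊢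
    have h3 : (g'⁻¹ * g) • a₀ ∈ hat Mp a₀ := by
      rw [mul_smul]
      exact smul_mem_hat (inv_smul_mem_hat h1) hg
    have h4 : g'⁻¹ * g = 1 := hWg i _ w hw h2
      (D.lift_map ha.1 h3 (D.dom_subset_near (hWd i hw)))
    rw [inv_mul_eq_one.1 h4]
  let F : D.dom α → H3 := fun y =>
    H3.center (ρ.finsupport (D.cov α y)) (fun i => ρ i (D.cov α y)) fun i => b i y
  have hnn : ∀ x, ∀ i ∈ ρ.finsupport x, 0 ≤ ρ i x := fun x i _ => ρ.nonneg i x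
  have hpos : ∀ x, ∃ i ∈ ρ.finsupport x, 0 < ρ i x := by
    intro x
    obtain ⟨i, hi⟩ := ρ.exists_pos (mem_univ x)
    exact ⟨i, (ρ.mem_finsupport x).2 hi.ne', hi⟩
  have hsupp : ∀ i (y : D.dom α), i ∈ ρ.finsupport (D.cov α y) → D.cov α y ∈ V i := fun i y hi =>
    hρ i (subset_tsupport _ ((ρ.mem_finsupport _).1 hi))
  refine ⟨F, ?_, ?_, ?_⟩
  · rw [continuous_iff_continuousAt]
    intro y₀
    obtain ⟨s, hs⟩ : ∃ s, s = ρ.fintsupport (D.cov α y₀) := ⟨_, rfl⟩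
    have h1 : ∀ᶠ y in 𝓝 y₀, ρ.finsupport (D.cov α y) ⊆ s := by
      rw [hs]
      exact (D.continuous_cov.tendsto y₀).eventually (ρ.eventually_finsupport_subset _)
    have h2 : ∀ᶠ y in 𝓝 y₀,
        H3.center s (fun i => ρ i (D.cov α y)) (fun i => b i y) = F y := by
      filter_upwards [h1] with y hy
      refine H3.center_congr (Finset.sum_subset hy fun i _ hi => ?_).symm
      rw [ρ.mem_finsupport, Function.notMem_support] at hi
      rw [hi, zero_smul]
    refine ContinuousAt.congr (H3.continuousAt_center (fun i _ => ?_) (fun i hi => ?_) ?_ ?_) h2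
    · exact ((ρ i).continuous.comp D.continuous_cov).continuousAt
    · rw [hs, ρ.mem_fintsupport_iff] at hi
      obtain ⟨g, hg, w, hw, e⟩ := hV i y₀ (hρ i hi)
      have h3 : ∀ᶠ y : D.dom α in 𝓝 y₀, g.symm y ∈ W i := by
        have : Continuous fun y : D.dom α => g.symm y :=
          g.symm.continuous.comp continuous_subtype_val
        refine this.continuousAt.preimage_mem_nhds ((hWo i).mem_nhds ?_)
        rwa [← e, g.symm_apply_apply]
      refine (continuousAt_const (y := g (a i))).congr ?_
      filter_upwards [h3] with y hy
      rw [← hb i g hg _ hy, g.apply_symm_apply]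
    · exact fun i _ => ρ.nonneg i _
    · obtain ⟨i, hi, h⟩ := hpos (D.cov α y₀)
      exact ⟨i, hs ▸ ρ.finsupport_subset_fintsupport _ hi, h⟩
  · intro g hg y y' e
    have hc : D.cov α y' = D.cov α y := ((D.cov_eq_iff ha).2 ⟨g, hg, e⟩).symm
    change H3.center _ _ _ = g (H3.center _ _ _)
    rw [H3.map_center g (hnn _) (hpos _), hc]
    refine H3.center_congr (Finset.sum_congr rfl fun i hi => ?_)
    obtain ⟨h, hh, w, hw, e'⟩ := hV i y (hsupp i y hi)
    have h1 : (g * h) • a₀ ∈ hat Mp a₀ := by rw [mul_smul]; exact smul_mem_hat hg hh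
    have h2 := hb i _ h1 w hw
    have h3 : (g * h) w = y' := by rw [← e, ← e']; rfl
    rw [h3] at h2
    rw [h2, ← e', hb i h hh w hw]
    rfl
  · intro β hβ y hy
    refine H3.center_mem (D.geodConvex_model β) (hnn _) (hpos _) fun i hi => ?_
    obtain ⟨h, hh, w, hw, e⟩ := hV i y (hsupp i y hi)
    rw [← e, hb i h hh w hw]
    have h1 := D.reachable_smul_of_hat ha.1 (inv_smul_mem_hat hh) hβ
    have h2 : w ∈ Metric.cthickening (19 / 4) ((h⁻¹ • β).model Mp) := by
      have := Piece.cthickening_model_smul (g := h⁻¹) hy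
      rw [← e] at this
      have e2 : h⁻¹ (h w) = w := h.symm_apply_apply w
      rwa [e2] at this
    have h3 := hWa i w hw _ h1 h2
    rw [Piece.model_smul] at h3
    obtain ⟨c, hc, e3⟩ := h3
    rw [← e3]
    have e4 : h (h⁻¹ c) = c := h.apply_symm_apply c
    rwa [e4]

/-- Both homotopies run along segments from `y` to `F y`; they stay over `M` when `y` does because a
point of a model and its image under `F` lie in the same convex model. -/
theorem exists_homotopyEquiv (ha : a₀ ∈ α.core Mp) :
    ∃ e : (⋃ i, Mp i : Set Y) ≃ₕ D.hullNhd α,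
      (e : (⋃ i, Mp i : Set Y) → D.hullNhd α) = inclusion (D.union_subset_hullNhd ha) := by
  obtain ⟨F, hFc, hFg, hFm⟩ := D.exists_equivariant ha
  have hF : ∀ y : D.dom α, ∃ β, D.pattern.G.Reachable α β ∧ F y ∈ β.model Mp := by
    intro y
    obtain ⟨β, hβ, hy⟩ := D.dom_subset_nhd y.2
    exact ⟨β, hβ, hFm β hβ y hy⟩
  have hFd : ∀ y, F y ∈ D.dom α := fun y => by
    obtain ⟨β, hβ, h⟩ := hF y
    exact D.model_subset_dom hβ h
  let G : C(unitInterval × D.dom α, D.hullNhd α) :=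
    ⟨fun x => D.cov α ⟨H3.mid x.1 x.2 (F x.2),
      H3.mid_mem D.geodConvex_dom x.1.2 x.2.2 (hFd x.2)⟩,
      D.continuous_cov.comp ((H3.continuous_mid continuous_fst
        (continuous_subtype_val.comp continuous_snd) (hFc.comp continuous_snd)).subtype_mk _)⟩
  let c : C(unitInterval × D.dom α, unitInterval × D.hullNhd α) :=
    ⟨Prod.map id (D.cov α), continuous_id.prodMap D.continuous_cov⟩
  have hc : IsQuotientMap c :=
    (IsOpenQuotientMap.id.prodMap D.isOpenQuotientMap_cov).isQuotientMap
  have hG : ∀ x x', c x = c x' → G x = G x' := by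
    rintro ⟨t, y⟩ ⟨t', y'⟩ e
    obtain rfl : t = t' := congrArg Prod.fst e
    obtain ⟨g, hg, e'⟩ := (D.cov_eq_iff ha).1 (congrArg Prod.snd e)
    refine (D.cov_eq_iff ha).2 ⟨g, hg, ?_⟩
    change g (H3.mid t y (F y)) = H3.mid t y' (F y')
    rw [H3.map_mid g t.2, e', hFg g hg y y' e']
  let H : C(unitInterval × D.hullNhd α, D.hullNhd α) := hc.lift G hG
  have hH : ∀ t y, H (t, D.cov α y) = G (t, y) := fun t y =>
    DFunLike.congr_fun (hc.lift_comp G hG) (t, y)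
  refine exists_homotopyEquiv_of_deformation (D.union_subset_hullNhd ha) H ?_ ?_ ?_
  · intro x
    obtain ⟨y, rfl⟩ := D.surjective_cov x
    rw [hH]
    refine congrArg (D.cov α) (Subtype.ext ?_)
    exact H3.mid_zero
  · intro x
    obtain ⟨y, rfl⟩ := D.surjective_cov x
    rw [hH]
    obtain ⟨β, hβ, h⟩ := hF y
    refine mem_iUnion.2 ⟨β.idx, ?_⟩
    change (D.lift α (H3.mid 1 y (F y))).pt ∈ Mp β.idx
    rw [H3.mid_one]
    exact D.pt_lift_mem hβ h
  · intro t x hx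
    obtain ⟨β, hβ, q, hq, e⟩ := D.exists_mem_model ha hx
    obtain rfl : D.cov α ⟨q, D.model_subset_dom hβ hq⟩ = x := Subtype.ext e
    rw [hH]
    refine mem_iUnion.2 ⟨β.idx, D.pt_lift_mem hβ ?_⟩
    exact H3.mid_mem (D.geodConvex_model β) t.2 hq
      (hFm β hβ _ (H3.mem_cthickening_of_mem hq))

theorem hasConvexThickening (ha : a₀ ∈ α.core Mp) :
    HasConvexThickening (⋃ i, Mp i : Set Y) :=
  ⟨D.hullNhd α, inferInstance, inferInstance, inclusion (D.union_subset_hullNhd ha),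
    D.isConvexHyp3Manifold_hullNhd ha, isIsometricInclusion_inclusion _, D.exists_homotopyEquiv ha⟩

end Decomposition

theorem theorem2p5 (ε : ℝ) (hε : 0 < ε) :
    ∃ R : ℝ, 8 < R ∧
      ∀ (Y : Type u) [TopologicalSpace Y] [HypStructure Y] (m : ℕ)
        (Mp Yp : Fin (m + 1) → Set Y),
        -- `Y = Y₀ ∪ … ∪ Yₘ` and `M = M₀ ∪ … ∪ Mₘ` are connected hyperbolic 3-manifolds
        IsHyp3Manifold Y → ConnectedSpace Y → (⋃ i, Yp i) = univ →
        IsHyp3Manifold (⋃ i, Mp i) → ConnectedSpace (⋃ i, Mp i) →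
        -- the pieces are convex hyperbolic 3-manifolds
        (∀ i, IsConvexHyp3Manifold (Mp i)) → (∀ i, IsConvexHyp3Manifold (Yp i)) →
        -- `Yᵢ` is a thickening of `Mᵢ` and contains `Th₈(Mᵢ)`
        (∀ i, ∃ h : Mp i ⊆ Yp i, IsThickening (inclusion h) ∧
          ∀ b : BaseGerm (Mp i), ∃ j : b.thickening 8 → Yp i,
            b.IsRealization (inclusion h) (b.thickening 8) j) →
        -- if `Yᵢ` meets `Yⱼ` then `i = j` or one of the indices is `0`
        (∀ i j, (Yp i ∩ Yp j).Nonempty → i = j ∨ i = 0 ∨ j = 0) →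
        -- each component of `Yᵢ ∩ Yⱼ` contains a point of `Mᵢ ∩ Mⱼ`
        (∀ i j, ∀ x ∈ Yp i ∩ Yp j,
          (connectedComponentIn (Yp i ∩ Yp j) x ∩ (Mp i ∩ Mp j)).Nonempty) →
        -- then the convex hull of `M` is defined, lies in `Y`, and satisfies the inclusion
        HasConvexThickening (⋃ i, Mp i) ∧
        ∀ b : BaseGerm (⋃ i, Mp i), ∃ j : b.convexHull → Y,
          b.IsRealization Subtype.val b.convexHull j ∧
          range j ⊆ hypNhd ε (Mp 0) ∪ hypNhd R (⋃ i ∈ {i : Fin (m + 1) | i ≠ 0}, Mp i) := by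
  have hs : 0 < Real.sinh 8 := Real.sinh_pos_iff.2 (by norm_num)
  obtain ⟨d, hd0, hd⟩ : ∃ d : ℝ, 0 < d ∧ 6 * (Real.exp (-d) * Real.sinh 8) ≤ ε := by
    refine ⟨max 1 (Real.log (6 * Real.sinh 8 / ε)), lt_max_of_lt_left one_pos, ?_⟩
    have h1 : Real.exp (-max 1 (Real.log (6 * Real.sinh 8 / ε))) ≤ (6 * Real.sinh 8 / ε)⁻¹ := by
      rw [Real.exp_neg]
      refine inv_anti₀ (by positivity) ?_
      rw [← Real.log_le_iff_le_exp (by positivity)]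
      exact le_max_right _ _
    calc 6 * (Real.exp (-max 1 (Real.log (6 * Real.sinh 8 / ε))) * Real.sinh 8)
        ≤ 6 * ((6 * Real.sinh 8 / ε)⁻¹ * Real.sinh 8) := by gcongr
      _ = ε := by field_simp
  refine ⟨8 + 3 * d, by linarith, ?_⟩
  intro Y _ _ m Mp Yp hY _ _ hM hMc hMp hYp hpair hij hcomp
  have D : Decomposition Mp Yp :=
    { manifold := hY
      manifold_M := hM
      connected_M := hMc
      pair := fun i => by
        obtain ⟨h, ⟨-, he⟩, hr⟩ := hpair i
        exact ⟨h, hMp i, hYp i, he, hr⟩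
      eq_or_zero := hij
      component := hcomp }
  have := hY.rigid
  have := hY.t2
  have key : ∀ b : BaseGerm (⋃ i, Mp i), ∃ (a₀ : GermSpace Y) (α : Piece Yp),
      b.Extends a₀ ∧ a₀ ∈ α.core Mp := by
    intro b
    have := hM.rigid
    obtain ⟨a₀, ha₀⟩ := b.exists_extends
    obtain ⟨α, hα⟩ := D.exists_core (a := a₀) (by rw [ha₀.1]; exact b.pt.2)
    exact ⟨a₀, α, ha₀, hα⟩
  constructor
  · obtain ⟨x⟩ : Nonempty (⋃ i, Mp i : Set Y) := hMc.toNonempty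
    obtain ⟨c, hc, hx⟩ := HypStructure.cover x
    obtain ⟨a₀, α, -, hα⟩ := key ⟨x, c.toFun, c, hc, hx, 1, Eventually.of_forall fun _ => rfl⟩
    exact D.hasConvexThickening hα
  · intro b
    obtain ⟨a₀, α, hb, hα⟩ := key b
    exact ⟨_, D.isRealization hb hα, D.range_subset hb hα hd0 hd⟩
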